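/- Let $G=(A,B,E)$ be a bipartite graph with $E\subseteq A\times B$, given with a two-layered drawing: the vertices $a_1,\dots,a_{n_A}$ of $A$ and $b_1,\dots,b_{n_B}$ of $B$ are placed from left to right on two parallel lines. Two edges $a_ib_q$ and $a_jb_p$ form a \emph{crossing pair} if ($i<j$ and $p<q$) or ($i>j$ and $p>q$). Let $w\colon E\to\mathbb{R}$ be a positive weight function and let $\mathcal{X}$ be a set of crossing pairs of $G$ (the \emph{admissible} pairs). A matching $M\subseteq E$ is a \emph{2-CPE matching} if every crossing pair contained in $M$ belongs to $\mathcal{X}$ and every edge of $M$ crosses at most two other edges of $M$; its weight is $\sum_{e\in M}w(e)$. Put $n=n_A+n_B$, $m=|E|$ and $k=|\mathcal{X}|$. There is an algorithm which, for every such $(G,w,\mathcal{X})$, finds a 2-CPE matching of maximum weight in $$O\bigl(k^3+k^2n+m(m+\log n)\bigr)\ \text{time and}\ O(k^2+kn+m^2)\ \text{space}$$ (for $m=0$ both bounds are read as $O(1)$). Here an algorithm is a single program for a unit-cost random access machine whose words hold natural numbers bounded by a fixed power of $n+m+k+2$ and whose real cells can only be copied, added, subtracted and compared. The input consists of $n_A,n_B,m,k$,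 the edges with their weights listed in any order, and the admissible pairs listed in any order, each as a pair of positions in the edge list. Space is the number of memory cells, including those of the input. -/

import Mathlib

/-! ### The max-weighted `c`-CPE matching problem on two-layered bipartite graphs -/

namespace CPE

/-- A potential edge `a_i b_q` of a bipartite graph with layers `a_0, …, a_{nA-1}` and
`b_0, …, b_{nB-1}`, the vertices of each layer being numbered from left to right. -/
abbrev Edge (nA nB : ℕ) : Type := Fin nA × Fin nB

/-- Two edges make a crossing: their endpoints are in opposite orders on the two layers. -/
def Crosses {nA nB : ℕ} (e f : Edge nA nB) : Prop :=
  (e.1 < f.1 ∧ f.2 < e.2) ∨ (f.1 < e.1 ∧ e.2 < f.2)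

instance {nA nB : ℕ} (e f : Edge nA nB) : Decidable (Crosses e f) :=
  inferInstanceAs (Decidable (_ ∨ _))

/-- The set of all crossing pairs formed by edges of `E`. -/
def crossingPairs {nA nB : ℕ} (E : Finset (Edge nA nB)) : Set (Sym2 (Edge nA nB)) :=
  {p | ∃ e ∈ E, ∃ f ∈ E, Crosses e f ∧ p = s(e, f)}

/-- An instance: a two-layered bipartite graph, positive edge weights, and a set `X` of admissible
crossing pairs. -/
structure Problem where
  /-- number of vertices of the upper layer -/
  nA : ℕ
  /-- number of vertices of the lower layer -/
  nB : ℕ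
  /-- the edge set -/
  E : Finset (Edge nA nB)
  /-- the weight function (only its values on `E` matter) -/
  w : Edge nA nB → ℝ
  w_pos : ∀ e ∈ E, 0 < w e
  /-- the admissible set -/
  X : Finset (Sym2 (Edge nA nB))
  X_subset : (X : Set (Sym2 (Edge nA nB))) ⊆ crossingPairs E

namespace Problem

variable (I : Problem)

/-- number of vertices -/
def n : ℕ := I.nA + I.nB

/-- number of edges -/
def m : ℕ := I.E.card

/-- number of admissible pairs -/
def k : ℕ := I.X.card

/-- `M` is a matching of the graph. -/
def IsMatching (M : Finset (Edge I.nA I.nB)) : Prop :=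
  M ⊆ I.E ∧ ∀ e ∈ M, ∀ f ∈ M, e ≠ f → e.1 ≠ f.1 ∧ e.2 ≠ f.2

/-- `M` is a `c`-CPE matching: a matching in which every crossing pair is admissible and every edge
crosses at most `c` other edges. -/
def IsCPEMatching (c : ℕ) (M : Finset (Edge I.nA I.nB)) : Prop :=
  I.IsMatching M ∧ crossingPairs M ⊆ (I.X : Set (Sym2 (Edge I.nA I.nB))) ∧
    ∀ e ∈ M, (M.filter fun f => Crosses e f).card ≤ c

/-- The weight of an edge set. -/
noncomputable def weight (M : Finset (Edge I.nA I.nB)) : ℝ := ∑ e ∈ M, I.w e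

/-- `M` is a `c`-CPE matching of maximum weight. -/
def IsMaxCPEMatching (c : ℕ) (M : Finset (Edge I.nA I.nB)) : Prop :=
  I.IsCPEMatching c M ∧ ∀ M' : Finset (Edge I.nA I.nB), I.IsCPEMatching c M' →
    I.weight M' ≤ I.weight M

end Problem

end CPE

/-! ### A random access machine with word and real memory

Programs are while-programs over
* word registers and a word memory, holding natural numbers below a bound `W`, and
* real registers and a real memory, holding real numbers, which can only be copied, added,
  subtracted and compared.

A program names its registers by literals, so it uses a fixed finite number of them, while memory
cells are addressed indirectly by computed words. Each of the two memories has `S` cells. Accessing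
a cell outside the memory, or computing a word that is not below `W`, is a fault: it has no
execution. Every read of a register, literal or cell, every arithmetic operation, comparison,
Boolean operation, assignment and branch takes one unit of time. -/

namespace RAM

/-- A memory configuration. -/
structure Store where
  /-- word registers -/
  reg : ℕ → ℕ
  /-- word memory -/
  mem : ℕ → ℕ
  /-- real registers -/
  rreg : ℕ → ℝ
  /-- real memory -/
  rmem : ℕ → ℝ

/-- A word, if it is below the bound `W`; otherwise a fault. -/
def fit (W v : ℕ) : Option ℕ := if v < W then some v else none

/-- Word expressions; `sub` is truncated subtraction. -/
inductive NExp where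
  | lit (v : ℕ)
  | reg (r : ℕ)
  | load (a : NExp)
  | add (a b : NExp)
  | sub (a b : NExp)
  | mul (a b : NExp)

/-- Real expressions. -/
inductive RExp where
  | zero
  | reg (r : ℕ)
  | load (a : NExp)
  | add (x y : RExp)
  | sub (x y : RExp)

/-- Tests. -/
inductive BExp where
  | eq (a b : NExp)
  | lt (a b : NExp)
  | rlt (x y : RExp)
  | not (b : BExp)
  | and (b c : BExp)

/-- The value of a word expression, `none` being a fault. -/
def NExp.eval (W S : ℕ) (s : Store) : NExp → Option ℕ
  | .lit v => fit W v
  | .reg r => some (s.reg r)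
  | .load a => (a.eval W S s).bind fun i => if i < S then some (s.mem i) else none
  | .add a b => (a.eval W S s).bind fun u => (b.eval W S s).bind fun v => fit W (u + v)
  | .sub a b => (a.eval W S s).bind fun u => (b.eval W S s).bind fun v => fit W (u - v)
  | .mul a b => (a.eval W S s).bind fun u => (b.eval W S s).bind fun v => fit W (u * v)

/-- The value of a real expression, `none` being a fault. -/
noncomputable def RExp.eval (W S : ℕ) (s : Store) : RExp → Option ℝ
  | .zero => some 0
  | .reg r => some (s.rreg r)
  | .load a => (a.eval W S s).bind fun i => if i < S then some (s.rmem i) else none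
  | .add x y => (x.eval W S s).bind fun u => (y.eval W S s).bind fun v => some (u + v)
  | .sub x y => (x.eval W S s).bind fun u => (y.eval W S s).bind fun v => some (u - v)

/-- The value of a test, `none` being a fault. -/
noncomputable def BExp.eval (W S : ℕ) (s : Store) : BExp → Option Bool
  | .eq a b => (a.eval W S s).bind fun u => (b.eval W S s).bind fun v => some (decide (u = v))
  | .lt a b => (a.eval W S s).bind fun u => (b.eval W S s).bind fun v => some (decide (u < v))
  | .rlt x y => (x.eval W S s).bind fun u => (y.eval W S s).bind fun v => some (decide (u < v))
  | .not b => (b.eval W S s).bind fun u => some (!u)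
  | .and b c => (b.eval W S s).bind fun u => (c.eval W S s).bind fun v => some (u && v)

/-- Time to evaluate a word expression. -/
def NExp.cost : NExp → ℕ
  | .lit _ => 1
  | .reg _ => 1
  | .load a => a.cost + 1
  | .add a b => a.cost + b.cost + 1
  | .sub a b => a.cost + b.cost + 1
  | .mul a b => a.cost + b.cost + 1

/-- Time to evaluate a real expression. -/
def RExp.cost : RExp → ℕ
  | .zero => 1
  | .reg _ => 1
  | .load a => a.cost + 1
  | .add x y => x.cost + y.cost + 1
  | .sub x y => x.cost + y.cost + 1

/-- Time to evaluate a test. -/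
def BExp.cost : BExp → ℕ
  | .eq a b => a.cost + b.cost + 1
  | .lt a b => a.cost + b.cost + 1
  | .rlt x y => x.cost + y.cost + 1
  | .not b => b.cost + 1
  | .and b c => b.cost + c.cost + 1

/-- Programs. -/
inductive Prog where
  | skip
  | setReg (r : ℕ) (e : NExp)
  | setMem (a e : NExp)
  | setRReg (r : ℕ) (x : RExp)
  | setRMem (a : NExp) (x : RExp)
  | seq (p q : Prog)
  | ite (b : BExp) (p q : Prog)
  | loop (b : BExp) (p : Prog)

/-- `Exec W S p s t s'`: with words below `W` and `S` cells in each memory, the program `p`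
started in `s` halts without a fault after exactly `t` units of time in `s'`. -/
inductive Exec (W S : ℕ) : Prog → Store → ℕ → Store → Prop
  | skip (s : Store) : Exec W S .skip s 1 s
  | setReg {r : ℕ} {e : NExp} {s : Store} {v : ℕ} (he : e.eval W S s = some v) :
      Exec W S (.setReg r e) s (e.cost + 1) { s with reg := Function.update s.reg r v }
  | setMem {a e : NExp} {s : Store} {i v : ℕ} (ha : a.eval W S s = some i) (hi : i < S)
      (he : e.eval W S s = some v) :
      Exec W S (.setMem a e) s (a.cost + e.cost + 1)
        { s with mem := Function.update s.mem i v }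
  | setRReg {r : ℕ} {x : RExp} {s : Store} {v : ℝ} (hx : x.eval W S s = some v) :
      Exec W S (.setRReg r x) s (x.cost + 1) { s with rreg := Function.update s.rreg r v }
  | setRMem {a : NExp} {x : RExp} {s : Store} {i : ℕ} {v : ℝ} (ha : a.eval W S s = some i)
      (hi : i < S) (hx : x.eval W S s = some v) :
      Exec W S (.setRMem a x) s (a.cost + x.cost + 1)
        { s with rmem := Function.update s.rmem i v }
  | seq {p q : Prog} {s s' s'' : Store} {t t' : ℕ} (hp : Exec W S p s t s')
      (hq : Exec W S q s' t' s'') : Exec W S (.seq p q) s (t + t') s''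
  | iteTrue {b : BExp} {p q : Prog} {s s' : Store} {t : ℕ} (hb : b.eval W S s = some true)
      (hp : Exec W S p s t s') : Exec W S (.ite b p q) s (b.cost + 1 + t) s'
  | iteFalse {b : BExp} {p q : Prog} {s s' : Store} {t : ℕ} (hb : b.eval W S s = some false)
      (hq : Exec W S q s t s') : Exec W S (.ite b p q) s (b.cost + 1 + t) s'
  | loopTrue {b : BExp} {p : Prog} {s s' s'' : Store} {t t' : ℕ}
      (hb : b.eval W S s = some true) (hp : Exec W S p s t s')
      (hl : Exec W S (.loop b p) s' t' s'') :
      Exec W S (.loop b p) s (b.cost + 1 + t + t') s''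
  | loopFalse {b : BExp} {p : Prog} {s : Store} (hb : b.eval W S s = some false) :
      Exec W S (.loop b p) s (b.cost + 1) s

end RAM

/-! ### Input and output -/

namespace CPE

/-- A presentation of an instance as a list of its edges, in any order, and a list of its
admissible pairs, in any order, each one given by the positions of its two edges in the edge list,
in either order. -/
structure Presentation (I : Problem) where
  /-- the edge list -/
  edges : List (Edge I.nA I.nB)
  edges_nodup : edges.Nodup
  edges_eq : edges.toFinset = I.E
  /-- the list of admissible pairs -/
  pairs : List (Fin edges.length × Fin edges.length)
  pairs_nodup : (pairs.map fun p => s(edges.get p.1, edges.get p.2)).Nodup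
  pairs_eq : (pairs.map fun p => s(edges.get p.1, edges.get p.2)).toFinset = I.X

namespace Presentation

variable {I : Problem} (L : Presentation I)

/-- The initial configuration: `nA`, `nB`, `m`, `k` in the first four word registers, in the word
memory the two endpoints of each edge followed by the two edge positions of each admissible pair,
in the real memory the weights of the edges, and zero everywhere else. -/
noncomputable def input : RAM.Store where
  reg r := [I.nA, I.nB, I.m, I.k].getD r 0
  mem a := ((L.edges.flatMap fun e => [(e.1 : ℕ), (e.2 : ℕ)]) ++
    L.pairs.flatMap fun p => [(p.1 : ℕ), (p.2 : ℕ)]).getD a 0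
  rreg _ := 0
  rmem a := (L.edges.map I.w).getD a 0

/-- The configuration `s` reports the edge set `M`: register `0` holds the number of edges of `M`,
and the word memory starts with a list, without repetitions, of their positions in the edge list. -/
def Reports (s : RAM.Store) (M : Finset (Edge I.nA I.nB)) : Prop :=
  ∃ out : List (Fin L.edges.length), out.Nodup ∧ (out.map L.edges.get).toFinset = M ∧
    s.reg 0 = out.length ∧ ∀ (j : ℕ) (hj : j < out.length), s.mem j = (out[j] : ℕ)

end Presentation

end CPE

/-! In a 2-CPE matching the crossing graph has maximum degree two. It is a permutation graph, so its
induced cycles have length at most four. Hence its components are zigzag paths, triangles and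
four-cycles, ordered from left to right. A dynamic program can assemble the matching in this order,
remembering only the right end of the last component.

An item is a single edge or an admissible pair, `U` being its edge with the left endpoint on the
upper layer. Let `d` be the edge of a nonempty matching reaching farthest right on the upper layer
and `u` the one reaching farthest right on the lower layer. Either `u = d`, or they cross and form
an item `j`. Each of them has at most one further crossing. Which of these exist, and whether they
are with the same edge, decides the state `(i, j)`: a base state `(j, j)`, a path step (`PD` or
`PU`), a triangle (`TR`) or a four-cycle (`CC`). This is `exists_sem`; the classification of
components is thus only needed locally, at the right end.

Each kind of state has a compose lemma and a decompose lemma, which together give an exact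
recurrence. Removing item `j` from a base state leaves an arbitrary matching to its left. Removing
the newest edge of a path leaves the base state of `i` or a path state `(l, i)`; the degree bound
pushes everything else far enough left that compatibility concerns only `l`, `i`, `j`
(`path_decompose`). A triangle loses its middle edge and becomes the base state of `j`; a four-cycle
loses `j` and becomes the base state of `i`. The upside-down drawing `swap` turns `PD` into `PU`.

Items are processed by increasing `key`, the sum of the two upper endpoints, so a state depends only
on items already closed and on `(j, j)`. Of the states with `i ≠ j`, only the `k ^ 2` ones between
admissible pairs are computed, each by a search over at most `k` predecessors; every item also costs
two linear scans over all items. The total is `k ^ 3 + (m + k) ^ 2` up to constants, that is `O(k ^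
3 + m ^ 2 + 1)`, with tables of size `(m + k) ^ 2`. This is below the bounds to be proved.

Every table cell also stores the newly added edges and a link to the preceding state. `Tr` says that
following the links lists exactly the matching, and it allows only states that are already final, so
later writes cannot spoil it. Value `0` marks a state that no matching realises, which is
unambiguous because weights are positive. The program is written in a small structured language
whose compilation to the machine is proved correct once (`HRun.of_wp`, `HRun.forUp`, `HRun.todo`).
-/

namespace CPE

/-- A weighted two-layered drawing with vertices and edges replaced by natural numbers. The *items*
are the `m` edges (item `i < m` has both ends equal to `i`) followed by the `k` admissible pairs
(item `i` with `m ≤ i < m + k` consists of crossing edges `U i` and `D i`, the first one having the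
left endpoint on the upper layer). -/
structure Layered where
  m : ℕ
  k : ℕ
  a : ℕ → ℕ
  b : ℕ → ℕ
  w : ℕ → ℝ
  U : ℕ → ℕ
  D : ℕ → ℕ
  single : ∀ i < m, U i = i ∧ D i = i
  pair : ∀ i, m ≤ i → i < m + k → U i < m ∧ D i < m ∧ a (U i) < a (D i) ∧ b (D i) < b (U i)
  w_pos : ∀ e < m, 0 < w e

namespace Layered

variable (I : Layered)

/-- The number of items. -/
def N : ℕ := I.m + I.k

/-- `e` lies strictly to the left of `f` on both layers. -/
def Lt (e f : ℕ) : Prop := I.a e < I.a f ∧ I.b e < I.b f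

/-- `e` and `f` are the two edges of an admissible pair. -/
def Adj (e f : ℕ) : Prop := ∃ i, I.m ≤ i ∧ i < I.m + I.k ∧ I.U i = e ∧ I.D i = f

/-- `e` and `f` cross. -/
def Cr (e f : ℕ) : Prop := (I.a e < I.a f ∧ I.b f < I.b e) ∨ (I.a f < I.a e ∧ I.b e < I.b f)

/-- `M` is a `2`-CPE matching. -/
structure Valid (M : Finset ℕ) : Prop where
  lt_m : ∀ e ∈ M, e < I.m
  rel : ∀ e ∈ M, ∀ f ∈ M, e ≠ f → I.Lt e f ∨ I.Lt f e ∨ I.Adj e f ∨ I.Adj f e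
  deg : ∀ e ∈ M, ∀ x ∈ M, ∀ y ∈ M, ∀ z ∈ M, x ≠ y → x ≠ z → y ≠ z →
    I.Cr e x → I.Cr e y → I.Cr e z → False

/-- The weight of an edge set. -/
noncomputable def wt (M : Finset ℕ) : ℝ := ∑ e ∈ M, I.w e

/-- `f` lies strictly to the left of item `j`. -/
def Below (f j : ℕ) : Prop := I.a f < I.a (I.U j) ∧ I.b f < I.b (I.D j)

/-- `j` continues `i` along a zigzag at the common edge `D i = D j`. -/
def PD (i j : ℕ) : Prop := I.D i = I.D j ∧ I.Lt (I.U i) (I.U j)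

/-- `j` continues `i` along a zigzag at the common edge `U i = U j`. -/
def PU (i j : ℕ) : Prop := I.U i = I.U j ∧ I.Lt (I.D i) (I.D j)

/-- `i` and `j` span a triangle of pairwise crossing edges. -/
def TR (i j : ℕ) : Prop := I.U i = I.U j ∧ I.Adj (I.D i) (I.D j)

/-- `i` and `j` are opposite edges of a crossing four-cycle. -/
def CC (i j : ℕ) : Prop :=
  I.Lt (I.U i) (I.U j) ∧ I.Lt (I.D i) (I.D j) ∧ I.Adj (I.U i) (I.D j) ∧ I.Adj (I.U j) (I.D i)

/-- So far item `j` is a whole component: all other edges are left of both of its edges. -/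
def SBase (j : ℕ) (M : Finset ℕ) : Prop :=
  I.Valid M ∧ I.U j ∈ M ∧ I.D j ∈ M ∧ ∀ f ∈ M, f ≠ I.U j → f ≠ I.D j → I.Below f j

/-- The other edges are compared with item `j` only: the edge before item `i` on the zigzag crosses
an edge of `i`. -/
def SPath (i j : ℕ) (M : Finset ℕ) : Prop :=
  I.Valid M ∧ I.U j ∈ M ∧ I.D j ∈ M ∧ I.U i ∈ M ∧ I.D i ∈ M ∧
    ∀ f ∈ M, f ≠ I.U i → f ≠ I.D i → f ≠ I.U j → f ≠ I.D j → I.Lt f (I.U j) ∧ I.Lt f (I.D j)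

/-- Under `TR i j` the edge `D i` is the middle one of the three, `U i` being the same as `U j`. -/
def STri (i j : ℕ) (M : Finset ℕ) : Prop :=
  I.Valid M ∧ I.U j ∈ M ∧ I.D j ∈ M ∧ I.D i ∈ M ∧
    ∀ f ∈ M, f ≠ I.D i → f ≠ I.U j → f ≠ I.D j → I.Below f j

/-- Under `CC i j` the item `i` is the left one, so it is the one that bounds the rest of the
matching. -/
def SCyc (i j : ℕ) (M : Finset ℕ) : Prop :=
  I.Valid M ∧ I.U j ∈ M ∧ I.D j ∈ M ∧ I.U i ∈ M ∧ I.D i ∈ M ∧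
    ∀ f ∈ M, f ≠ I.U i → f ≠ I.D i → f ≠ I.U j → f ≠ I.D j → I.Below f i

/-- `M` is a `2`-CPE matching whose last crossing component ends with the items `i, j`. -/
def Sem (i j : ℕ) (M : Finset ℕ) : Prop :=
  (i = j ∧ I.SBase j M) ∨ (I.m ≤ i ∧ I.m ≤ j ∧
    (((I.PD i j ∨ I.PU i j) ∧ I.SPath i j M) ∨ (I.TR i j ∧ I.STri i j M) ∨
      (I.CC i j ∧ I.SCyc i j M)))

/-- The same drawing turned upside down. -/
def swap : Layered where
  m := I.m
  k := I.k
  a := I.b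
  b := I.a
  w := I.w
  U := I.D
  D := I.U
  single i hi := (I.single i hi).symm
  pair i h h' := ⟨(I.pair i h h').2.1, (I.pair i h h').1, (I.pair i h h').2.2.2,
    (I.pair i h h').2.2.1⟩
  w_pos := I.w_pos

/-! ### Reflection symmetry and elementary facts about crossings -/

variable {I}

lemma lt_swap {e f : ℕ} : I.swap.Lt e f ↔ I.Lt e f := and_comm

lemma adj_swap {e f : ℕ} : I.swap.Adj e f ↔ I.Adj f e := by
  constructor <;> rintro ⟨i, h1, h2, h3, h4⟩ <;> exact ⟨i, h1, h2, h4, h3⟩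

lemma cr_swap {e f : ℕ} : I.swap.Cr e f ↔ I.Cr e f := by
  simp only [Cr, swap]; tauto

lemma valid_swap {M : Finset ℕ} : I.swap.Valid M ↔ I.Valid M := by
  constructor
  · intro h
    refine ⟨h.lt_m, fun e he f hf hne => ?_, fun e he x hx y hy z hz h1 h2 h3 c1 c2 c3 =>
      h.deg e he x hx y hy z hz h1 h2 h3 (cr_swap.2 c1) (cr_swap.2 c2) (cr_swap.2 c3)⟩
    have := h.rel e he f hf hne
    simp only [lt_swap, adj_swap] at this
    tauto
  · intro h
    refine ⟨h.lt_m, fun e he f hf hne => ?_, fun e he x hx y hy z hz h1 h2 h3 c1 c2 c3 =>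
      h.deg e he x hx y hy z hz h1 h2 h3 (cr_swap.1 c1) (cr_swap.1 c2) (cr_swap.1 c3)⟩
    have := h.rel e he f hf hne
    simp only [lt_swap, adj_swap]
    tauto

lemma sPath_swap {i j : ℕ} {M : Finset ℕ} : I.swap.SPath i j M ↔ I.SPath i j M := by
  simp only [SPath, valid_swap, lt_swap]
  simp only [swap]
  constructor <;> rintro ⟨h, h1, h2, h3, h4, h5⟩ <;>
    exact ⟨h, h2, h1, h4, h3, fun f hf e1 e2 e3 e4 => (h5 f hf e2 e1 e4 e3).symm⟩

lemma sBase_swap {j : ℕ} {M : Finset ℕ} : I.swap.SBase j M ↔ I.SBase j M := by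
  simp only [SBase, valid_swap]
  simp only [swap, Below]
  constructor <;> rintro ⟨h, h1, h2, h5⟩ <;>
    exact ⟨h, h2, h1, fun f hf e1 e2 => (h5 f hf e2 e1).symm⟩

lemma Adj.lt {e f : ℕ} (h : I.Adj e f) : e < I.m ∧ f < I.m ∧ I.a e < I.a f ∧ I.b f < I.b e := by
  obtain ⟨i, h1, h2, rfl, rfl⟩ := h
  exact I.pair i h1 h2

lemma Adj.cr {e f : ℕ} (h : I.Adj e f) : I.Cr e f := Or.inl h.lt.2.2

lemma Adj.cr' {e f : ℕ} (h : I.Adj e f) : I.Cr f e := Or.inr h.lt.2.2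

lemma adj_item {i : ℕ} (h1 : I.m ≤ i) (h2 : i < I.N) : I.Adj (I.U i) (I.D i) :=
  ⟨i, h1, h2, rfl, rfl⟩

lemma U_lt {i : ℕ} (h : i < I.N) : I.U i < I.m := by
  by_cases hi : i < I.m
  · rw [(I.single i hi).1]; exact hi
  · exact (I.pair i (by omega) h).1

lemma D_lt {i : ℕ} (h : i < I.N) : I.D i < I.m := by
  by_cases hi : i < I.m
  · rw [(I.single i hi).2]; exact hi
  · exact (I.pair i (by omega) h).2.1

lemma le_item {i : ℕ} (h : i < I.N) : I.a (I.U i) ≤ I.a (I.D i) ∧ I.b (I.D i) ≤ I.b (I.U i) := by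
  by_cases hi : i < I.m
  · rw [(I.single i hi).1, (I.single i hi).2]; exact ⟨le_rfl, le_rfl⟩
  · obtain ⟨-, -, h1, h2⟩ := I.pair i (by omega) h; exact ⟨h1.le, h2.le⟩

lemma Valid.mono {M M' : Finset ℕ} (h : I.Valid M) (hs : M' ⊆ M) : I.Valid M' :=
  ⟨fun e he => h.lt_m e (hs he), fun e he f hf => h.rel e (hs he) f (hs hf),
    fun e he x hx y hy z hz => h.deg e (hs he) x (hs hx) y (hs hy) z (hs hz)⟩

lemma valid_empty : I.Valid ∅ := ⟨by simp, by simp, by simp⟩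

lemma wt_nonneg {M : Finset ℕ} (h : I.Valid M) : 0 ≤ I.wt M :=
  Finset.sum_nonneg fun e he => (I.w_pos e (h.lt_m e he)).le

lemma cr_comm {e f : ℕ} : I.Cr e f ↔ I.Cr f e := by simp only [Cr]; tauto

lemma not_cr_of_lt {e f : ℕ} (h : I.Lt e f) : ¬ I.Cr e f := by
  obtain ⟨h1, h2⟩ := h; rintro (⟨h3, h4⟩ | ⟨h3, h4⟩) <;> omega

lemma not_cr_of_lt' {e f : ℕ} (h : I.Lt f e) : ¬ I.Cr e f := fun h' => not_cr_of_lt h (cr_comm.1 h')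

lemma not_cr_self {e : ℕ} : ¬ I.Cr e e := by rintro (⟨h, -⟩ | ⟨h, -⟩) <;> omega

lemma not_lt_self {e : ℕ} : ¬ I.Lt e e := fun h => by have := h.1; omega

/-- Adding an edge that crosses at most two old edges, each of which has at most one crossing. -/
lemma Valid.insert_edge {M : Finset ℕ} (h : I.Valid M) {x p q : ℕ} (hx : x < I.m)
    (hrel : ∀ f ∈ M, f ≠ p → f ≠ q → I.Lt f x)
    (hp : p ∈ M → (I.Adj x p ∨ I.Adj p x) ∧ ∃ p', ∀ f ∈ M, I.Cr p f → f = p')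
    (hq : q ∈ M → (I.Adj x q ∨ I.Adj q x) ∧ ∃ q', ∀ f ∈ M, I.Cr q f → f = q') :
    I.Valid (insert x M) := by
  -- Only `p` and `q` can cross `x`. They may coincide or lie outside `M`, which covers fewer than
  -- two crossings.
  have hcr : ∀ f ∈ insert x M, I.Cr x f → f = p ∨ f = q := by
    intro f hf hc
    rcases Finset.mem_insert.1 hf with rfl | hf
    · exact (not_cr_self hc).elim
    · by_contra! hne
      exact not_cr_of_lt' (hrel f hf hne.1 hne.2) hc
  have hcr' : ∀ e ∈ M, I.Cr e x → ∃ e', ∀ f ∈ M, I.Cr e f → f = e' := by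
    intro e he hc
    by_cases e1 : e = p
    · subst e1; exact (hp he).2
    by_cases e2 : e = q
    · subst e2; exact (hq he).2
    exact (not_cr_of_lt (hrel e he e1 e2) hc).elim
  have hr : ∀ f ∈ M, I.Lt f x ∨ I.Adj x f ∨ I.Adj f x := by
    intro f hf
    by_cases e1 : f = p
    · subst e1; exact Or.inr (hp hf).1
    by_cases e2 : f = q
    · subst e2; exact Or.inr (hq hf).1
    exact Or.inl (hrel f hf e1 e2)
  refine ⟨?_, ?_, ?_⟩
  · intro e he
    rcases Finset.mem_insert.1 he with rfl | he
    · exact hx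
    · exact h.lt_m e he
  · intro e he f hf hne
    rcases Finset.mem_insert.1 he with rfl | he' <;> rcases Finset.mem_insert.1 hf with rfl | hf'
    · exact absurd rfl hne
    · have := hr f hf'; tauto
    · have := hr e he'; tauto
    · exact h.rel e he' f hf' hne
  · intro e he y hy z hz t ht h1 h2 h3 c1 c2 c3
    rcases Finset.mem_insert.1 he with rfl | he
    · have := hcr y hy c1; have := hcr z hz c2; have := hcr t ht c3
      omega
    · by_cases hex : I.Cr e x
      · obtain ⟨e', he'⟩ := hcr' e he hex
        have key : ∀ f ∈ insert x M, I.Cr e f → f = x ∨ f = e' := by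
          intro f hf hc
          rcases Finset.mem_insert.1 hf with rfl | hf
          · exact Or.inl rfl
          · exact Or.inr (he' f hf hc)
        have := key y hy c1; have := key z hz c2; have := key t ht c3
        omega
      · have key : ∀ f ∈ insert x M, I.Cr e f → f ∈ M := by
          intro f hf hc
          rcases Finset.mem_insert.1 hf with rfl | hf
          · exact (hex hc).elim
          · exact hf
        exact h.deg e he y (key y hy c1) z (key z hz c2) t (key t ht c3) h1 h2 h3 c1 c2 c3

/-! ### Composing and decomposing the states -/

lemma wt_insert {M : Finset ℕ} {x : ℕ} (h : x ∉ M) : I.wt (insert x M) = I.w x + I.wt M :=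
  Finset.sum_insert h

lemma wt_erase {M : Finset ℕ} {x : ℕ} (h : x ∈ M) : I.wt M = I.w x + I.wt (M.erase x) :=
  (Finset.add_sum_erase M I.w h).symm

/-- The weight of the edges of an item. -/
noncomputable def iw (I : Layered) (j : ℕ) : ℝ :=
  if j < I.m then I.w (I.U j) else I.w (I.U j) + I.w (I.D j)

lemma Below.lt {f j : ℕ} (hj : j < I.N) (h : I.Below f j) : I.Lt f (I.U j) ∧ I.Lt f (I.D j) := by
  have := le_item hj; obtain ⟨h1, h2⟩ := h
  exact ⟨⟨by omega, by omega⟩, ⟨by omega, by omega⟩⟩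

/-- The new edges cross nothing in `M`, so a new component starts. Writing the item as `{U j, D j}`
treats single edges and pairs uniformly. -/
lemma base_compose {M : Finset ℕ} (h : I.Valid M) {j : ℕ} (hj : j < I.N)
    (hb : ∀ f ∈ M, I.Below f j) :
    I.SBase j ({I.U j, I.D j} ∪ M) ∧ Disjoint {I.U j, I.D j} M ∧
      I.wt ({I.U j, I.D j} ∪ M) = I.iw j + I.wt M := by
  have hU : I.U j ∉ M := fun h' => not_lt_self (hb _ h' |>.lt hj).1
  have hD : I.D j ∉ M := fun h' => not_lt_self (hb _ h' |>.lt hj).2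
  have hu : ({I.U j, I.D j} : Finset ℕ) ∪ M = insert (I.U j) (insert (I.D j) M) := by
    ext; simp
  -- `D j` crosses no old edge, so `p` and `q` are set to an edge outside `M`.
  have v1 : I.Valid (insert (I.D j) M) :=
    h.insert_edge (p := I.D j) (q := I.D j) (D_lt hj) (fun f hf _ _ => (hb f hf |>.lt hj).2)
      (fun h' => (hD h').elim) (fun h' => (hD h').elim)
  by_cases hjm : j < I.m
  · obtain ⟨e1, e2⟩ := I.single j hjm
    have : ({I.U j, I.D j} : Finset ℕ) ∪ M = insert (I.D j) M := by rw [hu, e1, e2]; simp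
    rw [this]
    refine ⟨⟨v1, by rw [e1, e2]; simp, by simp, ?_⟩, ?_, ?_⟩
    · intro f hf n1 n2
      exact hb f ((Finset.mem_insert.1 hf).resolve_left n2)
    · rw [Finset.disjoint_left]; intro x hx; simp at hx; rcases hx with rfl | rfl <;> assumption
    · rw [wt_insert hD, iw, if_pos hjm, e1, e2]
  · have hadj := adj_item (not_lt.1 hjm) hj
    have hne : I.U j ≠ I.D j := fun h => by have := hadj.lt.2.2.1; rw [h] at this; omega
    have v2 : I.Valid (insert (I.U j) (insert (I.D j) M)) := by
      refine v1.insert_edge (p := I.D j) (q := I.D j) (U_lt hj) ?_ ?_ ?_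
      · intro f hf n1 n2
        exact (hb f ((Finset.mem_insert.1 hf).resolve_left n1) |>.lt hj).1
      all_goals
        refine fun _ => ⟨Or.inl hadj, I.D j, ?_⟩
        intro f hf hc
        by_contra hn
        exact not_cr_of_lt' (hb f ((Finset.mem_insert.1 hf).resolve_left hn) |>.lt hj).2 hc
    rw [hu]
    refine ⟨⟨v2, by simp, by simp, ?_⟩, ?_, ?_⟩
    · intro f hf n1 n2
      simp only [Finset.mem_insert] at hf
      exact hb f ((hf.resolve_left n1).resolve_left n2)
    · rw [Finset.disjoint_left]; intro x hx; simp at hx; rcases hx with rfl | rfl <;> assumption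
    · rw [wt_insert (by simp [hne, hU]), wt_insert hD, iw, if_neg hjm]; ring

lemma base_decompose {M : Finset ℕ} {j : ℕ} (hj : j < I.N) (h : I.SBase j M) :
    ∃ M', I.Valid M' ∧ (∀ f ∈ M', I.Below f j) ∧ I.wt M = I.iw j + I.wt M' := by
  obtain ⟨hv, hU, hD, hb⟩ := h
  refine ⟨(M.erase (I.U j)).erase (I.D j),
    hv.mono ((Finset.erase_subset _ _).trans (Finset.erase_subset _ _)), ?_, ?_⟩
  · intro f hf
    simp only [Finset.mem_erase] at hf
    exact hb f hf.2.2 hf.2.1 hf.1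
  · by_cases hjm : j < I.m
    · obtain ⟨e1, e2⟩ := I.single j hjm
      rw [iw, if_pos hjm, wt_erase hU, e1, e2, Finset.erase_eq_of_notMem (Finset.notMem_erase _ _)]
    · have hadj := adj_item (not_lt.1 hjm) hj
      have hne : I.D j ≠ I.U j := fun h => by have := hadj.lt.2.2.1; rw [h] at this; omega
      rw [iw, if_neg hjm, wt_erase hU, wt_erase (Finset.mem_erase.2 ⟨hne, hD⟩)]; ring

/-- `M` can be continued at `D i` to the item `j`. -/
def Ext (I : Layered) (i j : ℕ) (M : Finset ℕ) : Prop :=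
  I.Valid M ∧ I.U i ∈ M ∧ I.D i ∈ M ∧ (∀ f ∈ M, f ≠ I.D i → I.Lt f (I.U j)) ∧
    ∀ f ∈ M, f ≠ I.U i → f ≠ I.D i → I.Lt f (I.D i)

/-- The new edge `U j` crosses only `D i`, whose only earlier crossing is with `U i`; the degree
bound survives. -/
lemma path_compose {M : Finset ℕ} {i j : ℕ} (hj : I.m ≤ j) (hjN : j < I.N) (hij : I.PD i j)
    (h : I.Ext i j M) : I.U j ∉ M ∧ I.SPath i j (insert (I.U j) M) := by
  obtain ⟨hv, hU, hD, h1, h2⟩ := h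
  obtain ⟨e, hlt⟩ := hij
  have hadj := adj_item hj hjN
  have hne : I.U j ≠ I.D j := fun h => by have := hadj.lt.2.2.1; rw [h] at this; omega
  have hUj : I.U j ∉ M := fun h' => not_lt_self (h1 _ h' (e ▸ hne))
  refine ⟨hUj, ?_, by simp, by simp [← e, hD], by simp [hU], by simp [hD], ?_⟩
  · refine hv.insert_edge (p := I.D i) (q := I.D i) (U_lt hjN) (fun f hf n _ => h1 f hf n) ?_ ?_
    all_goals
      refine fun _ => ⟨Or.inl (e ▸ hadj), I.U i, ?_⟩
      intro f hf hc
      by_contra hn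
      by_cases hn' : f = I.D i
      · subst hn'; exact not_cr_self hc
      · exact not_cr_of_lt' (h2 f hf hn hn') hc
  · intro f hf n1 n2 n3 n4
    have hf' := (Finset.mem_insert.1 hf).resolve_left n3
    exact ⟨h1 f hf' n2, e ▸ h2 f hf' n1 n2⟩

/-- The state `(l, i)` can be continued by `j` at `D i`. -/
def Next (I : Layered) (l i j : ℕ) : Prop :=
  I.U l = I.U i ∧ I.Lt (I.D l) (I.D i) ∧ I.Lt (I.D l) (I.U j)

lemma ext_of_base {M : Finset ℕ} {i j : ℕ} (hi : i < I.N) (hij : I.PD i j)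
    (h : I.SBase i M) : I.Ext i j M := by
  obtain ⟨hv, hU, hD, hb⟩ := h
  refine ⟨hv, hU, hD, fun f hf n => ?_, fun f hf n1 n2 => (hb f hf n1 n2 |>.lt hi).2⟩
  by_cases hfu : f = I.U i
  · exact hfu ▸ hij.2
  · have := (hb f hf hfu n |>.lt hi).1
    exact ⟨this.1.trans hij.2.1, this.2.trans hij.2.2⟩

lemma ext_of_path {M : Finset ℕ} {l i j : ℕ} (hij : I.PD i j)
    (hl : I.Next l i j) (h : I.SPath l i M) : I.Ext i j M := by
  obtain ⟨hv, hU, hD, hU', hD', hb⟩ := h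
  obtain ⟨e, h1, h2⟩ := hl
  refine ⟨hv, hU, hD, fun f hf n => ?_, fun f hf n1 n2 => ?_⟩
  · by_cases n1 : f = I.U i
    · exact n1 ▸ hij.2
    by_cases n2 : f = I.D l
    · exact n2 ▸ h2
    have := (hb f hf (e ▸ n1) n2 n1 n).1
    exact ⟨this.1.trans hij.2.1, this.2.trans hij.2.2⟩
  · by_cases n3 : f = I.D l
    · exact n3 ▸ h1
    exact (hb f hf (e ▸ n1) n3 n1 n2).2

/-- Without `U j`, the edge `D i` crosses only `U i`. If `U i` has no second crossing, item `i` is a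
base; otherwise that crossing is an item `l` on which the zigzag turns the other way. -/
lemma path_decompose {M : Finset ℕ} {i j : ℕ} (hi : I.m ≤ i) (hiN : i < I.N) (hj : I.m ≤ j)
    (hjN : j < I.N) (hij : I.PD i j) (h : I.SPath i j M) :
    I.wt M = I.w (I.U j) + I.wt (M.erase (I.U j)) ∧
      (I.SBase i (M.erase (I.U j)) ∨ ∃ l, I.m ≤ l ∧ l < I.N ∧ I.Next l i j ∧ I.PU l i ∧
        I.SPath l i (M.erase (I.U j))) := by
  obtain ⟨hv, hU, hD, hU', hD', hb⟩ := h
  obtain ⟨e, hlt⟩ := hij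
  have hadj := adj_item hj hjN
  have hadi := adj_item hi hiN
  have hne : I.U j ≠ I.D j := fun h => by have := hadj.lt.2.2.1; rw [h] at this; omega
  have hne1 : I.U i ≠ I.D i := fun h => by have := hadi.lt.2.2.1; rw [h] at this; omega
  have hne2 : I.U i ≠ I.U j := fun h => not_lt_self (h ▸ hlt)
  have hv' : I.Valid (M.erase (I.U j)) := hv.mono (Finset.erase_subset _ _)
  have mU : I.U i ∈ M.erase (I.U j) := Finset.mem_erase.2 ⟨hne2, hU'⟩
  have mD : I.D i ∈ M.erase (I.U j) := Finset.mem_erase.2 ⟨e ▸ hne.symm, hD'⟩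
  have hb' : ∀ f ∈ M.erase (I.U j), f ≠ I.U i → f ≠ I.D i → I.Lt f (I.U j) ∧ I.Lt f (I.D i) := by
    intro f hf n1 n2
    obtain ⟨n3, hf⟩ := Finset.mem_erase.1 hf
    have := hb f hf n1 n2 n3 (e ▸ n2)
    exact ⟨this.1, e ▸ this.2⟩
  have hub : I.b (I.D i) < I.b (I.U i) := hadi.lt.2.2.2
  refine ⟨wt_erase hU, ?_⟩
  by_cases hall : ∀ f ∈ M.erase (I.U j), f ≠ I.U i → f ≠ I.D i → I.Lt f (I.U i)
  · left
    refine ⟨hv', mU, mD, fun f hf n1 n2 => ⟨(hall f hf n1 n2).1, (hb' f hf n1 n2).2.2⟩⟩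
  · right
    push Not at hall
    obtain ⟨x, hx, n1, n2, hnl⟩ := hall
    have hxl := hb' x hx n1 n2
    -- `x` lies left of `D i`, hence below `U i` on the lower layer. Not being left of `U i`, it can
    -- only cross it, as the `D`-edge of an item.
    have hax : I.Adj (I.U i) x := by
      rcases hv'.rel _ mU x hx n1.symm with h | h | h | h
      · have := h.2; have := hxl.2.2; omega
      · exact absurd h hnl
      · exact h
      · have := h.lt.2.2.2; have := hxl.2.2; omega
    obtain ⟨l, hl1, hl2, hl3, hl4⟩ := hax
    refine ⟨l, hl1, hl2, ⟨hl3, hl4 ▸ hxl.2, hl4 ▸ hxl.1⟩, ⟨hl3, hl4 ▸ hxl.2⟩, hv', mU, mD,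
      hl3 ▸ mU, hl4 ▸ hx, ?_⟩
    intro f hf k1 k2 k3 k4
    refine ⟨?_, (hb' f hf k3 k4).2⟩
    rcases hv'.rel _ mU f hf k3.symm with h | h | h | h
    · have := h.2; have := (hb' f hf k3 k4).2.2; omega
    · exact h
    -- A third crossing of `U i`, besides `D i` and `x`, would violate the degree bound.
    · refine (hv'.deg _ mU (I.D i) mD x hx f hf n2.symm k4.symm (hl4 ▸ k2.symm) hadi.cr ?_ h.cr).elim
      exact Or.inl ⟨by have := I.pair l hl1 hl2; rw [hl3, hl4] at this; exact this.2.2.1,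
        by have := I.pair l hl1 hl2; rw [hl3, hl4] at this; exact this.2.2.2⟩
    · have := h.lt.2.2.2; have := (hb' f hf k3 k4).2.2; omega

/-- The middle edge `D i` starts to the right of `U j` above and of `D j` below, so it crosses only
these two. -/
lemma tri_compose {M : Finset ℕ} {i j : ℕ} (hi : I.m ≤ i) (hiN : i < I.N) (hj : I.m ≤ j)
    (hjN : j < I.N) (hij : I.TR i j) (h : I.SBase j M) :
    I.D i ∉ M ∧ I.STri i j (insert (I.D i) M) := by
  obtain ⟨hv, hU, hD, hb⟩ := h
  obtain ⟨e, had⟩ := hij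
  have hadj := adj_item hj hjN
  have hadi := adj_item hi hiN
  rw [e] at hadi
  have k1 := had.lt.2.2
  have k2 := hadi.lt.2.2
  have n1 : I.D i ≠ I.U j := fun h => by rw [h] at k2; omega
  have n2 : I.D i ≠ I.D j := fun h => by rw [h] at k1; omega
  have hlt : ∀ f ∈ M, f ≠ I.U j → f ≠ I.D j → I.Lt f (I.D i) := by
    intro f hf m1 m2
    obtain ⟨h1, h2⟩ := hb f hf m1 m2
    exact ⟨by omega, by omega⟩
  refine ⟨fun h' => not_lt_self (hlt _ h' n1 n2), ?_, by simp [hU], by simp [hD], by simp, ?_⟩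
  · refine hv.insert_edge (p := I.U j) (q := I.D j) (D_lt hiN) hlt ?_ ?_
    · refine fun _ => ⟨Or.inr hadi, I.D j, fun f hf hc => ?_⟩
      by_contra m2
      by_cases m1 : f = I.U j
      · exact not_cr_self (m1 ▸ hc)
      · exact not_cr_of_lt' (hb f hf m1 m2 |>.lt hjN).1 hc
    · refine fun _ => ⟨Or.inl had, I.U j, fun f hf hc => ?_⟩
      by_contra m2
      by_cases m1 : f = I.D j
      · exact not_cr_self (m1 ▸ hc)
      · exact not_cr_of_lt' (hb f hf m2 m1 |>.lt hjN).2 hc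
  · intro f hf m1 m2 m3
    exact hb f ((Finset.mem_insert.1 hf).resolve_left m1) m2 m3

lemma tri_decompose {M : Finset ℕ} {i j : ℕ} (hi : I.m ≤ i) (hiN : i < I.N)
    (hij : I.TR i j) (h : I.STri i j M) :
    I.wt M = I.w (I.D i) + I.wt (M.erase (I.D i)) ∧ I.SBase j (M.erase (I.D i)) := by
  obtain ⟨hv, hU, hD, hD', hb⟩ := h
  obtain ⟨e, had⟩ := hij
  have k1 := had.lt.2.2
  have k2 := (adj_item hi hiN).lt.2.2
  rw [e] at k2
  have n1 : I.U j ≠ I.D i := fun h => by rw [h] at k2; omega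
  have n2 : I.D j ≠ I.D i := fun h => by rw [h] at k1; omega
  refine ⟨wt_erase hD', hv.mono (Finset.erase_subset _ _), Finset.mem_erase.2 ⟨n1, hU⟩,
    Finset.mem_erase.2 ⟨n2, hD⟩, fun f hf m1 m2 => ?_⟩
  obtain ⟨m3, hf⟩ := Finset.mem_erase.1 hf
  exact hb f hf m3 m1 m2

/-- Inserting `U j` first extends the path `U i`, `D i` at `D i`; inserting `D j` then joins the two
ends `U i` and `U j`. -/
lemma cyc_compose {M : Finset ℕ} {i j : ℕ} (hi : I.m ≤ i) (hiN : i < I.N) (hj : I.m ≤ j)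
    (hjN : j < I.N) (hij : I.CC i j) (h : I.SBase i M) :
    Disjoint {I.U j, I.D j} M ∧ I.SCyc i j ({I.U j, I.D j} ∪ M) ∧
      I.wt ({I.U j, I.D j} ∪ M) = I.w (I.U j) + I.w (I.D j) + I.wt M := by
  obtain ⟨hv, hU, hD, hb⟩ := h
  obtain ⟨l1, l2, a1, a2⟩ := hij
  have hadj := adj_item hj hjN
  have hadi := adj_item hi hiN
  have k1 := a1.lt.2.2
  have k2 := a2.lt.2.2
  have k3 := hadi.lt.2.2
  have k4 := hadj.lt.2.2
  have u1 : ∀ f ∈ M, f ≠ I.D i → I.Lt f (I.U j) := by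
    intro f hf n
    by_cases n' : f = I.U i
    · exact n' ▸ l1
    · have := (hb f hf n' n |>.lt hiN).1
      exact ⟨this.1.trans l1.1, this.2.trans l1.2⟩
  have u2 : ∀ f ∈ M, f ≠ I.U i → I.Lt f (I.D j) := by
    intro f hf n
    by_cases n' : f = I.D i
    · exact n' ▸ l2
    · have := (hb f hf n n' |>.lt hiN).2
      exact ⟨this.1.trans l2.1, this.2.trans l2.2⟩
  have n1 : I.U j ≠ I.D i := fun h => by rw [h] at k2; omega
  have n2 : I.D j ≠ I.U i := fun h => by rw [h] at k1; omega
  have n3 : I.D j ≠ I.U j := fun h => by rw [h] at k4; omega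
  have n4 : I.U i ≠ I.U j := fun h => not_lt_self (h ▸ l1)
  have n5 : I.D i ≠ I.U i := fun h => by rw [h] at k3; omega
  have hUj : I.U j ∉ M := fun h => not_lt_self (u1 _ h n1)
  have hDj : I.D j ∉ M := fun h => not_lt_self (u2 _ h n2)
  have v1 : I.Valid (insert (I.U j) M) := by
    refine hv.insert_edge (p := I.D i) (q := I.D i) (U_lt hjN) (fun f hf n _ => u1 f hf n) ?_ ?_
    all_goals
      refine fun _ => ⟨Or.inl a2, I.U i, fun f hf hc => ?_⟩
      by_contra m1
      by_cases m2 : f = I.D i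
      · exact not_cr_self (m2 ▸ hc)
      · exact not_cr_of_lt' (hb f hf m1 m2 |>.lt hiN).2 hc
  have v2 : I.Valid (insert (I.D j) (insert (I.U j) M)) := by
    refine v1.insert_edge (p := I.U i) (q := I.U j) (D_lt hjN) ?_ ?_ ?_
    · intro f hf m1 m2
      exact u2 f ((Finset.mem_insert.1 hf).resolve_left m2) m1
    · refine fun _ => ⟨Or.inr a1, I.D i, fun f hf hc => ?_⟩
      by_contra m1
      rcases Finset.mem_insert.1 hf with rfl | hf
      · exact not_cr_of_lt l1 hc
      by_cases m2 : f = I.U i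
      · exact not_cr_self (m2 ▸ hc)
      · exact not_cr_of_lt' (hb f hf m2 m1 |>.lt hiN).1 hc
    · refine fun _ => ⟨Or.inr hadj, I.D i, fun f hf hc => ?_⟩
      by_contra m1
      rcases Finset.mem_insert.1 hf with rfl | hf
      · exact not_cr_self hc
      · exact not_cr_of_lt' (u1 f hf m1) hc
  have hu : ({I.U j, I.D j} : Finset ℕ) ∪ M = insert (I.D j) (insert (I.U j) M) := by
    ext; simp; tauto
  rw [hu]
  refine ⟨?_, ⟨v2, by simp, by simp, by simp [hU], by simp [hD], ?_⟩, ?_⟩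
  · rw [Finset.disjoint_left]; intro x hx; simp at hx; rcases hx with rfl | rfl <;> assumption
  · intro f hf m1 m2 m3 m4
    simp only [Finset.mem_insert] at hf
    exact hb f ((hf.resolve_left m4).resolve_left m3) m1 m2
  · rw [wt_insert (by simp [n3, hDj]), wt_insert hUj]; ring

lemma cyc_decompose {M : Finset ℕ} {i j : ℕ} (hj : I.m ≤ j) (hjN : j < I.N)
    (hij : I.CC i j) (h : I.SCyc i j M) :
    ∃ M', I.SBase i M' ∧ I.wt M = I.w (I.U j) + I.w (I.D j) + I.wt M' := by
  obtain ⟨hv, hU, hD, hU', hD', hb⟩ := h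
  obtain ⟨l1, l2, a1, a2⟩ := hij
  have k1 := a1.lt.2.2
  have k2 := a2.lt.2.2
  have k4 := (adj_item hj hjN).lt.2.2
  have n1 : I.D i ≠ I.U j := fun h => by rw [h] at k2; omega
  have n2 : I.U i ≠ I.D j := fun h => by rw [h] at k1; omega
  have n3 : I.D j ≠ I.U j := fun h => by rw [h] at k4; omega
  have n4 : I.U i ≠ I.U j := fun h => not_lt_self (h ▸ l1)
  have n5 : I.D i ≠ I.D j := fun h => not_lt_self (h ▸ l2)
  refine ⟨(M.erase (I.U j)).erase (I.D j),
    ⟨hv.mono ((Finset.erase_subset _ _).trans (Finset.erase_subset _ _)), ?_, ?_, ?_⟩, ?_⟩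
  · simp [n2, n4, hU']
  · simp [n1, n5, hD']
  · intro f hf m1 m2
    simp only [Finset.mem_erase] at hf
    exact hb f hf.2.2 m1 m2 hf.2.1 hf.1
  · rw [wt_erase hU, wt_erase (Finset.mem_erase.2 ⟨n3, hD⟩)]; ring

/-- Every nonempty `2`-CPE matching is in one of the states. -/
lemma exists_sem {M : Finset ℕ} (hv : I.Valid M) (hM : M.Nonempty) :
    ∃ i < I.N, ∃ j < I.N, I.Sem i j M := by
  -- If `d` and `u` differ, their extremality excludes every relation between them except the
  -- crossing `Adj u d`.
  obtain ⟨d, hd, hdmax⟩ := M.exists_max_image I.a hM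
  obtain ⟨u, hu, humax⟩ := M.exists_max_image I.b hM
  by_cases hud : u = d
  · subst hud
    have hum := hv.lt_m u hu
    obtain ⟨e1, e2⟩ := I.single u hum
    have : u < I.N := by unfold N; omega
    refine ⟨u, this, u, this, Or.inl ⟨rfl, hv, e1.symm ▸ hu, e2.symm ▸ hu, ?_⟩⟩
    intro f hf n1 n2
    rw [e1] at n1
    have ha := hdmax f hf
    have hb := humax f hf
    rcases hv.rel f hf u hu n1 with h | h | h | h
    · exact ⟨e1.symm ▸ h.1, e2.symm ▸ h.2⟩
    · have := h.1; omega
    · have := h.lt.2.2; omega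
    · have := h.lt.2.2; omega
  have hadj : I.Adj u d := by
    have ha := hdmax u hu
    have hb := humax d hd
    rcases hv.rel u hu d hd hud with h | h | h | h
    · have := h.2; omega
    · have := h.1; omega
    · exact h
    · have := h.lt.2.2; omega
  have hrd : ∀ g ∈ M, g ≠ d → I.Lt g d ∨ I.Adj g d := by
    intro g hg n
    have ha := hdmax g hg
    rcases hv.rel g hg d hd n with h | h | h | h
    · exact Or.inl h
    · have := h.1; omega
    · exact Or.inr h
    · have := h.lt.2.2; omega
  have hru : ∀ g ∈ M, g ≠ u → I.Lt g u ∨ I.Adj u g := by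
    intro g hg n
    have hb := humax g hg
    rcases hv.rel g hg u hu n with h | h | h | h
    · exact Or.inl h
    · have := h.2; omega
    · have := h.lt.2.2; omega
    · exact Or.inr h
  have hadl := hadj.lt
  obtain ⟨j, hj1, hj2, hjU, hjD⟩ := id hadj
  -- Four cases: whether `d` has a second crossing `g`, and whether `u` has a second crossing `h`.
  by_cases c1 : ∃ g ∈ M, g ≠ u ∧ I.Adj g d
  · obtain ⟨g, hg, hgu, hgd⟩ := c1
    have hgdl := hgd.lt
    have hgd' : g ≠ d := fun h => by rw [h] at hgdl; omega
    -- no further edge crosses `d`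
    have fd : ∀ f ∈ M, f ≠ g → f ≠ u → f ≠ d → I.Lt f d := by
      intro f hf n1 n2 n3
      rcases hrd f hf n3 with h | h
      · exact h
      · exact (hv.deg d hd u hu g hg f hf hgu.symm n2.symm n1.symm hadj.cr' hgd.cr' h.cr').elim
    by_cases c2 : ∃ h ∈ M, h ≠ d ∧ I.Adj u h
    · obtain ⟨h, hh, hhd, huh⟩ := c2
      have huhl := huh.lt
      have hhu : h ≠ u := fun e => by rw [e] at huhl; omega
      have fu : ∀ f ∈ M, f ≠ h → f ≠ u → f ≠ d → I.Lt f u := by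
        intro f hf n1 n2 n3
        rcases hru f hf n2 with h' | h'
        · exact h'
        · exact (hv.deg u hu d hd h hh f hf hhd.symm n3.symm n1.symm hadj.cr huh.cr h'.cr).elim
      -- One common neighbour gives a triangle; two different ones give a four-cycle.
      by_cases hgh : g = h
      · subst hgh
        obtain ⟨i, hi1, hi2, hiU, hiD⟩ := id huh
        refine ⟨i, hi2, j, hj2, Or.inr ⟨hi1, hj1, Or.inr (Or.inl ⟨⟨hiU.trans hjU.symm, ?_⟩, hv,
          hjU.symm ▸ hu, hjD.symm ▸ hd, hiD.symm ▸ hg, ?_⟩)⟩⟩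
        · rw [hiD, hjD]; exact hgd
        · rw [hiD, hjU, hjD]
          intro f hf n1 n2 n3
          exact ⟨hjU.symm ▸ (fu f hf n1 n2 n3).1, hjD.symm ▸ (fd f hf n1 n2 n3).2⟩
      · have lgu := fu g hg hgh hgu hgd'
        have lhd := fd h hh (Ne.symm hgh) hhu hhd
        -- On the upper layer `g < u < h`, on the lower one `h < d < g`; so `g` and `h` are forced
        -- to cross.
        have hagh : I.Adj g h := by
          have p1 := lgu.1; have p2 := lhd.2
          rcases hv.rel g hg h hh hgh with h' | h' | h' | h'
          · have := h'.2; omega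
          · have := h'.1; omega
          · exact h'
          · have := h'.lt.2.2; omega
        obtain ⟨i, hi1, hi2, hiU, hiD⟩ := id hagh
        have haghl := hagh.lt
        refine ⟨i, hi2, j, hj2, Or.inr ⟨hi1, hj1, Or.inr (Or.inr ⟨?_, hv,
          hjU.symm ▸ hu, hjD.symm ▸ hd, hiU.symm ▸ hg, hiD.symm ▸ hh, ?_⟩)⟩⟩
        · simp only [CC, hiU, hiD, hjU, hjD]
          exact ⟨lgu, lhd, hgd, huh⟩
        · simp only [hiU, hiD, hjU, hjD, Below]
          intro f hf n1 n2 n3 n4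
          have q1 := fu f hf n2 n3 n4
          have q2 := fd f hf n1 n3 n4
          -- An edge left of `u` and `d` but not below item `i` would be a third crossing of `g` or
          -- of `h`.
          constructor
          · rcases hv.rel f hf g hg n1 with h' | h' | h' | h'
            · exact h'.1
            · have := h'.2; have := q2.2; omega
            · have := h'.lt.2.2; have := q2.2; omega
            · exact (hv.deg g hg d hd h hh f hf hhd.symm n4.symm n2.symm hgd.cr hagh.cr h'.cr).elim
          · rcases hv.rel f hf h hh n2 with h' | h' | h' | h'
            · exact h'.2
            · have := h'.1; have := q1.1; omega
            · exact (hv.deg h hh u hu g hg f hf hgu.symm n3.symm n1.symm huh.cr' hagh.cr'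
                h'.cr').elim
            · have := h'.lt.2.2; have := q1.1; omega
    · push Not at c2
      have fu : ∀ f ∈ M, f ≠ u → f ≠ d → I.Lt f u := fun f hf n1 n2 =>
        (hru f hf n1).resolve_right (c2 f hf n2)
      obtain ⟨i, hi1, hi2, hiU, hiD⟩ := id hgd
      refine ⟨i, hi2, j, hj2, Or.inr ⟨hi1, hj1, Or.inl ⟨Or.inl ⟨hiD.trans hjD.symm, ?_⟩, hv,
        hjU.symm ▸ hu, hjD.symm ▸ hd, hiU.symm ▸ hg, hiD.symm ▸ hd, ?_⟩⟩⟩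
      · rw [hiU, hjU]; exact fu g hg hgu hgd'
      · rw [hiU, hiD, hjU, hjD]
        intro f hf n1 _ n3 n4
        exact ⟨fu f hf n3 n4, fd f hf n1 n3 n4⟩
  · push Not at c1
    have fd : ∀ f ∈ M, f ≠ u → f ≠ d → I.Lt f d := fun f hf n1 n2 =>
      (hrd f hf n2).resolve_right (c1 f hf n1)
    by_cases c2 : ∃ h ∈ M, h ≠ d ∧ I.Adj u h
    · obtain ⟨h, hh, hhd, huh⟩ := c2
      have huhl := huh.lt
      have hhu : h ≠ u := fun e => by rw [e] at huhl; omega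
      have fu : ∀ f ∈ M, f ≠ h → f ≠ u → f ≠ d → I.Lt f u := by
        intro f hf n1 n2 n3
        rcases hru f hf n2 with h' | h'
        · exact h'
        · exact (hv.deg u hu d hd h hh f hf hhd.symm n3.symm n1.symm hadj.cr huh.cr h'.cr).elim
      obtain ⟨i, hi1, hi2, hiU, hiD⟩ := id huh
      refine ⟨i, hi2, j, hj2, Or.inr ⟨hi1, hj1, Or.inl ⟨Or.inr ⟨hiU.trans hjU.symm, ?_⟩, hv,
        hjU.symm ▸ hu, hjD.symm ▸ hd, hiU.symm ▸ hu, hiD.symm ▸ hh, ?_⟩⟩⟩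
      · rw [hiD, hjD]; exact fd h hh hhu hhd
      · rw [hiU, hiD, hjU, hjD]
        intro f hf _ n2 n3 n4
        exact ⟨fu f hf n2 n3 n4, fd f hf n3 n4⟩
    · push Not at c2
      refine ⟨j, hj2, j, hj2, Or.inl ⟨rfl, hv, hjU.symm ▸ hu, hjD.symm ▸ hd, ?_⟩⟩
      rw [hjU, hjD]
      intro f hf n1 n2
      exact ⟨hjU.symm ▸ ((hru f hf n1).resolve_right (c2 f hf n2)).1, hjD.symm ▸ (fd f hf n1 n2).2⟩

lemma Sem.valid {i j : ℕ} {M : Finset ℕ} (h : I.Sem i j M) : I.Valid M ∧ I.U j ∈ M ∧ I.D j ∈ M := by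
  rcases h with ⟨_, h⟩ | ⟨_, _, ⟨_, h⟩ | ⟨_, h⟩ | ⟨_, h⟩⟩ <;> exact ⟨h.1, h.2.1, h.2.2.1⟩

/-- The last item of a state is at the right end. -/
lemma Sem.end {i j : ℕ} {M : Finset ℕ} (hi : i < I.N) (hj : j < I.N) (h : I.Sem i j M) :
    ∀ f ∈ M, I.a f ≤ I.a (I.D j) ∧ I.b f ≤ I.b (I.U j) := by
  intro f hf
  have lj := le_item hj
  have li := le_item hi
  by_cases e1 : f = I.U j
  · subst e1; exact ⟨lj.1, le_rfl⟩
  by_cases e2 : f = I.D j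
  · subst e2; exact ⟨le_rfl, lj.2⟩
  rcases h with ⟨_, h⟩ | ⟨hi1, _, ⟨h', h⟩ | ⟨h', h⟩ | ⟨h', h⟩⟩
  · have := h.2.2.2 f hf e1 e2; unfold Below at this; omega
  · by_cases e3 : f = I.U i
    · subst e3
      rcases h' with ⟨h1, h2, h3⟩ | ⟨h1, h2, h3⟩
      · rw [h1] at li; omega
      · exact absurd h1 e1
    by_cases e4 : f = I.D i
    · subst e4
      rcases h' with ⟨h1, h2, h3⟩ | ⟨h1, h2, h3⟩
      · exact absurd h1 e2
      · rw [h1] at li; omega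
    have := h.2.2.2.2.2 f hf e3 e4 e1 e2; unfold Lt at this; omega
  · by_cases e4 : f = I.D i
    · subst e4
      have h2 := h'.2.lt.2.2
      have h3 := h'.1
      rw [h3] at li; omega
    have := h.2.2.2.2 f hf e4 e1 e2; unfold Below at this; omega
  · obtain ⟨⟨p1, p2⟩, ⟨p3, p4⟩, p5, p6⟩ := h'
    have p5 := p5.lt.2.2
    have p6 := p6.lt.2.2
    by_cases e3 : f = I.U i
    · subst e3; omega
    by_cases e4 : f = I.D i
    · subst e4; omega
    have := h.2.2.2.2.2 f hf e3 e4 e1 e2; unfold Below at this; omega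

end Layered

end CPE

/-! ### A structured language with tables, compiled to the random access machine -/

namespace CPE

namespace Layered

/-- The start of the table area of the word memory. -/
def base (I : Layered) : ℕ := 2 * I.m + 2 * I.k

/-- The words and the memory are large enough. -/
structure Room (I : Layered) (nA W S : ℕ) : Prop where
  a_lt : ∀ e < I.m, I.a e < nA
  top_lt : 2 * nA < W
  word : I.base + 8 * (I.N * I.N) + 64 ≤ W
  space : I.base + 8 * (I.N * I.N) + 64 ≤ S

end Layered

/-- A store of the structured language: registers, word tables, real registers, a real table. -/
structure HStore where
  reg : ℕ → ℕ
  arr : ℕ → ℕ → ℕ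
  rreg : ℕ → ℝ
  V : ℕ → ℝ

namespace HStore

variable (h : HStore)

def sr (r v : ℕ) : HStore := { h with reg := Function.update h.reg r v }
def sa (c i v : ℕ) : HStore :=
  { h with arr := Function.update h.arr c (Function.update (h.arr c) i v) }
def srr (r : ℕ) (v : ℝ) : HStore := { h with rreg := Function.update h.rreg r v }
def sV (i : ℕ) (v : ℝ) : HStore := { h with V := Function.update h.V i v }

@[simp] lemma sr_reg (r v r' : ℕ) : (h.sr r v).reg r' = if r' = r then v else h.reg r' :=
  Function.update_apply ..
@[simp] lemma sr_arr (r v : ℕ) : (h.sr r v).arr = h.arr := rfl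
@[simp] lemma sr_rreg (r v : ℕ) : (h.sr r v).rreg = h.rreg := rfl
@[simp] lemma sr_V (r v : ℕ) : (h.sr r v).V = h.V := rfl
@[simp] lemma sa_reg (c i v : ℕ) : (h.sa c i v).reg = h.reg := rfl
@[simp] lemma sa_arr (c i v c' : ℕ) :
    (h.sa c i v).arr c' = if c' = c then Function.update (h.arr c) i v else h.arr c' :=
  Function.update_apply ..
@[simp] lemma sa_rreg (c i v : ℕ) : (h.sa c i v).rreg = h.rreg := rfl
@[simp] lemma sa_V (c i v : ℕ) : (h.sa c i v).V = h.V := rfl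
@[simp] lemma srr_reg (r : ℕ) (v : ℝ) : (h.srr r v).reg = h.reg := rfl
@[simp] lemma srr_arr (r : ℕ) (v : ℝ) : (h.srr r v).arr = h.arr := rfl
@[simp] lemma srr_rreg (r : ℕ) (v : ℝ) (r' : ℕ) :
    (h.srr r v).rreg r' = if r' = r then v else h.rreg r' := Function.update_apply ..
@[simp] lemma srr_V (r : ℕ) (v : ℝ) : (h.srr r v).V = h.V := rfl
@[simp] lemma sV_reg (i : ℕ) (v : ℝ) : (h.sV i v).reg = h.reg := rfl
@[simp] lemma sV_arr (i : ℕ) (v : ℝ) : (h.sV i v).arr = h.arr := rfl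
@[simp] lemma sV_V (i : ℕ) (v : ℝ) : (h.sV i v).V = Function.update h.V i v := rfl

end HStore

open RAM

/-- The address of cell `e` of word table `c`. -/
def adr (c : ℕ) (e : NExp) : NExp := .add (.reg 5) (.add (.mul (.lit 8) e) (.lit c))

/-- `nn` and `mm` are the numbers of items and of edges, `code` numbers the states, and `top` is a
sentinel exceeding every key. -/
inductive HN where
  | lit (v : ℕ)
  | reg (r : ℕ)
  | nn
  | mm
  | top
  | U (e : HN)
  | D (e : HN)
  | A (e : HN)
  | B (e : HN)
  | arr (c : ℕ) (e : HN)
  | code (e f : HN)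
  | succ (e : HN)
  | key (e : HN)

inductive HR where
  | zero
  | reg (r : ℕ)
  | V (e : HN)
  | w (e : HN)
  | add (x y : HR)

inductive HB where
  | eq (e f : HN)
  | lt (e f : HN)
  | rlt (x y : HR)
  | adj (e f : HN)
  | not (b : HB)
  | and (b c : HB)

inductive HP where
  | skip
  | setReg (r : ℕ) (e : HN)
  | setArr (c : ℕ) (i e : HN)
  | setRReg (r : ℕ) (x : HR)
  | setV (i : HN) (x : HR)
  | seq (p q : HP)
  | ite (b : HB) (p q : HP)
  | loop (b : HB) (p : HP)

-- The input stays in place below `base`. Above it eight tables are interleaved: columns 0 and 1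
-- hold `U` and `D`, column 2 the admissibility matrix, columns 3 to 7 the word tables 0 to 4
-- (closed flag, best state, two emitted edges, link). Registers are shifted by 6 to protect the
-- machine registers that hold constants.
@[simp] def HN.c : HN → NExp
  | .lit v => .lit v
  | .reg r => .reg (r + 6)
  | .nn => .reg 4
  | .mm => .reg 2
  | .top => .add (.reg 0) (.reg 0)
  | .U e => .load (adr 0 e.c)
  | .D e => .load (adr 1 e.c)
  | .A e => .load (.mul (.lit 2) e.c)
  | .B e => .load (.add (.mul (.lit 2) e.c) (.lit 1))
  | .arr c e => .load (adr (c + 3) e.c)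
  | .code e f => .add (.mul e.c (.reg 4)) f.c
  | .succ e => .add e.c (.lit 1)
  | .key e => .add (.load (.mul (.lit 2) (.load (adr 0 e.c))))
      (.load (.mul (.lit 2) (.load (adr 1 e.c))))

/-- The weights occupy the first `m` real cells, so the table of values starts at cell `m`. -/
def HR.c : HR → RExp
  | .zero => .zero
  | .reg r => .reg r
  | .V e => .load (.add (.reg 2) e.c)
  | .w e => .load e.c
  | .add x y => .add x.c y.c

def HB.c : HB → BExp
  | .eq e f => .eq e.c f.c
  | .lt e f => .lt e.c f.c
  | .rlt x y => .rlt x.c y.c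
  | .adj e f => .eq (.load (adr 2 (HN.code e f).c)) (.lit 1)
  | .not b => .not b.c
  | .and b c => .and b.c c.c

def HP.c : HP → Prog
  | .skip => .skip
  | .setReg r e => .setReg (r + 6) e.c
  | .setArr c i e => .setMem (adr (c + 3) i.c) e.c
  | .setRReg r x => .setRReg r x.c
  | .setV i x => .setRMem (.add (.reg 2) i.c) x.c
  | .seq p q => .seq p.c q.c
  | .ite b p q => .ite b.c p.c q.c
  | .loop b p => .loop b.c p.c

/-! ### Meaning of the structured language and conditions for the absence of faults -/

section Semantics

variable (I : Layered) (nA : ℕ) (h : HStore)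

/-- The key of an item, by which the items are ordered. -/
def Layered.key (j : ℕ) : ℕ := I.a (I.U j) + I.a (I.D j)

@[simp] def HN.den : HN → ℕ
  | .lit v => v
  | .reg r => h.reg r
  | .nn => I.N
  | .mm => I.m
  | .top => 2 * nA
  | .U e => I.U e.den
  | .D e => I.D e.den
  | .A e => I.a e.den
  | .B e => I.b e.den
  | .arr c e => h.arr c e.den
  | .code e f => e.den * I.N + f.den
  | .succ e => e.den + 1
  | .key e => I.key e.den

@[simp] def HN.ok : HN → Prop
  | .lit v => v ≤ 8
  | .reg _ => True
  | .nn => True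
  | .mm => True
  | .top => True
  | .U e => e.ok ∧ e.den I nA h < I.N
  | .D e => e.ok ∧ e.den I nA h < I.N
  | .A e => e.ok ∧ e.den I nA h < I.m
  | .B e => e.ok ∧ e.den I nA h < I.m
  | .arr c e => e.ok ∧ c < 5 ∧ e.den I nA h < I.N * I.N
  | .code e f => e.ok ∧ f.ok ∧ e.den I nA h < I.N ∧ f.den I nA h < I.N
  | .succ e => e.ok ∧ e.den I nA h < I.N * I.N
  | .key e => e.ok ∧ e.den I nA h < I.N

@[simp] def HR.den : HR → ℝ
  | .zero => 0
  | .reg r => h.rreg r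
  | .V e => h.V (e.den I nA h)
  | .w e => I.w (e.den I nA h)
  | .add x y => x.den + y.den

@[simp] def HR.ok : HR → Prop
  | .zero => True
  | .reg _ => True
  | .V e => e.ok I nA h ∧ e.den I nA h < I.N * I.N
  | .w e => e.ok I nA h ∧ e.den I nA h < I.m
  | .add x y => x.ok ∧ y.ok

@[simp] def HB.den : HB → Prop
  | .eq e f => e.den I nA h = f.den I nA h
  | .lt e f => e.den I nA h < f.den I nA h
  | .rlt x y => x.den I nA h < y.den I nA h
  | .adj e f => I.Adj (e.den I nA h) (f.den I nA h)
  | .not b => ¬ b.den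
  | .and b c => b.den ∧ c.den

@[simp] def HB.ok : HB → Prop
  | .eq e f => e.ok I nA h ∧ f.ok I nA h
  | .lt e f => e.ok I nA h ∧ f.ok I nA h
  | .rlt x y => x.ok I nA h ∧ y.ok I nA h
  | .adj e f => e.ok I nA h ∧ f.ok I nA h ∧ e.den I nA h < I.m ∧ f.den I nA h < I.m
  | .not b => b.ok
  | .and b c => b.ok ∧ c.ok

end Semantics

/-- The machine store `s` represents `h`. -/
structure Sim (I : Layered) (nA : ℕ) (s : Store) (h : HStore) : Prop where
  r0 : s.reg 0 = nA
  r2 : s.reg 2 = I.m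
  r4 : s.reg 4 = I.N
  r5 : s.reg 5 = I.base
  reg : ∀ r, s.reg (r + 6) = h.reg r
  a : ∀ e < I.m, s.mem (2 * e) = I.a e
  b : ∀ e < I.m, s.mem (2 * e + 1) = I.b e
  U : ∀ i < I.N, s.mem (I.base + (8 * i + 0)) = I.U i
  D : ∀ i < I.N, s.mem (I.base + (8 * i + 1)) = I.D i
  adj : ∀ u < I.m, ∀ v < I.m, s.mem (I.base + (8 * (u * I.N + v) + 2)) = 1 ↔ I.Adj u v
  arr : ∀ c < 5, ∀ i < I.N * I.N, s.mem (I.base + (8 * i + (c + 3))) = h.arr c i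
  rreg : ∀ r, s.rreg r = h.rreg r
  w : ∀ e < I.m, s.rmem e = I.w e
  V : ∀ i < I.N * I.N, s.rmem (I.m + i) = h.V i

/-! ### Correctness of compiled expressions and assignments -/

section

variable {I : Layered} {nA W S : ℕ} {s : Store} {h : HStore}

lemma code_lt {i j N : ℕ} (hi : i < N) (hj : j < N) : i * N + j < N * N := by
  have : (i + 1) * N ≤ N * N := Nat.mul_le_mul_right N hi
  linarith [Nat.succ_mul i N]

lemma Layered.N_le_sq : I.N ≤ I.N * I.N := Nat.le_mul_self _

lemma adr_eval (R : I.Room nA W S) (h5 : s.reg 5 = I.base) {e : NExp} {v c : ℕ}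
    (he : e.eval W S s = some v) (hv : v < I.N * I.N) (hc : c ≤ 7) :
    (adr c e).eval W S s = some (I.base + (8 * v + c)) := by
  have := R.word
  simp only [adr, NExp.eval, he, h5, fit, Option.bind_some]
  rw [if_pos (by omega), Option.bind_some, if_pos (by omega), Option.bind_some,
    if_pos (by omega), Option.bind_some, if_pos (by omega), Option.bind_some, if_pos (by omega)]

lemma adr_load (R : I.Room nA W S) (h5 : s.reg 5 = I.base) {e : NExp} {v c : ℕ}
    (he : e.eval W S s = some v) (hv : v < I.N * I.N) (hc : c ≤ 7) :
    (NExp.load (adr c e)).eval W S s = some (s.mem (I.base + (8 * v + c))) := by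
  have := R.space
  rw [NExp.eval, adr_eval R h5 he hv hc, Option.bind_some, if_pos (by omega)]

lemma a_load (R : I.Room nA W S) (hs : Sim I nA s h) {e : NExp} {v : ℕ}
    (he : e.eval W S s = some v) (hv : v < I.m) :
    (NExp.load (.mul (.lit 2) e)).eval W S s = some (I.a v) := by
  have := R.word; have := R.space; have : I.base = 2 * I.m + 2 * I.k := rfl
  simp only [NExp.eval, he, fit, Option.bind_some]
  rw [if_pos (by omega), Option.bind_some, if_pos (by omega), Option.bind_some,
    if_pos (by omega), hs.a v hv]

lemma b_load (R : I.Room nA W S) (hs : Sim I nA s h) {e : NExp} {v : ℕ}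
    (he : e.eval W S s = some v) (hv : v < I.m) :
    (NExp.load (.add (.mul (.lit 2) e) (.lit 1))).eval W S s = some (I.b v) := by
  have := R.word; have := R.space; have : I.base = 2 * I.m + 2 * I.k := rfl
  simp only [NExp.eval, he, fit, Option.bind_some]
  rw [if_pos (by omega), Option.bind_some, if_pos (by omega), Option.bind_some,
    if_pos (by omega), Option.bind_some, if_pos (by omega), Option.bind_some,
    if_pos (by omega), hs.b v hv]

lemma HN.eval_c (R : I.Room nA W S) (hs : Sim I nA s h) (e : HN) (hok : e.ok I nA h) :
    e.c.eval W S s = some (e.den I nA h) := by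
  have hW := R.word
  have hN := I.N_le_sq
  induction e with
  | lit v =>
    have : v ≤ 8 := hok
    simp only [HN.c, NExp.eval, fit, HN.den]; rw [if_pos (by omega)]
  | reg r => simp only [HN.c, NExp.eval, HN.den, hs.reg]
  | nn => simp only [HN.c, NExp.eval, HN.den, hs.r4]
  | mm => simp only [HN.c, NExp.eval, HN.den, hs.r2]
  | top =>
    have := R.top_lt
    simp only [HN.c, NExp.eval, HN.den, hs.r0, Option.bind_some, fit]
    rw [if_pos (by omega), two_mul]
  | U e ih =>
    obtain ⟨h1, h2⟩ := hok
    rw [HN.c, adr_load R hs.r5 (ih h1) (by omega) (by omega), hs.U _ h2, HN.den]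
  | D e ih =>
    obtain ⟨h1, h2⟩ := hok
    rw [HN.c, adr_load R hs.r5 (ih h1) (by omega) (by omega), hs.D _ h2, HN.den]
  | A e ih =>
    obtain ⟨h1, h2⟩ := hok
    rw [HN.c, a_load R hs (ih h1) h2, HN.den]
  | B e ih =>
    obtain ⟨h1, h2⟩ := hok
    rw [HN.c, b_load R hs (ih h1) h2, HN.den]
  | arr c e ih =>
    obtain ⟨h1, h2, h3⟩ := hok
    rw [HN.c, adr_load R hs.r5 (ih h1) h3 (by omega), hs.arr c h2 _ h3, HN.den]
  | code e f ihe ihf =>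
    obtain ⟨h1, h2, h3, h4⟩ := hok
    have := code_lt h3 h4
    simp only [HN.c, NExp.eval, HN.den, ihe h1, ihf h2, hs.r4, Option.bind_some, fit]
    rw [if_pos (by omega), Option.bind_some, if_pos (by omega)]
  | succ e ih =>
    obtain ⟨h1, h2⟩ := hok
    simp only [HN.c, NExp.eval, HN.den, ih h1, Option.bind_some, fit]
    rw [if_pos (by omega), Option.bind_some, if_pos (by omega)]
  | key e ih =>
    obtain ⟨h1, h2⟩ := hok
    have eU := adr_load (c := 0) R hs.r5 (ih h1) (by omega) (by omega)
    have eD := adr_load (c := 1) R hs.r5 (ih h1) (by omega) (by omega)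
    rw [hs.U _ h2] at eU
    rw [hs.D _ h2] at eD
    have lU := Layered.U_lt h2
    have lD := Layered.D_lt h2
    have := R.a_lt _ lU; have := R.a_lt _ lD; have := R.top_lt
    rw [HN.c, NExp.eval, a_load R hs eU lU, a_load R hs eD lD, Option.bind_some, Option.bind_some,
      fit, if_pos (by omega)]
    rfl

lemma HR.eval_c (R : I.Room nA W S) (hs : Sim I nA s h) (x : HR) (hok : x.ok I nA h) :
    x.c.eval W S s = some (x.den I nA h) := by
  have hW := R.word
  have hS := R.space
  have hb : I.base = 2 * I.m + 2 * I.k := rfl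
  induction x with
  | zero => rfl
  | reg r => simp only [HR.c, RExp.eval, HR.den, hs.rreg]
  | V e =>
    obtain ⟨h1, h2⟩ := hok
    simp only [HR.c, RExp.eval, NExp.eval, HN.eval_c R hs e h1, hs.r2, Option.bind_some, fit]
    rw [if_pos (by omega), Option.bind_some, if_pos (by omega), hs.V _ h2, HR.den]
  | w e =>
    obtain ⟨h1, h2⟩ := hok
    simp only [HR.c, RExp.eval, HN.eval_c R hs e h1, Option.bind_some]
    rw [if_pos (by omega), hs.w _ h2, HR.den]
  | add x y ihx ihy =>
    simp only [HR.c, RExp.eval, ihx hok.1, ihy hok.2, Option.bind_some, HR.den]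

lemma HB.eval_c (R : I.Room nA W S) (hs : Sim I nA s h) (b : HB) (hok : b.ok I nA h) :
    ∃ v, b.c.eval W S s = some v ∧ (v = true ↔ b.den I nA h) := by
  have hW := R.word
  induction b with
  | eq e f =>
    exact ⟨_, by rw [HB.c, BExp.eval, HN.eval_c R hs e hok.1, HN.eval_c R hs f hok.2]; rfl,
      by simp⟩
  | lt e f =>
    exact ⟨_, by rw [HB.c, BExp.eval, HN.eval_c R hs e hok.1, HN.eval_c R hs f hok.2]; rfl,
      by simp⟩
  | rlt x y =>
    exact ⟨_, by rw [HB.c, BExp.eval, HR.eval_c R hs x hok.1, HR.eval_c R hs y hok.2]; rfl,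
      by simp⟩
  | adj e f =>
    obtain ⟨h1, h2, h3, h4⟩ := hok
    have hm : I.m ≤ I.N := Nat.le_add_right _ _
    have h5 : e.den I nA h < I.N := by omega
    have h6 : f.den I nA h < I.N := by omega
    have hc := HN.eval_c R hs (.code e f) ⟨h1, h2, h5, h6⟩
    refine ⟨decide (s.mem (I.base + (8 * (e.den I nA h * I.N + f.den I nA h) + 2)) = 1), ?_, ?_⟩
    · rw [HB.c, BExp.eval, adr_load R hs.r5 hc (code_lt h5 h6) (by omega), Option.bind_some, NExp.eval,
        fit, if_pos (by omega), Option.bind_some, HN.den]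
    · simpa using hs.adj _ h3 _ h4
  | not b ih =>
    obtain ⟨v, h1, h2⟩ := ih hok
    exact ⟨!v, by rw [HB.c, BExp.eval, h1]; rfl, by simp [← h2]⟩
  | and b c ihb ihc =>
    obtain ⟨v, h1, h2⟩ := ihb hok.1
    obtain ⟨v', h3, h4⟩ := ihc hok.2
    exact ⟨v && v', by rw [HB.c, BExp.eval, h1, h3]; rfl, by simp [h2, h4]⟩

lemma Sim.setReg (hs : Sim I nA s h) (r v : ℕ) :
    Sim I nA { s with reg := Function.update s.reg (r + 6) v } (h.sr r v) := by
  refine ⟨?_, ?_, ?_, ?_, ?_, hs.a, hs.b, hs.U, hs.D, hs.adj, hs.arr, hs.rreg, hs.w, hs.V⟩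
  · simpa [Function.update_apply] using hs.r0
  · simpa [Function.update_apply] using hs.r2
  · simpa [Function.update_apply] using hs.r4
  · simpa [Function.update_apply] using hs.r5
  · intro r'
    simp [Function.update_apply, hs.reg]

lemma Sim.setRReg (hs : Sim I nA s h) (r : ℕ) (v : ℝ) :
    Sim I nA { s with rreg := Function.update s.rreg r v } (h.srr r v) := by
  refine ⟨hs.r0, hs.r2, hs.r4, hs.r5, hs.reg, hs.a, hs.b, hs.U, hs.D, hs.adj, hs.arr, ?_, hs.w,
    hs.V⟩
  intro r'
  simp [Function.update_apply, hs.rreg]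

/-- Different columns have addresses with different residues modulo 8, and all of them are beyond
the input, so nothing else is overwritten. -/
lemma Sim.setArr (hs : Sim I nA s h) {c i : ℕ} (v : ℕ) (hc : c < 5) (hi : i < I.N * I.N) :
    Sim I nA { s with mem := Function.update s.mem (I.base + (8 * i + (c + 3))) v }
      (h.sa c i v) := by
  have hb : I.base = 2 * I.m + 2 * I.k := rfl
  refine ⟨hs.r0, hs.r2, hs.r4, hs.r5, hs.reg, ?_, ?_, ?_, ?_, ?_, ?_, hs.rreg, hs.w, hs.V⟩
  · intro e he; dsimp only; rw [Function.update_of_ne (by omega)]; exact hs.a e he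
  · intro e he; dsimp only; rw [Function.update_of_ne (by omega)]; exact hs.b e he
  · intro e he; dsimp only; rw [Function.update_of_ne (by omega)]; exact hs.U e he
  · intro e he; dsimp only; rw [Function.update_of_ne (by omega)]; exact hs.D e he
  · intro u hu e he; dsimp only; rw [Function.update_of_ne (by omega)]; exact hs.adj u hu e he
  · intro c' hc' i' hi'
    dsimp only
    rw [HStore.sa_arr]
    split_ifs with h1
    · subst h1
      by_cases h2 : i' = i
      · subst h2; simp
      · rw [Function.update_of_ne (by omega), Function.update_of_ne h2, hs.arr _ hc' _ hi']
    · rw [Function.update_of_ne (by omega), hs.arr _ hc' _ hi']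

lemma Sim.setV (hs : Sim I nA s h) {i : ℕ} (v : ℝ) :
    Sim I nA { s with rmem := Function.update s.rmem (I.m + i) v } (h.sV i v) := by
  refine ⟨hs.r0, hs.r2, hs.r4, hs.r5, hs.reg, hs.a, hs.b, hs.U, hs.D, hs.adj, hs.arr, hs.rreg,
    ?_, ?_⟩
  · intro e he; dsimp only; rw [Function.update_of_ne (by omega)]; exact hs.w e he
  · intro i' hi'
    dsimp only
    rw [HStore.sV_V, Function.update_apply, Function.update_apply]
    split_ifs with h1 h2 h2
    · rfl
    · omega
    · omega
    · exact hs.V i' hi'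

end

/-! ### Rules for running programs -/

section Run

variable (I : Layered) (nA W S : ℕ)

/-- `p` runs without a fault from every representation of `h`, and `Q` holds of the time and of
the final store. -/
def HRunQ (p : HP) (h : HStore) (Q : ℕ → HStore → Prop) : Prop :=
  ∀ s, Sim I nA s h → ∃ t s' h', Exec W S p.c s t s' ∧ Sim I nA s' h' ∧ Q t h'

def HRun (p : HP) (h : HStore) (T : ℕ) (Q : HStore → Prop) : Prop :=
  HRunQ I nA W S p h fun t h' => t ≤ T ∧ Q h'

/-- The weakest precondition of a program without loops. -/
@[simp] def HP.wp : HP → (HStore → Prop) → HStore → Prop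
  | .skip, Q, h => Q h
  | .setReg r e, Q, h => e.ok I nA h ∧ Q (h.sr r (e.den I nA h))
  | .setArr c i e, Q, h => c < 5 ∧ i.ok I nA h ∧ i.den I nA h < I.N * I.N ∧ e.ok I nA h ∧
      Q (h.sa c (i.den I nA h) (e.den I nA h))
  | .setRReg r x, Q, h => x.ok I nA h ∧ Q (h.srr r (x.den I nA h))
  | .setV i x, Q, h => i.ok I nA h ∧ i.den I nA h < I.N * I.N ∧ x.ok I nA h ∧
      Q (h.sV (i.den I nA h) (x.den I nA h))
  | .seq p q, Q, h => p.wp (q.wp Q) h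
  | .ite b p q, Q, h => b.ok I nA h ∧ (b.den I nA h → p.wp Q h) ∧ (¬ b.den I nA h → q.wp Q h)
  | .loop _ _, _, _ => False

/-- A time bound for a program without loops. -/
def HP.cst : HP → ℕ
  | .skip => 1
  | .setReg _ e => e.c.cost + 1
  | .setArr c i e => (adr (c + 3) i.c).cost + e.c.cost + 1
  | .setRReg _ x => x.c.cost + 1
  | .setV i x => (NExp.add (.reg 2) i.c).cost + x.c.cost + 1
  | .seq p q => p.cst + q.cst
  | .ite b p q => b.c.cost + 1 + (p.cst + q.cst)
  | .loop _ _ => 0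

variable {I nA W S}

/-- Reduces every loop-free block to a weakest precondition that `simp` can unfold. -/
theorem HRun.of_wp (R : I.Room nA W S) {p : HP} {h : HStore} {Q : HStore → Prop}
    (hw : p.wp I nA Q h) : HRun I nA W S p h p.cst Q := by
  have hW := R.word
  have hS := R.space
  have hb : I.base = 2 * I.m + 2 * I.k := rfl
  induction p generalizing h Q with
  | skip => exact fun s hs => ⟨_, _, h, .skip s, hs, le_rfl, hw⟩
  | setReg r e =>
    intro s hs
    exact ⟨_, _, _, .setReg (HN.eval_c R hs e hw.1), hs.setReg r _, le_rfl, hw.2⟩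
  | setArr c i e =>
    intro s hs
    obtain ⟨h1, h2, h3, h4, h5⟩ := hw
    exact ⟨_, _, _, .setMem (adr_eval R hs.r5 (HN.eval_c R hs i h2) h3 (by omega)) (by omega)
      (HN.eval_c R hs e h4), hs.setArr _ h1 h3, le_rfl, h5⟩
  | setRReg r x =>
    intro s hs
    exact ⟨_, _, _, .setRReg (HR.eval_c R hs x hw.1), hs.setRReg r _, le_rfl, hw.2⟩
  | setV i x =>
    intro s hs
    obtain ⟨h2, h3, h4, h5⟩ := hw
    refine ⟨_, _, _, .setRMem (i := I.m + i.den I nA h) ?_ (by omega) (HR.eval_c R hs x h4),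
      hs.setV _, le_rfl, h5⟩
    simp only [NExp.eval, HN.eval_c R hs i h2, hs.r2, Option.bind_some, fit]
    rw [if_pos (by omega)]
  | seq p q ihp ihq =>
    intro s hs
    obtain ⟨t, s', h', e1, hs', ht, hw'⟩ := ihp hw s hs
    obtain ⟨t', s'', h'', e2, hs'', ht', hQ⟩ := ihq hw' s' hs'
    exact ⟨_, _, _, .seq e1 e2, hs'', Nat.add_le_add ht ht', hQ⟩
  | ite b p q ihp ihq =>
    intro s hs
    obtain ⟨h1, h2, h3⟩ := hw
    obtain ⟨v, hv, hv'⟩ := HB.eval_c R hs b h1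
    by_cases hd : b.den I nA h
    · obtain ⟨t, s', h', e1, hs', ht, hQ⟩ := ihp (h2 hd) s hs
      rw [hv'.2 hd] at hv
      exact ⟨_, _, _, .iteTrue hv e1, hs', by simp only [HP.cst]; omega, hQ⟩
    · obtain ⟨t, s', h', e1, hs', ht, hQ⟩ := ihq (h3 hd) s hs
      have : v = false := by simpa using fun hvt => hd (hv'.1 hvt)
      rw [this] at hv
      exact ⟨_, _, _, .iteFalse hv e1, hs', by simp only [HP.cst]; omega, hQ⟩
  | loop => exact hw.elim

theorem HRunQ.seq {p q : HP} {h : HStore} {Q : ℕ → HStore → Prop} {T : ℕ} {Q' : HStore → Prop}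
    (hp : HRun I nA W S p h T Q')
    (hq : ∀ h', Q' h' → HRunQ I nA W S q h' fun t h'' => ∀ t' ≤ T, Q (t' + t) h'') :
    HRunQ I nA W S (.seq p q) h Q := by
  intro s hs
  obtain ⟨t, s', h', e1, hs', ht, hQ⟩ := hp s hs
  obtain ⟨t', s'', h'', e2, hs'', hQ'⟩ := hq h' hQ s' hs'
  exact ⟨_, _, _, .seq e1 e2, hs'', hQ' t ht⟩

theorem HRun.seq {p q : HP} {h : HStore} {Q' Q : HStore → Prop} {T T' : ℕ}
    (hp : HRun I nA W S p h T Q') (hq : ∀ h', Q' h' → HRun I nA W S q h' T' Q) :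
    HRun I nA W S (.seq p q) h (T + T') Q :=
  HRunQ.seq hp fun h' hQ' s hs => by
    obtain ⟨t, s', h'', e, hs', ht, hQ⟩ := hq h' hQ' s hs
    exact ⟨t, s', h'', e, hs', fun t' ht' => ⟨by omega, hQ⟩⟩

theorem HRun.mono {p : HP} {h : HStore} {Q' Q : HStore → Prop} {T T' : ℕ}
    (hp : HRun I nA W S p h T Q') (hT : T ≤ T') (hQ : ∀ h', Q' h' → Q h') :
    HRun I nA W S p h T' Q := by
  intro s hs
  obtain ⟨t, s', h', e, hs', ht, hq⟩ := hp s hs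
  exact ⟨t, s', h', e, hs', ht.trans hT, hQ _ hq⟩

theorem HRun.ite (R : I.Room nA W S) {b : HB} {p q : HP} {h : HStore} {Q : HStore → Prop} {T : ℕ}
    (hb : b.ok I nA h) (hp : b.den I nA h → HRun I nA W S p h T Q)
    (hq : ¬ b.den I nA h → HRun I nA W S q h T Q) :
    HRun I nA W S (.ite b p q) h (b.c.cost + 1 + T) Q := by
  intro s hs
  obtain ⟨v, hv, hv'⟩ := HB.eval_c R hs b hb
  by_cases hd : b.den I nA h
  · obtain ⟨t, s', h', e1, hs', ht, hQ⟩ := hp hd s hs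
    rw [hv'.2 hd] at hv
    exact ⟨_, _, _, .iteTrue hv e1, hs', by omega, hQ⟩
  · obtain ⟨t, s', h', e1, hs', ht, hQ⟩ := hq hd s hs
    have : v = false := by simpa using fun hvt => hd (hv'.1 hvt)
    rw [this] at hv
    exact ⟨_, _, _, .iteFalse hv e1, hs', by omega, hQ⟩

/-- Run register `r` from `lo` up to the number of items. -/
def forUp (r : ℕ) (lo : HN) (p : HP) : HP :=
  .seq (.setReg r lo) (.loop (.lt (.reg r) .nn) (.seq p (.setReg r (.succ (.reg r)))))

/-- Each round pays 4 for the test and 4 for the increment, hence the 8; the last, failing test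
costs another 4. The invariant is stated for the store in which the counter is already set. -/
theorem HRun.forUp (R : I.Room nA W S) {r : ℕ} {lo : HN} {p : HP} {h : HStore}
    {Iv : ℕ → HStore → Prop} {T : ℕ} (hlo : lo.ok I nA h) (hN : lo.den I nA h ≤ I.N)
    (h0 : Iv (lo.den I nA h) (h.sr r (lo.den I nA h)))
    (hstep : ∀ i h', lo.den I nA h ≤ i → i < I.N → h'.reg r = i → Iv i h' →
      HRun I nA W S p h' T fun h'' => h''.reg r = i ∧ Iv (i + 1) (h''.sr r (i + 1))) :
    HRun I nA W S (CPE.forUp r lo p) h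
      (lo.c.cost + 5 + (I.N - lo.den I nA h) * (T + 8)) (Iv I.N) := by
  have key : ∀ d i h', lo.den I nA h ≤ i → i + d = I.N → h'.reg r = i → Iv i h' →
      HRun I nA W S (.loop (.lt (.reg r) .nn) (.seq p (.setReg r (.succ (.reg r))))) h'
        (4 + d * (T + 8)) (Iv I.N) := by
    intro d
    induction d with
    | zero =>
      intro i h' hi hd hr hI s hs
      obtain ⟨v, hv, hv'⟩ := HB.eval_c R hs (.lt (.reg r) .nn) ⟨trivial, trivial⟩
      have : v = false := by
        simp only [HB.den, HN.den, hr] at hv'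
        have : ¬ v = true := fun h1 => by have := hv'.1 h1; omega
        simpa using this
      rw [this] at hv
      refine ⟨_, _, _, .loopFalse hv, hs, ?_, ?_⟩
      · simp [BExp.cost, NExp.cost, HB.c, HN.c]
      · rwa [show i = I.N by omega] at hI
    | succ d ih =>
      intro i h' hi hd hr hI s hs
      obtain ⟨v, hv, hv'⟩ := HB.eval_c R hs (.lt (.reg r) .nn) ⟨trivial, trivial⟩
      have : v = true := by
        simp only [HB.den, HN.den, hr] at hv'
        exact hv'.2 (by omega)
      rw [this] at hv
      obtain ⟨t, s', h1, e1, hs1, ht, hr1, hI1⟩ := hstep i h' hi (by omega) hr hI s hs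
      have hok : (HN.succ (.reg r)).ok I nA h1 := by
        have := I.N_le_sq
        simp only [HN.ok, HN.den, hr1, true_and]; omega
      have e2 := HN.eval_c R hs1 _ hok
      have hs2 := hs1.setReg r ((HN.succ (.reg r)).den I nA h1)
      simp only [HN.den, hr1] at hs2
      obtain ⟨t', s'', h2, e3, hs3, ht', hI2⟩ := ih (i + 1) _ (by omega) (by omega) (by simp) hI1 _ hs2
      refine ⟨_, _, _, .loopTrue hv (.seq e1 (.setReg (by simpa [hr1] using e2))) e3, hs3, ?_, hI2⟩
      simp only [HB.c, HN.c, BExp.cost, NExp.cost]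
      have : (d + 1) * (T + 8) = d * (T + 8) + (T + 8) := Nat.succ_mul _ _
      omega
  have h1 : HRun I nA W S (.setReg r lo) h (lo.c.cost + 1) (fun h' => h' = h.sr r (lo.den I nA h)) :=
    HRun.of_wp R (p := .setReg r lo) ⟨hlo, rfl⟩
  refine (HRun.seq h1 (T' := 4 + (I.N - lo.den I nA h) * (T + 8)) (Q := Iv I.N) ?_).mono
    (by omega) fun _ => id
  rintro h' rfl
  exact key _ _ _ le_rfl (by omega) (by simp) h0

/-- A loop that removes one element of a finite set in each round. -/
theorem HRun.todo (R : I.Room nA W S) {b : HB} {p : HP} {Iv : Finset ℕ → HStore → Prop}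
    {cost : ℕ → ℕ} (hb : ∀ X h, Iv X h → b.ok I nA h ∧ (b.den I nA h ↔ X.Nonempty))
    (hp : ∀ X h, Iv X h → X.Nonempty →
      HRunQ I nA W S p h fun t h' => ∃ j ∈ X, t ≤ cost j ∧ Iv (X.erase j) h')
    (X : Finset ℕ) (h : HStore) (hI : Iv X h) :
    HRun I nA W S (.loop b p) h (b.c.cost + 1 + ∑ j ∈ X, (cost j + (b.c.cost + 1))) (Iv ∅) := by
  induction hn : X.card using Nat.strong_induction_on generalizing X h with
  | _ n ih =>
    intro s hs
    obtain ⟨hok, hden⟩ := hb X h hI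
    obtain ⟨v, hv, hv'⟩ := HB.eval_c R hs b hok
    by_cases hX : X.Nonempty
    · rw [hv'.2 (hden.2 hX)] at hv
      obtain ⟨t, s', h', e1, hs', j, hj, ht, hI'⟩ := hp X h hI hX s hs
      have hlt : (X.erase j).card < n := hn ▸ Finset.card_erase_lt_of_mem hj
      obtain ⟨t', s'', h'', e2, hs'', ht', hI''⟩ := ih _ hlt (X.erase j) h' hI' rfl s' hs'
      refine ⟨_, _, _, .loopTrue hv e1 e2, hs'', ?_, hI''⟩
      rw [← Finset.add_sum_erase X _ hj]
      omega
    · have : v = false := by simpa using fun hvt => hX (hden.1 (hv'.1 hvt))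
      rw [this] at hv
      refine ⟨_, _, _, .loopFalse hv, hs, Nat.le_add_right _ _, ?_⟩
      rwa [Finset.not_nonempty_iff_eq_empty.1 hX] at hI

end Run

end CPE

/-! ### The tables of the dynamic program -/

namespace CPE

namespace Layered

/-- The tables of states: emitted edges, link to the previous state (plus one), value. -/
structure Tab where
  e1 : ℕ → ℕ
  e2 : ℕ → ℕ
  nx : ℕ → ℕ
  V : ℕ → ℝ

variable (I : Layered)

/-- Following the links from `p` through states in `F` emits the edges of `M`. -/
inductive Tr (T : Tab) (F : ℕ → ℕ → Prop) : ℕ → Finset ℕ → Prop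
  | nil : Tr T F 0 ∅
  | cons {i j : ℕ} {M : Finset ℕ} (hi : i < I.N) (hj : j < I.N) (hF : F i j)
      (h : Tr T F (T.nx (i * I.N + j)) M)
      (hd : Disjoint {T.e1 (i * I.N + j), T.e2 (i * I.N + j)} M) :
      Tr T F (i * I.N + j + 1) ({T.e1 (i * I.N + j), T.e2 (i * I.N + j)} ∪ M)

/-- The value and the links of the state `(i, j)` are correct. -/
def StOK (T : Tab) (F : ℕ → ℕ → Prop) (i j : ℕ) : Prop :=
  (∀ M, I.Sem i j M → I.wt M ≤ T.V (i * I.N + j)) ∧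
  (T.V (i * I.N + j) = 0 ∨
    ∃ M, I.Sem i j M ∧ I.wt M = T.V (i * I.N + j) ∧ I.Tr T F (i * I.N + j + 1) M) ∧
  (i = j → T.V (i * I.N + j) ≠ 0)

def AllOK (T : Tab) (F : ℕ → ℕ → Prop) : Prop := ∀ i < I.N, ∀ j < I.N, F i j → I.StOK T F i j

/-- `v, x, y, p` are a correct entry for the state `(i, j)`. -/
def Cand (T : Tab) (F : ℕ → ℕ → Prop) (i j : ℕ) (v : ℝ) (x y p : ℕ) : Prop :=
  (∀ M, I.Sem i j M → I.wt M ≤ v) ∧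
  (v = 0 ∨ ∃ M, I.Sem i j ({x, y} ∪ M) ∧ I.wt ({x, y} ∪ M) = v ∧ I.Tr T F p M ∧
    Disjoint {x, y} M) ∧
  (i = j → v ≠ 0)

variable {I}

lemma code_inj {N i j i' j' : ℕ} (hj : j < N) (hj' : j' < N) (h : i * N + j = i' * N + j') :
    i = i' ∧ j = j' := by
  have h0 : 0 < N := by omega
  have h1 : (i * N + j) / N = i := by
    rw [mul_comm, Nat.mul_add_div h0, Nat.div_eq_of_lt hj, Nat.add_zero]
  have h2 : (i' * N + j') / N = i' := by
    rw [mul_comm, Nat.mul_add_div h0, Nat.div_eq_of_lt hj', Nat.add_zero]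
  have : i = i' := by rw [← h1, ← h2, h]
  subst this
  exact ⟨rfl, by omega⟩

/-- A trace reads only cells of states in `F`, so it survives any change elsewhere and any
enlargement of `F`. -/
lemma Tr.mono {T T' : Tab} {F F' : ℕ → ℕ → Prop} {p : ℕ} {M : Finset ℕ} (h : I.Tr T F p M)
    (hT : ∀ i < I.N, ∀ j < I.N, F i j → T'.e1 (i * I.N + j) = T.e1 (i * I.N + j) ∧
      T'.e2 (i * I.N + j) = T.e2 (i * I.N + j) ∧ T'.nx (i * I.N + j) = T.nx (i * I.N + j))
    (hF : ∀ i j, F i j → F' i j) : I.Tr T' F' p M := by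
  induction h with
  | nil => exact .nil
  | @cons i j M hi hj hFij _ hd ih =>
    obtain ⟨h1, h2, h3⟩ := hT i hi j hj hFij
    rw [← h1, ← h2]
    rw [← h3] at ih
    rw [← h1, ← h2] at hd
    exact .cons hi hj (hF _ _ hFij) ih hd

/-- `T'` agrees with `T` on the states in `F`. -/
def Agree (I : Layered) (T T' : Tab) (F : ℕ → ℕ → Prop) : Prop :=
  ∀ i < I.N, ∀ j < I.N, F i j → T'.e1 (i * I.N + j) = T.e1 (i * I.N + j) ∧
    T'.e2 (i * I.N + j) = T.e2 (i * I.N + j) ∧ T'.nx (i * I.N + j) = T.nx (i * I.N + j) ∧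
    T'.V (i * I.N + j) = T.V (i * I.N + j)

lemma Agree.tr {T T' : Tab} {F F' : ℕ → ℕ → Prop} {p : ℕ} {M : Finset ℕ} (ha : I.Agree T T' F)
    (hF : ∀ i j, F i j → F' i j) (h : I.Tr T F p M) : I.Tr T' F' p M :=
  h.mono (fun i hi j hj hf => ⟨(ha i hi j hj hf).1, (ha i hi j hj hf).2.1,
    (ha i hi j hj hf).2.2.1⟩) hF

lemma AllOK.congr {T : Tab} {F F' : ℕ → ℕ → Prop} (h : I.AllOK T F)
    (hF : ∀ i < I.N, ∀ j < I.N, F i j ↔ F' i j) : I.AllOK T F' := by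
  have htr : ∀ p M, I.Tr T F p M → I.Tr T F' p M := by
    intro p M ht
    induction ht with
    | nil => exact .nil
    | cons hi hj hf _ hd ih => exact .cons hi hj ((hF _ hi _ hj).1 hf) ih hd
  intro i hi j hj hf
  obtain ⟨h1, h2, h3⟩ := h i hi j hj ((hF i hi j hj).2 hf)
  exact ⟨h1, h2.imp_right fun ⟨M, a, b, c⟩ => ⟨M, a, b, htr _ _ c⟩, h3⟩

/-- The tables after storing an entry. -/
def Tab.set (T : Tab) (c : ℕ) (v : ℝ) (x y p : ℕ) : Tab :=
  ⟨Function.update T.e1 c x, Function.update T.e2 c y, Function.update T.nx c p,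
    Function.update T.V c v⟩

lemma agree_set {T : Tab} {F : ℕ → ℕ → Prop} {i j : ℕ} (hj : j < I.N) (hF : ¬ F i j)
    (v : ℝ) (x y p : ℕ) : I.Agree T (T.set (i * I.N + j) v x y p) F := by
  intro i' hi' j' hj' hf
  have : i' * I.N + j' ≠ i * I.N + j := by
    intro h
    obtain ⟨rfl, rfl⟩ := code_inj hj' hj h
    exact hF hf
  simp [Tab.set, this]

/-- The cell written was not yet final, so no earlier trace passes through it; the new trace is one
link followed by an old one. -/
lemma AllOK.set {T : Tab} {F F' : ℕ → ℕ → Prop} {i j : ℕ} (h : I.AllOK T F) (hi : i < I.N)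
    (hj : j < I.N) (hF : ¬ F i j) (hF' : ∀ i' j', F' i' j' ↔ F i' j' ∨ (i' = i ∧ j' = j))
    {v : ℝ} {x y p : ℕ} (hc : I.Cand T F i j v x y p) :
    I.AllOK (T.set (i * I.N + j) v x y p) F' := by
  have ha := agree_set (T := T) hj hF v x y p
  have hmono : ∀ i j, F i j → F' i j := fun i j hf => (hF' i j).2 (Or.inl hf)
  intro i' hi' j' hj' hf
  rcases (hF' i' j').1 hf with hf | ⟨rfl, rfl⟩
  · obtain ⟨h1, h2, h3⟩ := h i' hi' j' hj' hf
    have hV := (ha i' hi' j' hj' hf).2.2.2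
    refine ⟨?_, ?_, ?_⟩
    · rwa [hV]
    · rw [hV]
      exact h2.imp_right fun ⟨M, a, b, c⟩ => ⟨M, a, b, ha.tr hmono c⟩
    · rwa [hV]
  · obtain ⟨h1, h2, h3⟩ := hc
    have hV : (T.set (i' * I.N + j') v x y p).V (i' * I.N + j') = v := by simp [Tab.set]
    refine ⟨?_, ?_, ?_⟩
    · rwa [hV]
    · rw [hV]
      refine h2.imp_right fun ⟨M, a, b, c, d⟩ => ⟨_, a, b, ?_⟩
      have := Tr.cons (I := I) (T := T.set (i' * I.N + j') v x y p) (F := F') (M := M) hi' hj' hf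
        (by simpa [Tab.set] using ha.tr hmono c) (by simpa [Tab.set] using d)
      simpa [Tab.set] using this
    · rwa [hV]

/-! ### The correct entry for each kind of state -/

lemma sem_diag {j : ℕ} {M : Finset ℕ} (h : I.Sem j j M) : I.SBase j M := by
  rcases h with ⟨_, h⟩ | ⟨h1, h2, ⟨h | h, _⟩ | ⟨h, _⟩ | ⟨h, _⟩⟩
  · exact h
  · exact (not_lt_self h.2).elim
  · exact (not_lt_self h.2).elim
  · have := h.2.lt; omega
  · exact (not_lt_self h.1).elim

/-- The path, triangle and cycle relations exclude one another and `i = j`, so the relation between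
two items fixes the kind of state. -/
lemma sem_path {i j : ℕ} {M : Finset ℕ} (hij : I.PD i j ∨ I.PU i j) (h : I.Sem i j M) :
    I.SPath i j M := by
  rcases h with ⟨rfl, _⟩ | ⟨h1, h2, ⟨_, h⟩ | ⟨h, _⟩ | ⟨h, _⟩⟩
  · rcases hij with h | h <;> exact (not_lt_self h.2).elim
  · exact h
  · obtain ⟨h1, h2⟩ := h
    have h2 := h2.lt
    rcases hij with h | h
    · have := h.2.1; rw [h1] at this; omega
    · have := h.2.2; omega
  · obtain ⟨h1, h2, -, -⟩ := h
    rcases hij with h | h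
    · rw [h.1] at h2; exact (not_lt_self h2).elim
    · rw [h.1] at h1; exact (not_lt_self h1).elim

lemma sem_tri {i j : ℕ} {M : Finset ℕ} (hij : I.TR i j) (h : I.Sem i j M) : I.STri i j M := by
  have h2 := hij.2.lt
  rcases h with ⟨rfl, _⟩ | ⟨_, _, ⟨h | h, _⟩ | ⟨_, h⟩ | ⟨h, _⟩⟩
  · omega
  · have := h.2.1; rw [hij.1] at this; omega
  · have := h.2.2; omega
  · exact h
  · have := h.1.1; rw [hij.1] at this; omega

lemma sem_cyc {i j : ℕ} {M : Finset ℕ} (hij : I.CC i j) (h : I.Sem i j M) : I.SCyc i j M := by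
  obtain ⟨⟨l1, _⟩, ⟨l2, _⟩, _, _⟩ := hij
  rcases h with ⟨rfl, _⟩ | ⟨_, _, ⟨h | h, _⟩ | ⟨h, _⟩ | ⟨_, h⟩⟩
  · omega
  · rw [h.1] at l2; omega
  · rw [h.1] at l1; omega
  · rw [h.1] at l1; omega
  · exact h

/-- `g` is the largest weight to the left of item `j`, and `p` links to a matching of this weight. -/
def GOK (I : Layered) (T : Tab) (F : ℕ → ℕ → Prop) (j : ℕ) (g : ℝ) (p : ℕ) : Prop :=
  (∀ M, I.Valid M → (∀ f ∈ M, I.Below f j) → I.wt M ≤ g) ∧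
  ∃ M, I.Valid M ∧ (∀ f ∈ M, I.Below f j) ∧ I.wt M = g ∧ I.Tr T F p M

lemma iw_pos {j : ℕ} (hj : j < I.N) : 0 < I.iw j := by
  have h1 := I.w_pos _ (U_lt hj)
  have h2 := I.w_pos _ (D_lt hj)
  unfold iw; split_ifs <;> linarith

lemma cand_base {T : Tab} {F : ℕ → ℕ → Prop} {j : ℕ} {g : ℝ} {p : ℕ} (hj : j < I.N)
    (h : I.GOK T F j g p) : I.Cand T F j j (g + I.iw j) (I.U j) (I.D j) p := by
  obtain ⟨h1, M, hv, hb, hw, ht⟩ := h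
  obtain ⟨k1, k2, k3⟩ := base_compose hv hj hb
  have := wt_nonneg hv
  have := iw_pos hj
  refine ⟨fun M' hM' => ?_, Or.inr ⟨M, Or.inl ⟨rfl, k1⟩, by rw [k3, hw, add_comm], ht, k2⟩,
    fun _ => by linarith⟩
  obtain ⟨M'', a1, a2, a3⟩ := base_decompose hj (sem_diag hM')
  have := h1 M'' a1 a2
  linarith

lemma StOK.sbase {T : Tab} {F : ℕ → ℕ → Prop} {i : ℕ} (h : I.StOK T F i i) :
    ∃ M, I.SBase i M ∧ I.wt M = T.V (i * I.N + i) ∧ I.Tr T F (i * I.N + i + 1) M := by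
  obtain ⟨M, h1, h2, h3⟩ := h.2.1.resolve_left (h.2.2 rfl)
  exact ⟨M, sem_diag h1, h2, h3⟩

/-- The search over the predecessors `l` of `i` that satisfy `Nx` has found `v`, linked by `p`. -/
def Found (I : Layered) (T : Tab) (Nx : ℕ → Prop) (n i : ℕ) (v : ℝ) (p : ℕ) : Prop :=
  (T.V (i * I.N + i) ≤ v ∧ ∀ l, I.m ≤ l → l < n → Nx l → T.V (l * I.N + i) ≤ v) ∧
  ∃ l, (l = i ∨ (I.m ≤ l ∧ l < I.N ∧ Nx l)) ∧ v = T.V (l * I.N + i) ∧ p = l * I.N + i + 1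

/-- The Bellman step for one new edge `x`, with composition and decomposition as hypotheses so that
it serves both directions of the zigzag. -/
lemma cand_path {T : Tab} {F : ℕ → ℕ → Prop} {i j x : ℕ} {Nx : ℕ → Prop} (hne : i ≠ j)
    (hiN : i < I.N) (hall : I.AllOK T F) (hFi : F i i)
    (hF : ∀ l, I.m ≤ l → l < I.N → F l i)
    (hcomp : ∀ M, (I.SBase i M ∨ ∃ l, I.m ≤ l ∧ l < I.N ∧ Nx l ∧ I.Sem l i M) →
      x ∉ M ∧ I.Sem i j (insert x M))
    (hdec : ∀ M, I.Sem i j M → I.wt M = I.w x + I.wt (M.erase x) ∧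
      (I.SBase i (M.erase x) ∨ ∃ l, I.m ≤ l ∧ l < I.N ∧ Nx l ∧ I.Sem l i (M.erase x)))
    {v : ℝ} {p : ℕ} (hfd : I.Found T Nx I.N i v p) : I.Cand T F i j (v + I.w x) x x p := by
  obtain ⟨⟨h1, h2⟩, l, hl, hv, hp⟩ := hfd
  have hii := hall i hiN i hiN hFi
  obtain ⟨Mi, hMi, hwi, hti⟩ := hii.sbase
  have hvpos : T.V (i * I.N + i) ≠ 0 := hii.2.2 rfl
  have hv0 : 0 ≤ T.V (i * I.N + i) := hwi ▸ wt_nonneg hMi.1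
  -- The search starts from the positive value of the base state `(i, i)`, so the winning
  -- predecessor is a realised state.
  have hvne : v ≠ 0 := by
    have : 0 < T.V (i * I.N + i) := lt_of_le_of_ne hv0 hvpos.symm
    linarith
  refine ⟨fun M hM => ?_, Or.inr ?_, fun h => (hne h).elim⟩
  · obtain ⟨d1, d2⟩ := hdec M hM
    rcases d2 with d2 | ⟨l', a1, a2, a3, a4⟩
    · have := hii.1 _ (Or.inl ⟨rfl, d2⟩)
      linarith
    · have := (hall l' a2 i hiN (hF l' a1 a2)).1 _ a4
      have := h2 l' a1 a2 a3
      linarith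
  · have : ∃ M, (I.SBase i M ∨ ∃ l, I.m ≤ l ∧ l < I.N ∧ Nx l ∧ I.Sem l i M) ∧
        I.wt M = v ∧ I.Tr T F p M := by
      rcases hl with rfl | ⟨l1, l2, l3⟩
      · exact ⟨Mi, Or.inl hMi, by rw [hwi, hv], hp ▸ hti⟩
      · obtain ⟨M, a, b, c⟩ := (hall l l2 i hiN (hF l l1 l2)).2.1.resolve_left (hv ▸ hvne)
        exact ⟨M, Or.inr ⟨l, l1, l2, l3, a⟩, by rw [b, hv], hp ▸ c⟩
    obtain ⟨M, hM, hw, ht⟩ := this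
    obtain ⟨c1, c2⟩ := hcomp M hM
    refine ⟨M, by simpa using c2, ?_, ht, by simpa using c1⟩
    rw [show ({x, x} : Finset ℕ) ∪ M = insert x M by simp, wt_insert c1, hw, add_comm]

lemma cand_pathD {T : Tab} {F : ℕ → ℕ → Prop} {i j : ℕ} (hi : I.m ≤ i) (hiN : i < I.N)
    (hj : I.m ≤ j) (hjN : j < I.N) (hij : I.PD i j) (hall : I.AllOK T F) (hFi : F i i)
    (hF : ∀ l, I.m ≤ l → l < I.N → F l i) {v : ℝ} {p : ℕ}
    (hfd : I.Found T (fun l => I.Next l i j) I.N i v p) :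
    I.Cand T F i j (v + I.w (I.U j)) (I.U j) (I.U j) p := by
  refine cand_path (by rintro rfl; exact not_lt_self hij.2) hiN hall hFi hF ?_ ?_ hfd
  · intro M hM
    have hext : I.Ext i j M := by
      rcases hM with hM | ⟨l, l1, l2, l3, hM⟩
      · exact ext_of_base hiN hij hM
      · exact ext_of_path hij l3 (sem_path (Or.inr ⟨l3.1, l3.2.1⟩) hM)
    obtain ⟨h1, h2⟩ := path_compose hj hjN hij hext
    exact ⟨h1, Or.inr ⟨hi, hj, Or.inl ⟨Or.inl hij, h2⟩⟩⟩
  · intro M hM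
    obtain ⟨h1, h2⟩ := path_decompose hi hiN hj hjN hij (sem_path (Or.inl hij) hM)
    refine ⟨h1, h2.imp_right ?_⟩
    rintro ⟨l, l1, l2, l3, l4, l5⟩
    exact ⟨l, l1, l2, l3, Or.inr ⟨l1, hi, Or.inl ⟨Or.inr l4, l5⟩⟩⟩

lemma pD_swap {i j : ℕ} : I.swap.PD i j ↔ I.PU i j := and_congr Iff.rfl lt_swap

lemma pU_swap {i j : ℕ} : I.swap.PU i j ↔ I.PD i j := and_congr Iff.rfl lt_swap

/-- The `PD` lemmas applied to the upside-down drawing; the tables themselves are not reflected. -/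
lemma cand_pathU {T : Tab} {F : ℕ → ℕ → Prop} {i j : ℕ} (hi : I.m ≤ i) (hiN : i < I.N)
    (hj : I.m ≤ j) (hjN : j < I.N) (hij : I.PU i j) (hall : I.AllOK T F) (hFi : F i i)
    (hF : ∀ l, I.m ≤ l → l < I.N → F l i) {v : ℝ} {p : ℕ}
    (hfd : I.Found T (fun l => I.swap.Next l i j) I.N i v p) :
    I.Cand T F i j (v + I.w (I.D j)) (I.D j) (I.D j) p := by
  have hij' := pD_swap.2 hij
  refine cand_path (by rintro rfl; exact not_lt_self hij.2) hiN hall hFi hF ?_ ?_ hfd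
  · intro M hM
    have hext : I.swap.Ext i j M := by
      rcases hM with hM | ⟨l, l1, l2, l3, hM⟩
      · exact ext_of_base hiN hij' (sBase_swap.2 hM)
      · exact ext_of_path hij' l3
          (sPath_swap.2 (sem_path (Or.inl ⟨l3.1, lt_swap.1 l3.2.1⟩) hM))
    obtain ⟨h1, h2⟩ := path_compose (I := I.swap) hj hjN hij' hext
    exact ⟨h1, Or.inr ⟨hi, hj, Or.inl ⟨Or.inr hij, sPath_swap.1 h2⟩⟩⟩
  · intro M hM
    obtain ⟨h1, h2⟩ := path_decompose (I := I.swap) hi hiN hj hjN hij'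
      (sPath_swap.2 (sem_path (Or.inr hij) hM))
    refine ⟨h1, h2.imp sBase_swap.1 ?_⟩
    rintro ⟨l, l1, l2, l3, l4, l5⟩
    exact ⟨l, l1, l2, l3, Or.inr ⟨l1, hi, Or.inl ⟨Or.inl (pU_swap.1 l4), sPath_swap.1 l5⟩⟩⟩

lemma cand_tri {T : Tab} {F : ℕ → ℕ → Prop} {i j : ℕ} (hi : I.m ≤ i) (hiN : i < I.N)
    (hj : I.m ≤ j) (hjN : j < I.N) (hij : I.TR i j) (hst : I.StOK T F j j) :
    I.Cand T F i j (T.V (j * I.N + j) + I.w (I.D i)) (I.D i) (I.D i) (j * I.N + j + 1) := by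
  have hne : i ≠ j := by rintro rfl; have := hij.2.lt; omega
  obtain ⟨M, hM, hw, ht⟩ := hst.sbase
  refine ⟨fun M' hM' => ?_, Or.inr ?_, fun h => (hne h).elim⟩
  · obtain ⟨h1, h2⟩ := tri_decompose hi hiN hij (sem_tri hij hM')
    have := hst.1 _ (Or.inl ⟨rfl, h2⟩)
    linarith
  · obtain ⟨h1, h2⟩ := tri_compose hi hiN hj hjN hij hM
    have hu : ({I.D i, I.D i} : Finset ℕ) ∪ M = insert (I.D i) M := by simp
    refine ⟨M, ?_, ?_, ht, by simpa using h1⟩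
    · rw [hu]
      exact Or.inr ⟨hi, hj, Or.inr (Or.inl ⟨hij, h2⟩)⟩
    · rw [hu, wt_insert h1, hw, add_comm]

lemma cand_cyc {T : Tab} {F : ℕ → ℕ → Prop} {i j : ℕ} (hi : I.m ≤ i) (hiN : i < I.N)
    (hj : I.m ≤ j) (hjN : j < I.N) (hij : I.CC i j) (hst : I.StOK T F i i) :
    I.Cand T F i j (T.V (i * I.N + i) + (I.w (I.U j) + I.w (I.D j))) (I.U j) (I.D j)
      (i * I.N + i + 1) := by
  have hne : i ≠ j := by rintro rfl; exact not_lt_self hij.1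
  obtain ⟨M, hM, hw, ht⟩ := hst.sbase
  refine ⟨fun M' hM' => ?_, Or.inr ?_, fun h => (hne h).elim⟩
  · obtain ⟨M'', h1, h2⟩ := cyc_decompose hj hjN hij (sem_cyc hij hM')
    have := hst.1 _ (Or.inl ⟨rfl, h1⟩)
    linarith
  · obtain ⟨h1, h2, h3⟩ := cyc_compose hi hiN hj hjN hij hM
    exact ⟨M, Or.inr ⟨hi, hj, Or.inr (Or.inr ⟨hij, h2⟩)⟩, by rw [h3, hw, add_comm], ht, h1⟩

/-- No matching realises such a state, so value `0` is a correct entry whatever edges and link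
accompany it. -/
lemma cand_none {T : Tab} {F : ℕ → ℕ → Prop} {i j : ℕ} (hne : i ≠ j) (h1 : ¬ I.PD i j)
    (h2 : ¬ I.PU i j) (h3 : ¬ I.TR i j) (h4 : ¬ I.CC i j) (x y p : ℕ) :
    I.Cand T F i j 0 x y p := by
  refine ⟨fun M hM => ?_, Or.inl rfl, fun h => (hne h).elim⟩
  rcases hM with ⟨h, _⟩ | ⟨_, _, ⟨h | h, _⟩ | ⟨h, _⟩ | ⟨h, _⟩⟩ <;> contradiction

/-- The key strictly increases along every dependency between different items. There is no version
for `TR`, whose state `(i, j)` depends only on `(j, j)`. -/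
lemma key_lt_of_before {i j : ℕ} (hi : i < I.N) (hj : j < I.N) (h : I.a (I.D i) < I.a (I.U j)) :
    I.key i < I.key j := by
  have := (le_item hi).1; have := (le_item hj).1
  unfold key; omega

lemma key_lt_of_PD {i j : ℕ} (h : I.PD i j) : I.key i < I.key j := by
  have := h.2.1; unfold key; rw [h.1]; omega

lemma key_lt_of_PU {i j : ℕ} (h : I.PU i j) : I.key i < I.key j := by
  have := h.2.1; unfold key; rw [h.1]; omega

lemma key_lt_of_CC {i j : ℕ} (h : I.CC i j) : I.key i < I.key j := by
  have := h.1.1; have := h.2.1.1; unfold key; omega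

/-- The entry of item `j` in the table of best states is correct. -/
def BestOK (I : Layered) (T : Tab) (best : ℕ → ℕ) (F : ℕ → ℕ → Prop) (j : ℕ) : Prop :=
  ∃ i < I.N, F i j ∧ best j = i * I.N + j ∧ 0 < T.V (best j) ∧
    ∀ i' < I.N, ∀ M, I.Sem i' j M → I.wt M ≤ T.V (best j)

/-- `v` is the largest value among the first `n` states ending with `j`, attained at `x`. -/
def BestUpTo (I : Layered) (T : Tab) (F : ℕ → ℕ → Prop) (n j : ℕ) (v : ℝ) (x : ℕ) : Prop :=
  (∃ i < I.N, F i j ∧ x = i * I.N + j) ∧ v = T.V x ∧ 0 < v ∧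
    ∀ i < I.N, i = j ∨ i < n → ∀ M, I.Sem i j M → I.wt M ≤ v

end Layered

end CPE

/-! ### The dynamic program -/

namespace CPE

open Layered

/-- The tables of states of a store. -/
def HStore.tab (h : HStore) : Tab := ⟨h.arr 2, h.arr 3, h.arr 4, h.V⟩

@[simp] lemma HStore.tab_V (h : HStore) : h.tab.V = h.V := rfl

/-- The stores differ only in the word registers `L` and the real registers `R`. -/
structure Fr (L R : List ℕ) (h h' : HStore) : Prop where
  arr : h'.arr = h.arr
  V : h'.V = h.V
  reg : ∀ r, r ∉ L → h'.reg r = h.reg r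
  rreg : ∀ r, r ∉ R → h'.rreg r = h.rreg r

namespace Fr

variable {L R L' R' : List ℕ} {h h' h'' : HStore}

lemma refl (h : HStore) : Fr L R h h := ⟨rfl, rfl, fun _ _ => rfl, fun _ _ => rfl⟩

lemma trans (a : Fr L R h h') (b : Fr L R h' h'') : Fr L R h h'' :=
  ⟨b.arr.trans a.arr, b.V.trans a.V, fun r hr => (b.reg r hr).trans (a.reg r hr),
    fun r hr => (b.rreg r hr).trans (a.rreg r hr)⟩

lemma mono (a : Fr L R h h') (hL : L ⊆ L') (hR : R ⊆ R') : Fr L' R' h h' :=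
  ⟨a.arr, a.V, fun r hr => a.reg r fun h => hr (hL h), fun r hr => a.rreg r fun h => hr (hR h)⟩

lemma sr (a : Fr L R h h') {r : ℕ} (hr : r ∈ L) (v : ℕ) : Fr L R h (h'.sr r v) :=
  ⟨a.arr, a.V, fun r' hr' => by
    rw [HStore.sr_reg, if_neg (fun e : r' = r => hr' (e ▸ hr))]; exact a.reg r' hr', a.rreg⟩

lemma srr (a : Fr L R h h') {r : ℕ} (hr : r ∈ R) (v : ℝ) : Fr L R h (h'.srr r v) :=
  ⟨a.arr, a.V, a.reg, fun r' hr' => by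
    rw [HStore.srr_rreg, if_neg (fun e : r' = r => hr' (e ▸ hr))]; exact a.rreg r' hr'⟩

lemma tab (a : Fr L R h h') : h'.tab = h.tab := by
  unfold HStore.tab; rw [a.arr, a.V]

end Fr

/-! ### Selecting an item and searching to its left -/

section

variable {I : Layered} {nA W S : ℕ}

theorem HRun.for0 (R : I.Room nA W S) {r : ℕ} {p : HP} {h : HStore} {Iv : ℕ → HStore → Prop}
    {T : ℕ} (h0 : Iv 0 (h.sr r 0))
    (hstep : ∀ i h', i < I.N → h'.reg r = i → Iv i h' →
      HRun I nA W S p h' T fun h'' => h''.reg r = i ∧ Iv (i + 1) (h''.sr r (i + 1))) :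
    HRun I nA W S (CPE.forUp r (.lit 0) p) h (6 + I.N * (T + 8)) (Iv I.N) :=
  HRun.forUp R (lo := .lit 0) (Nat.zero_le _) (Nat.zero_le _) h0 fun i h' _ => hstep i h'

theorem HRun.forM (R : I.Room nA W S) {r : ℕ} {p : HP} {h : HStore} {Iv : ℕ → HStore → Prop}
    {T : ℕ} (h0 : Iv I.m (h.sr r I.m))
    (hstep : ∀ i h', I.m ≤ i → i < I.N → h'.reg r = i → Iv i h' →
      HRun I nA W S p h' T fun h'' => h''.reg r = i ∧ Iv (i + 1) (h''.sr r (i + 1))) :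
    HRun I nA W S (CPE.forUp r .mm p) h (6 + I.k * (T + 8)) (Iv I.N) := by
  have := HRun.forUp R (lo := .mm) (T := T) (Iv := Iv) (r := r) (p := p) (h := h) trivial
    (Nat.le_add_right _ _) h0 hstep
  rwa [show I.N - (HN.mm).den I nA h = I.k from Nat.add_sub_cancel_left _ _] at this

/-- Register 4 holds the smallest open key so far and register 1 an item attaining it. -/
def selBody : HP :=
  .ite (.and (.eq (.arr 0 (.reg 2)) (.lit 0)) (.lt (.key (.reg 2)) (.reg 4)))
    (.seq (.setReg 1 (.reg 2)) (.setReg 4 (.key (.reg 2)))) .skip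

/-- Select the open item with the smallest key. -/
def selP : HP := .seq (.setReg 4 .top) (forUp 2 (.lit 0) selBody)

/-- Makes `top` a valid sentinel: the first open item always replaces it. -/
lemma key_lt (R : I.Room nA W S) {i : ℕ} (hi : i < I.N) : I.key i < 2 * nA := by
  have := R.a_lt _ (U_lt hi); have := R.a_lt _ (D_lt hi)
  unfold key; omega

lemma selP_run (R : I.Room nA W S) {h : HStore} {X : Finset ℕ} (hX : X ⊆ Finset.range I.N)
    (hne : X.Nonempty) (hd : ∀ i < I.N, h.arr 0 i = 0 ↔ i ∈ X) :
    HRun I nA W S selP h ((HP.setReg 4 .top).cst + (6 + I.N * (selBody.cst + 8)))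
      fun h' => Fr [1, 2, 4] [] h h' ∧ h'.reg 1 ∈ X ∧ ∀ i ∈ X, I.key (h'.reg 1) ≤ I.key i := by
  have hN := I.N_le_sq
  refine HRun.seq (HRun.of_wp (Q := fun h' => h' = h.sr 4 (2 * nA)) R ⟨trivial, rfl⟩) ?_
  rintro _ rfl
  refine (HRun.for0 (Iv := fun i h' => Fr [1, 2, 4] [] h h' ∧
    ((h'.reg 1 ∈ X ∧ h'.reg 4 = I.key (h'.reg 1)) ∨ h'.reg 4 = 2 * nA) ∧
    ∀ x ∈ X, x < i → h'.reg 4 ≤ I.key x) R ?_ ?_).mono le_rfl ?_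
  · exact ⟨((Fr.refl h).sr (by simp) _).sr (by simp) _, Or.inr (by simp), by simp⟩
  · rintro i h' hi hr ⟨hf, h1, h2⟩
    refine HRun.of_wp R ?_
    simp only [selBody, HP.wp, HB.ok, HB.den, HN.ok, HN.den, hr, hf.arr, hd i hi]
    refine ⟨⟨⟨⟨trivial, by omega, by omega⟩, by omega⟩, ⟨trivial, hi⟩, trivial⟩, ?_, ?_⟩
    · rintro ⟨h3, h4⟩
      refine ⟨trivial, ⟨trivial, by simpa [hr] using hi⟩, by simpa using hr,
        ((hf.sr (by simp) _).sr (by simp) _).sr (by simp) _, Or.inl (by simp [hr, h3]), ?_⟩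
      intro x hx hxi
      rcases Nat.lt_succ_iff_lt_or_eq.1 hxi with hxi | rfl
      · have := h2 x hx hxi
        simp [hr]; omega
      · simp [hr]
    · intro h3
      refine ⟨trivial, hf.sr (by simp) _, by simpa using h1, ?_⟩
      intro x hx hxi
      rcases Nat.lt_succ_iff_lt_or_eq.1 hxi with hxi | rfl
      · simpa using h2 x hx hxi
      · simp; by_contra h4; exact h3 ⟨hx, by omega⟩
  · rintro h' ⟨hf, h1, h2⟩
    have h3 : h'.reg 1 ∈ X ∧ h'.reg 4 = I.key (h'.reg 1) := by
      refine h1.resolve_right fun h3 => ?_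
      obtain ⟨x, hx⟩ := hne
      have hxN := Finset.mem_range.1 (hX hx)
      have := h2 x hx hxN
      have := key_lt R hxN
      omega
    exact ⟨hf, h3.1, fun i hi => h3.2 ▸ h2 i hi (Finset.mem_range.1 (hX hi))⟩

/-- `e` is strictly to the left of `f`. -/
def dom (e f : HN) : HB := .and (.lt (.A e) (.A f)) (.lt (.B e) (.B f))

def leftBody : HP :=
  .ite (.and (.lt (.A (.D (.reg 2))) (.A (.U (.reg 1)))) (.lt (.B (.U (.reg 2))) (.B (.D (.reg 1)))))
    (.ite (.rlt (.reg 1) (.V (.arr 1 (.reg 2))))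
      (.seq (.setRReg 1 (.V (.arr 1 (.reg 2)))) (.setReg 5 (.succ (.arr 1 (.reg 2))))) .skip) .skip

/-- Find the best matching to the left of the selected item. -/
def leftP : HP :=
  .seq (.seq (.setRReg 1 .zero) (.setReg 5 (.lit 0))) (forUp 2 (.lit 0) leftBody)

/-- It suffices to test last items `i`. By `Sem.end` the item bounds its whole matching, so the test
puts everything below `j`; conversely a nonempty matching below `j` has by `exists_sem` a last item,
whose edges belong to it and pass the test. -/
lemma leftP_run (R : I.Room nA W S) {h : HStore} {F : ℕ → ℕ → Prop} {j : ℕ} (hj : j < I.N)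
    (hr : h.reg 1 = j) (hall : I.AllOK h.tab F)
    (hb : ∀ i < I.N, I.key i < I.key j → I.BestOK h.tab (h.arr 1) F i) :
    HRun I nA W S leftP h
      (((HP.setRReg 1 .zero).seq (.setReg 5 (.lit 0))).cst + (6 + I.N * (leftBody.cst + 8)))
      fun h' => Fr [2, 5] [1] h h' ∧ I.GOK h.tab F j (h'.rreg 1) (h'.reg 5) := by
  have hN := I.N_le_sq
  have hUj := U_lt hj
  have hDj := D_lt hj
  refine HRun.seq (HRun.of_wp (Q := fun h' => h' = (h.srr 1 0).sr 5 0) R ?_) ?_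
  · simp
  rintro _ rfl
  refine (HRun.for0 (Iv := fun n h' => Fr [2, 5] [1] h h' ∧ 0 ≤ h'.rreg 1 ∧
    (∀ i < I.N, i < n → I.a (I.D i) < I.a (I.U j) → I.b (I.U i) < I.b (I.D j) →
      ∀ i' < I.N, ∀ M, I.Sem i' i M → I.wt M ≤ h'.rreg 1) ∧
    ∃ M, I.Valid M ∧ (∀ f ∈ M, I.Below f j) ∧ I.wt M = h'.rreg 1 ∧ I.Tr h.tab F (h'.reg 5) M)
    R ?_ ?_).mono le_rfl ?_
  · refine ⟨(((Fr.refl h).srr (by simp) _).sr (by simp) _).sr (by simp) _, by simp, by simp, ∅,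
      valid_empty, by simp, by simp [wt], ?_⟩
    simpa using Tr.nil
  · rintro i h' hi hr2 ⟨hf, h0, h1, M, hv, hM, hw, ht⟩
    have hr1 : h'.reg 1 = j := (hf.reg 1 (by simp)).trans hr
    have hU := U_lt hi
    have hD := D_lt hi
    refine HRun.of_wp R ?_
    simp only [leftBody, HP.wp, HB.ok, HB.den, HN.ok, HN.den, HR.ok, HR.den, hr1, hr2, hf.arr, hf.V]
    refine ⟨⟨⟨⟨⟨trivial, hi⟩, hD⟩, ⟨trivial, hj⟩, hUj⟩, ⟨⟨trivial, hi⟩, hU⟩, ⟨trivial, hj⟩, hDj⟩,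
      ?_, ?_⟩
    · rintro ⟨c1, c2⟩
      -- An item entirely to the left has a smaller key, so its best state is already recorded.
      obtain ⟨i', hi', hF', hbe, hb0, hbU⟩ := hb i hi (key_lt_of_before hi hj c1)
      have hcode : h.arr 1 i < I.N * I.N := hbe ▸ code_lt hi' hi
      refine ⟨⟨trivial, ⟨trivial, by omega, by omega⟩, hcode⟩, ?_, ?_⟩
      · intro hlt
        refine ⟨⟨⟨trivial, by omega, by omega⟩, hcode⟩, ⟨⟨trivial, by omega, ?_⟩, ?_⟩, ?_⟩
        · simp [hr2]; omega
        · simpa [hr2, hf.arr] using hcode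
        refine ⟨by simpa using hr2, ((hf.srr (by simp) _).sr (by simp) _).sr (by simp) _, ?_, ?_, ?_⟩
        · simp; linarith
        · intro x hx hxi d1 d2 y hy M' hM'
          rcases Nat.lt_succ_iff_lt_or_eq.1 hxi with hxi | rfl
          · simpa using (h1 x hx hxi d1 d2 y hy M' hM').trans hlt.le
          · simpa using hbU y hy M' hM'
        · obtain ⟨M', e1, e2, e3⟩ := (hall i' hi' i hi hF').2.1.resolve_left (hbe ▸ hb0.ne')
          refine ⟨M', e1.valid.1, ?_, ?_, ?_⟩
          · intro f hf
            have := e1.end hi' hi f hf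
            unfold Below; omega
          · simpa [hbe] using e2
          · simpa [hr2, hf.arr, hbe] using e3
      · intro hlt
        refine ⟨trivial, hf.sr (by simp) _, h0, ?_, M, hv, hM, hw, by simpa using ht⟩
        intro x hx hxi d1 d2 y hy M' hM'
        rcases Nat.lt_succ_iff_lt_or_eq.1 hxi with hxi | rfl
        · exact h1 x hx hxi d1 d2 y hy M' hM'
        · exact (hbU y hy M' hM').trans (not_lt.1 hlt)
    · intro hc
      refine ⟨trivial, hf.sr (by simp) _, h0, ?_, M, hv, hM, hw, by simpa using ht⟩
      intro x hx hxi d1 d2 y hy M' hM'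
      rcases Nat.lt_succ_iff_lt_or_eq.1 hxi with hxi | rfl
      · exact h1 x hx hxi d1 d2 y hy M' hM'
      · exact (hc ⟨d1, d2⟩).elim
  · rintro h' ⟨hf, h0, h1, h2⟩
    refine ⟨hf, ?_, h2⟩
    intro M hv hM
    by_cases hne : M.Nonempty
    · obtain ⟨i', hi', i, hi, hs⟩ := exists_sem hv hne
      exact h1 i hi hi (hM _ hs.valid.2.2).1 (hM _ hs.valid.2.1).2 i' hi' M hs
    · rw [Finset.not_nonempty_iff_eq_empty.1 hne]; simpa [wt] using h0

/-- Store the entry in the registers in the tables, at the state `(reg 2, reg 1)`. -/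
def storeP : HP :=
  .seq (.setV (.code (.reg 2) (.reg 1)) (.reg 2))
    (.seq (.setArr 2 (.code (.reg 2) (.reg 1)) (.reg 6))
      (.seq (.setArr 3 (.code (.reg 2) (.reg 1)) (.reg 7))
        (.setArr 4 (.code (.reg 2) (.reg 1)) (.reg 5))))

/-- The stores differ only in the tables of states. -/
structure SameReg (h h' : HStore) : Prop where
  reg : h'.reg = h.reg
  rreg : h'.rreg = h.rreg
  arr0 : h'.arr 0 = h.arr 0
  arr1 : h'.arr 1 = h.arr 1

lemma storeP_run (R : I.Room nA W S) {h : HStore} {i j : ℕ} (hi : i < I.N) (hj : j < I.N)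
    (h1 : h.reg 1 = j) (h2 : h.reg 2 = i) :
    HRun I nA W S storeP h storeP.cst fun h' => SameReg h h' ∧
      h'.tab = h.tab.set (i * I.N + j) (h.rreg 2) (h.reg 6) (h.reg 7) (h.reg 5) := by
  have hc := code_lt hi hj
  refine HRun.of_wp R ?_
  simp only [storeP, HP.wp, HN.ok, HN.den, HR.ok, HR.den, h1, h2, HStore.sV_reg, HStore.sa_reg]
  refine ⟨⟨trivial, trivial, hi, hj⟩, hc, trivial, by omega, ⟨trivial, trivial, hi, hj⟩, hc, trivial,
    by omega, ⟨trivial, trivial, hi, hj⟩, hc, trivial, by omega, ⟨trivial, trivial, hi, hj⟩, hc,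
    trivial, ⟨rfl, rfl, by simp, by simp⟩, ?_⟩
  simp [HStore.tab, Tab.set]

end

end CPE

/-! ### Computing the entry of one state -/

namespace CPE

open Layered

section

variable {I : Layered} {nA W S : ℕ}

/-- `P` and `Q` stand for the two ends of an item: `U`, `D` for a `PD` step and `D`, `U` for a `PU`
step. The new edge is `P` of item `reg 1`. -/
def pathBody (P Q : HN → HN) : HP :=
  .ite (.and (.and (.eq (P (.reg 3)) (P (.reg 2)))
      (.and (dom (Q (.reg 3)) (Q (.reg 2))) (dom (Q (.reg 3)) (P (.reg 1)))))
      (.rlt (.reg 2) (.V (.code (.reg 3) (.reg 2)))))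
    (.seq (.setRReg 2 (.V (.code (.reg 3) (.reg 2)))) (.setReg 5 (.succ (.code (.reg 3) (.reg 2)))))
    .skip

/-- The base state of item `reg 2` is the first candidate, compatible without any further test. -/
def pathInit : HP :=
  .seq (.setRReg 2 (.V (.code (.reg 2) (.reg 2)))) (.setReg 5 (.succ (.code (.reg 2) (.reg 2))))

def pathEnd (P : HN → HN) : HP :=
  .seq (.setRReg 2 (.add (.reg 2) (.w (P (.reg 1)))))
    (.seq (.setReg 6 (P (.reg 1))) (.setReg 7 (P (.reg 1))))

/-- Find the best continuation of a zigzag ending with item `reg 2` to item `reg 1`. -/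
def pathP (P Q : HN → HN) : HP :=
  .seq pathInit (.seq (forUp 3 .mm (pathBody P Q)) (pathEnd P))

def pathT (P Q : HN → HN) (k : ℕ) : ℕ :=
  pathInit.cst + (6 + k * ((pathBody P Q).cst + 8) + (pathEnd P).cst)

/-- `P` computes the end `p` of an item. -/
def Computes (I : Layered) (nA : ℕ) (P : HN → HN) (p : ℕ → ℕ) : Prop :=
  (∀ e h, (P e).den I nA h = p (e.den I nA h)) ∧
  (∀ e h, (P e).ok I nA h ↔ e.ok I nA h ∧ e.den I nA h < I.N) ∧ ∀ i < I.N, p i < I.m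

lemma pathP_run (R : I.Room nA W S) {P Q : HN → HN} {p q : ℕ → ℕ} (hP : Computes I nA P p)
    (hQ : Computes I nA Q q) {h : HStore} {i j : ℕ} (hi : i < I.N) (hj : j < I.N)
    (h1 : h.reg 1 = j) (h2 : h.reg 2 = i) :
    HRun I nA W S (pathP P Q) h (pathT P Q I.k) fun h' => Fr [3, 5, 6, 7] [2] h h' ∧
      ∃ v, I.Found h.tab (fun l => p l = p i ∧ I.Lt (q l) (q i) ∧ I.Lt (q l) (p j)) I.N i v
          (h'.reg 5) ∧
        h'.rreg 2 = v + I.w (p j) ∧ h'.reg 6 = p j ∧ h'.reg 7 = p j := by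
  obtain ⟨P1, P2, P3⟩ := hP
  obtain ⟨Q1, Q2, Q3⟩ := hQ
  have hcii := code_lt hi hi
  refine HRun.seq (HRun.of_wp (Q := fun h' => h' = (h.srr 2 (h.V (i * I.N + i))).sr 5
    (i * I.N + i + 1)) R ?_) ?_
  · simp [pathInit, h2, hi, hcii]
  rintro _ rfl
  refine HRun.seq (Q' := fun h' => Fr [3, 5] [2] h h' ∧
    I.Found h.tab (fun l => p l = p i ∧ I.Lt (q l) (q i) ∧ I.Lt (q l) (p j)) I.N i (h'.rreg 2)
      (h'.reg 5)) ?_ ?_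
  · refine HRun.forM (Iv := fun n h' => Fr [3, 5] [2] h h' ∧
      I.Found h.tab (fun l => p l = p i ∧ I.Lt (q l) (q i) ∧ I.Lt (q l) (p j)) n i (h'.rreg 2)
        (h'.reg 5)) R ?_ ?_
    · refine ⟨(((Fr.refl h).srr (by simp) _).sr (by simp) _).sr (by simp) _, ⟨?_, ?_⟩, i, Or.inl rfl,
        ?_⟩
      · simp
      · intro l hl hl'; omega
      · simp
    · rintro l h' hlm hl hr3 ⟨hf, ⟨f1, f2⟩, f3⟩
      have hr1 : h'.reg 1 = j := (hf.reg 1 (by simp)).trans h1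
      have hr2 : h'.reg 2 = i := (hf.reg 2 (by simp)).trans h2
      have hcli := code_lt hl hi
      refine HRun.of_wp R ?_
      simp only [pathBody, dom, HP.wp, HB.ok, HB.den, HN.ok, HN.den, HR.ok, HR.den, P1, P2, Q1, Q2,
        hr1, hr2, hr3, hf.V]
      refine ⟨⟨⟨⟨⟨trivial, hl⟩, trivial, hi⟩, ⟨⟨⟨⟨trivial, hl⟩, Q3 l hl⟩, ⟨trivial, hi⟩, Q3 i hi⟩,
        ⟨⟨trivial, hl⟩, Q3 l hl⟩, ⟨trivial, hi⟩, Q3 i hi⟩,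
        ⟨⟨⟨trivial, hl⟩, Q3 l hl⟩, ⟨trivial, hj⟩, P3 j hj⟩,
        ⟨⟨trivial, hl⟩, Q3 l hl⟩, ⟨trivial, hj⟩, P3 j hj⟩, trivial, ⟨trivial, trivial, hl, hi⟩,
        hcli⟩, ?_, ?_⟩
      · rintro ⟨⟨c1, c2, c3⟩, c4⟩
        refine ⟨⟨⟨trivial, trivial, hl, hi⟩, hcli⟩, ⟨⟨trivial, trivial, ?_, ?_⟩, ?_⟩, ?_, ?_, ?_⟩
        · simpa [hr3] using hl
        · simpa [hr2] using hi
        · simpa [hr3, hr2] using hcli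
        · simpa using hr3
        · exact ((hf.srr (by simp) _).sr (by simp) _).sr (by simp) _
        · refine ⟨⟨?_, ?_⟩, l, Or.inr ⟨hlm, hl, c1, c2, c3⟩, ?_⟩
          · simp at f1 ⊢; linarith
          · intro x hx hxl hxn
            rcases Nat.lt_succ_iff_lt_or_eq.1 hxl with hxl | rfl
            · have := f2 x hx hxl hxn
              simp at this ⊢; linarith
            · simp
          · simp [hr3, hr2]
      · intro hc
        refine ⟨trivial, hf.sr (by simp) _, ⟨by simpa using f1, ?_⟩, by simpa using f3⟩
        intro x hx hxl hxn
        rcases Nat.lt_succ_iff_lt_or_eq.1 hxl with hxl | rfl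
        · simpa using f2 x hx hxl hxn
        · simpa using not_lt.1 fun h => hc ⟨hxn, h⟩
  · rintro h' ⟨hf, hfd⟩
    have hr1 : h'.reg 1 = j := (hf.reg 1 (by simp)).trans h1
    refine HRun.of_wp R ?_
    simp only [pathEnd, HP.wp, HN.ok, HN.den, HR.ok, HR.den, P1, P2, HStore.srr_reg, HStore.sr_reg,
      hr1, hj, P3 j hj, true_and]
    simp only [show (1 : ℕ) ≠ 6 by decide, if_false, hj, true_and]
    refine ⟨(((hf.mono (by simp) (by simp)).srr (by simp) _).sr (by simp) _).sr (by simp) _,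
      h'.rreg 2, by simpa using hfd, by simp, by simp, by simp⟩

lemma computes_U : Computes I nA .U I.U := ⟨fun _ _ => rfl, fun _ _ => Iff.rfl, fun _ => U_lt⟩

lemma computes_D : Computes I nA .D I.D := ⟨fun _ _ => rfl, fun _ _ => Iff.rfl, fun _ => D_lt⟩

def triP : HP :=
  .seq (.setRReg 2 (.add (.V (.code (.reg 1) (.reg 1))) (.w (.D (.reg 2)))))
    (.seq (.setReg 6 (.D (.reg 2))) (.seq (.setReg 7 (.D (.reg 2)))
      (.setReg 5 (.succ (.code (.reg 1) (.reg 1))))))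

def cycP : HP :=
  .seq (.setRReg 2 (.add (.V (.code (.reg 2) (.reg 2))) (.add (.w (.U (.reg 1))) (.w (.D (.reg 1))))))
    (.seq (.setReg 6 (.U (.reg 1))) (.seq (.setReg 7 (.D (.reg 1)))
      (.setReg 5 (.succ (.code (.reg 2) (.reg 2))))))

def testPD : HB := .and (.eq (.D (.reg 2)) (.D (.reg 1))) (dom (.U (.reg 2)) (.U (.reg 1)))
def testPU : HB := .and (.eq (.U (.reg 2)) (.U (.reg 1))) (dom (.D (.reg 2)) (.D (.reg 1)))
def testTR : HB := .and (.eq (.U (.reg 2)) (.U (.reg 1))) (.adj (.D (.reg 2)) (.D (.reg 1)))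
def testCC : HB :=
  .and (dom (.U (.reg 2)) (.U (.reg 1))) (.and (dom (.D (.reg 2)) (.D (.reg 1)))
    (.and (.adj (.U (.reg 2)) (.D (.reg 1))) (.adj (.U (.reg 1)) (.D (.reg 2)))))

/-- Compute the entry of the state `(reg 2, reg 1)`. -/
def candP : HP :=
  .seq (.setRReg 2 .zero) (.ite testPD (pathP .U .D) (.ite testPU (pathP .D .U)
    (.ite testTR triP (.ite testCC cycP .skip))))

def candB (k : ℕ) : ℕ := pathT .U .D k + pathT .D .U k + triP.cst + cycP.cst + 1

def candT (k : ℕ) : ℕ :=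
  (HP.setRReg 2 .zero).cst + (testPD.c.cost + 1 + (testPU.c.cost + 1 + (testTR.c.cost + 1 +
    (testCC.c.cost + 1 + candB k))))

/-- `hF` is asked for only when `i` has a smaller key. In the `PD`, `PU` and `CC` branches the
relation itself supplies that inequality; the `TR` branch needs `hFj` alone. -/
lemma candP_run (R : I.Room nA W S) {h : HStore} {F : ℕ → ℕ → Prop} {i j : ℕ} (hi : i < I.N)
    (hj : j < I.N) (him : I.m ≤ i) (hjm : I.m ≤ j) (hne : i ≠ j)
    (h1 : h.reg 1 = j) (h2 : h.reg 2 = i) (hall : I.AllOK h.tab F) (hFj : F j j)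
    (hF : I.key i < I.key j → F i i ∧ ∀ l, I.m ≤ l → l < I.N → F l i) :
    HRun I nA W S candP h (candT I.k) fun h' => Fr [3, 5, 6, 7] [2] h h' ∧
      I.Cand h.tab F i j (h'.rreg 2) (h'.reg 6) (h'.reg 7) (h'.reg 5) := by
  have hUi := U_lt hi
  have hUj := U_lt hj
  have hDi := D_lt hi
  have hDj := D_lt hj
  have hN := I.N_le_sq
  have hcii := code_lt hi hi
  have hcjj := code_lt hj hj
  refine HRun.seq (HRun.of_wp (Q := fun h' => h' = h.srr 2 0) R ⟨trivial, rfl⟩) ?_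
  rintro _ rfl
  have hfr : Fr [3, 5, 6, 7] [2] h (h.srr 2 0) := (Fr.refl h).srr (by simp) _
  have dPD : testPD.den I nA (h.srr 2 0) ↔ I.PD i j := by
    simp [testPD, dom, PD, Lt, h1, h2]
  have dPU : testPU.den I nA (h.srr 2 0) ↔ I.PU i j := by
    simp [testPU, dom, PU, Lt, h1, h2]
  have dTR : testTR.den I nA (h.srr 2 0) ↔ I.TR i j := by
    simp [testTR, TR, h1, h2]
  have dCC : testCC.den I nA (h.srr 2 0) ↔ I.CC i j := by
    simp [testCC, dom, CC, Lt, h1, h2]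
  have hr1 : (h.srr 2 0).reg 1 = j := h1
  have hr2 : (h.srr 2 0).reg 2 = i := h2
  refine HRun.ite R (by simp [testPD, dom, h1, h2, hi, hj, hUi, hUj]) ?_ ?_
  · rw [dPD]
    intro hij
    obtain ⟨F1, F2⟩ := hF (key_lt_of_PD hij)
    refine (pathP_run R computes_U computes_D hi hj hr1 hr2).mono (by simp only [candB]; omega) ?_
    rintro h' ⟨hf, v, hfd, e1, e2, e3⟩
    refine ⟨hfr.trans hf, ?_⟩
    rw [e1, e2, e3]
    exact cand_pathD him hi hjm hj hij hall F1 F2 hfd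
  rw [dPD]
  intro nPD
  refine HRun.ite R (by simp [testPU, dom, h1, h2, hi, hj, hDi, hDj]) ?_ ?_
  · rw [dPU]
    intro hij
    obtain ⟨F1, F2⟩ := hF (key_lt_of_PU hij)
    refine (pathP_run R computes_D computes_U hi hj hr1 hr2).mono (by simp only [candB]; omega) ?_
    rintro h' ⟨hf, v, hfd, e1, e2, e3⟩
    refine ⟨hfr.trans hf, ?_⟩
    rw [e1, e2, e3]
    refine cand_pathU him hi hjm hj hij hall F1 F2 ?_
    have : (fun l => I.swap.Next l i j) =
        fun l => I.D l = I.D i ∧ I.Lt (I.U l) (I.U i) ∧ I.Lt (I.U l) (I.D j) := by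
      funext l; simp only [Next, lt_swap]; rfl
    rw [this]; exact hfd
  rw [dPU]
  intro nPU
  refine HRun.ite R (by simp [testTR, h1, h2, hi, hj, hDi, hDj]) ?_ ?_
  · rw [dTR]
    intro hij
    refine (HRun.of_wp (Q := fun h' => h' = ((((h.srr 2 0).srr 2
      (h.V (j * I.N + j) + I.w (I.D i))).sr 6 (I.D i)).sr 7 (I.D i)).sr 5 (j * I.N + j + 1))
      R ?_).mono (by simp only [candB]; omega) ?_
    · simp [triP, h1, h2, hi, hj, hDi, hcjj]
    rintro _ rfl
    refine ⟨((((hfr.srr (by simp) _).sr (by simp) _).sr (by simp) _).sr (by simp) _), ?_⟩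
    simpa using cand_tri him hi hjm hj hij (hall j hj j hj hFj)
  rw [dTR]
  intro nTR
  refine HRun.ite R (by simp [testCC, dom, h1, h2, hi, hj, hUi, hUj, hDi, hDj]) ?_ ?_
  · rw [dCC]
    intro hij
    refine (HRun.of_wp (Q := fun h' => h' = ((((h.srr 2 0).srr 2
      (h.V (i * I.N + i) + (I.w (I.U j) + I.w (I.D j)))).sr 6 (I.U j)).sr 7 (I.D j)).sr 5
      (i * I.N + i + 1)) R ?_).mono (by simp only [candB]; omega) ?_
    · simp [cycP, h1, h2, hi, hj, hUj, hDj, hcii]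
    rintro _ rfl
    refine ⟨((((hfr.srr (by simp) _).sr (by simp) _).sr (by simp) _).sr (by simp) _), ?_⟩
    simpa using cand_cyc him hi hjm hj hij (hall i hi i hi (hF (key_lt_of_CC hij)).1)
  rw [dCC]
  intro nCC
  refine (HRun.of_wp (p := .skip) (Q := fun h' => h' = h.srr 2 0) R rfl).mono
    (by simp only [candB, HP.cst]; omega) ?_
  rintro _ rfl
  -- The edge and link registers hold leftovers here, harmless in an entry of value `0`.
  exact ⟨hfr, by simpa using cand_none hne nPD nPU nTR nCC _ _ _⟩

end

end CPE

/-! ### The main loop and its invariant -/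

namespace CPE

open Layered

section

variable {I : Layered} {nA W S : ℕ}

/-- The states that are final when the items in `X` are open. -/
def Final (I : Layered) (X : Finset ℕ) (i j : ℕ) : Prop := j ∉ X ∧ (i = j ∨ (I.m ≤ i ∧ I.m ≤ j))

/-- The states that are final while the states of item `j` are computed. -/
def FinUp (I : Layered) (X : Finset ℕ) (j n i' j' : ℕ) : Prop :=
  Final I X i' j' ∨ (j' = j ∧ (i' = j ∨ (I.m ≤ i' ∧ i' < n ∧ I.m ≤ j)))

/-- The loop invariant while the states of item `j` are computed. -/
structure PairInv (I : Layered) (X : Finset ℕ) (j : ℕ) (h0 : HStore) (n : ℕ) (h : HStore) :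
    Prop where
  r0 : h.reg 0 = h0.reg 0
  r1 : h.reg 1 = j
  r9 : h.reg 9 = h0.reg 9
  rr0 : h.rreg 0 = h0.rreg 0
  arr0 : h.arr 0 = h0.arr 0
  arr1 : h.arr 1 = h0.arr 1
  all : I.AllOK h.tab (FinUp I X j n)
  agree : I.Agree h0.tab h.tab (Final I X)
  best : I.BestUpTo h.tab (FinUp I X j n) n j (h.rreg 3) (h.reg 8)

lemma Layered.Agree.trans {T T' T'' : Tab} {F F' : ℕ → ℕ → Prop} (a : I.Agree T T' F)
    (b : I.Agree T' T'' F') (hF : ∀ i j, F i j → F' i j) : I.Agree T T'' F := by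
  intro i hi j hj hf
  obtain ⟨a1, a2, a3, a4⟩ := a i hi j hj hf
  obtain ⟨b1, b2, b3, b4⟩ := b i hi j hj (hF i j hf)
  exact ⟨b1.trans a1, b2.trans a2, b3.trans a3, b4.trans a4⟩

/-- Register 2 is set to `j` because the entry is stored at the state `(reg 2, reg 1)`. The base
state also opens the competition for the best state of `j`, in word register 8 and real register 3.
-/
def baseRegP : HP :=
  .seq (.setReg 2 (.reg 1)) (.seq (.setRReg 2 (.add (.reg 1) (.w (.U (.reg 1)))))
    (.seq (.ite (.lt (.reg 1) .mm) .skip (.setRReg 2 (.add (.reg 2) (.w (.D (.reg 1))))))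
      (.seq (.setReg 6 (.U (.reg 1))) (.seq (.setReg 7 (.D (.reg 1)))
        (.seq (.setReg 8 (.code (.reg 1) (.reg 1))) (.setRReg 3 (.reg 2)))))))

/-- Compute the state in which the selected item `reg 1` starts a component. -/
def baseP : HP := .seq baseRegP storeP

lemma baseP_run (R : I.Room nA W S) {h0 h : HStore} {X : Finset ℕ} {j : ℕ} (hjX : j ∈ X)
    (hj : j < I.N) (hfr : Fr [1, 2, 4, 5] [1] h0 h) (h1 : h.reg 1 = j)
    (hall : I.AllOK h0.tab (Final I X)) (hG : I.GOK h0.tab (Final I X) j (h.rreg 1) (h.reg 5)) :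
    HRun I nA W S baseP h (baseRegP.cst + storeP.cst) fun h' => PairInv I X j h0 I.m h' := by
  have hN := I.N_le_sq
  have hUj := U_lt hj
  have hDj := D_lt hj
  refine HRun.seq (Q' := fun h' => Fr [1, 2, 4, 5, 6, 7, 8] [1, 2, 3] h0 h' ∧ h'.reg 1 = j ∧
    h'.reg 2 = j ∧ h'.rreg 2 = h.rreg 1 + I.iw j ∧ h'.rreg 3 = h.rreg 1 + I.iw j ∧
    h'.reg 6 = I.U j ∧ h'.reg 7 = I.D j ∧ h'.reg 5 = h.reg 5 ∧ h'.reg 8 = j * I.N + j)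
    (HRun.of_wp R ?_) ?_
  · have hfr' : Fr [1, 2, 4, 5, 6, 7, 8] [1, 2, 3] h0 h := hfr.mono (by simp) (by simp)
    simp only [baseRegP, HP.wp, HB.ok, HB.den, HN.ok, HN.den, HR.ok, HR.den]
    refine ⟨trivial, by simp [h1, hj, hUj], by simp, fun hlt => ?_, fun hlt => ?_⟩
    · have hlt : j < I.m := by simpa [h1] using hlt
      refine ⟨by simp [h1, hj], by simp [h1, hj], by simp [h1, hj], trivial, ?_, ?_⟩
      · exact ((((((hfr'.sr (by simp) _).srr (by simp) _).sr (by simp) _).sr (by simp) _).sr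
          (by simp) _).srr (by simp) _)
      · simp [h1, iw, hlt]
    · have hlt : ¬ j < I.m := by simpa [h1] using hlt
      refine ⟨by simp [h1, hj, hDj], by simp [h1, hj], by simp [h1, hj], by simp [h1, hj], trivial,
        ?_, ?_⟩
      · exact (((((((hfr'.sr (by simp) _).srr (by simp) _).srr (by simp) _).sr (by simp) _).sr
          (by simp) _).sr (by simp) _).srr (by simp) _)
      · simp [h1, iw, hlt, add_assoc]
  · rintro h' ⟨hf, e1, e2, e3, e4, e5, e6, e7, e8⟩
    refine (storeP_run R hj hj e1 e2).mono le_rfl ?_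
    rintro h'' ⟨hs, ht⟩
    rw [e3, e5, e6, e7, hf.tab] at ht
    have hc := cand_base hj hG
    have hnF : ¬ Final I X j j := fun h => h.1 hjX
    have hF : ∀ i' j', FinUp I X j I.m i' j' ↔ Final I X i' j' ∨ (i' = j ∧ j' = j) := by
      intro i' j'
      unfold FinUp
      constructor
      · rintro (h | ⟨h, h' | h'⟩)
        · exact Or.inl h
        · exact Or.inr ⟨h', h⟩
        · omega
      · rintro (h | ⟨h, h'⟩)
        · exact Or.inl h
        · exact Or.inr ⟨h', Or.inl h⟩
    refine ⟨?_, ?_, ?_, ?_, ?_, ?_, ?_, ?_, ?_⟩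
    · rw [hs.reg]; exact hf.reg 0 (by simp)
    · rw [hs.reg, e1]
    · rw [hs.reg]; exact hf.reg 9 (by simp)
    · rw [hs.rreg]; exact hf.rreg 0 (by simp)
    · rw [hs.arr0, hf.arr]
    · rw [hs.arr1, hf.arr]
    · rw [ht]; exact hall.set hj hj hnF hF hc
    · rw [ht]; exact agree_set hj hnF _ _ _ _
    · rw [ht, hs.reg, hs.rreg, e4, e8]
      have hpos : 0 < h.rreg 1 + I.iw j := by
        obtain ⟨-, M, hv, -, hw, -⟩ := hG
        have := wt_nonneg hv
        have := iw_pos hj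
        linarith
      refine ⟨⟨j, hj, (hF j j).2 (Or.inr ⟨rfl, rfl⟩), rfl⟩, by simp [Tab.set], hpos, ?_⟩
      intro i hi hij M hM
      by_cases hij' : i = j
      · subst hij'; exact hc.1 M hM
      · rcases hM with ⟨h, -⟩ | ⟨h, -⟩
        · exact (hij' h).elim
        · omega

def updP : HP :=
  .ite (.rlt (.reg 3) (.reg 2)) (.seq (.setRReg 3 (.reg 2)) (.setReg 8 (.code (.reg 2) (.reg 1))))
    .skip

def pairBody : HP := .ite (.eq (.reg 2) (.reg 1)) .skip (.seq candP (.seq storeP updP))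

def pairT (k : ℕ) : ℕ :=
  (HB.eq (.reg 2) (.reg 1)).c.cost + 1 + (candT k + (storeP.cst + updP.cst) + 1)

lemma finUp_succ {X : Finset ℕ} {i j : ℕ} (him : I.m ≤ i) (hjm : I.m ≤ j) (i' j' : ℕ) :
    FinUp I X j (i + 1) i' j' ↔ FinUp I X j i i' j' ∨ (i' = i ∧ j' = j) := by
  unfold FinUp
  by_cases h : j' = j
  · by_cases h2 : Final I X i' j' <;> simp only [h2, true_or, false_or]; omega
  · simp [h]

/-- `j` has the smallest open key, so any item on which the new entry may depend through a smaller
key is closed. The round `i = j` is skipped since the base state is already stored. -/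
lemma pairBody_run (R : I.Room nA W S) {h0 h : HStore} {X : Finset ℕ} {i j : ℕ} (hjX : j ∈ X)
    (hj : j < I.N) (hjm : I.m ≤ j) (hi : i < I.N) (him : I.m ≤ i)
    (hmin : ∀ x < I.N, I.key x < I.key j → x ∉ X)
    (hinv : PairInv I X j h0 i h) (h2 : h.reg 2 = i) :
    HRun I nA W S pairBody h (pairT I.k) fun h' => h'.reg 2 = i ∧
      PairInv I X j h0 (i + 1) (h'.sr 2 (i + 1)) := by
  have h1 := hinv.r1
  have hs := finUp_succ (X := X) him hjm
  refine HRun.ite R (by simp) ?_ ?_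
  · intro hd
    have hij : i = j := by simpa [h1, h2] using hd
    refine (HRun.of_wp (p := .skip) (Q := fun h' => h' = h) R rfl).mono
      (by simp only [HP.cst]; omega) ?_
    rintro _ rfl
    have hiff : ∀ i' < I.N, ∀ j' < I.N, FinUp I X j i i' j' ↔ FinUp I X j (i + 1) i' j' := by
      intro i' _ j' _
      rw [hs]
      refine ⟨Or.inl, ?_⟩
      rintro (h | ⟨rfl, rfl⟩)
      · exact h
      · exact Or.inr ⟨rfl, Or.inl hij⟩
    refine ⟨h2, hinv.r0, hinv.r1, hinv.r9, hinv.rr0, hinv.arr0, hinv.arr1, hinv.all.congr hiff,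
      hinv.agree, ?_⟩
    obtain ⟨⟨x, b1, b2, b3⟩, b4, b5, b6⟩ := hinv.best
    refine ⟨⟨x, b1, (hiff x b1 j hj).1 b2, b3⟩, b4, b5, ?_⟩
    intro y hy hyi M hM
    exact b6 y hy (by omega) M hM
  · intro hd
    have hij : i ≠ j := by simpa [h1, h2] using hd
    have hnF : ¬ FinUp I X j i i j := by
      rintro (h | ⟨_, h | h⟩)
      · exact h.1 hjX
      · exact hij h
      · omega
    refine (HRun.seq (candP_run (F := FinUp I X j i) R hi hj him hjm hij h1 h2 hinv.all
      (Or.inr ⟨rfl, Or.inl rfl⟩) ?_) (T' := storeP.cst + updP.cst)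
      (Q := fun h' => h'.reg 2 = i ∧ PairInv I X j h0 (i + 1) (h'.sr 2 (i + 1))) ?_).mono
      (by omega) fun _ => id
    · intro hk
      have hnX := hmin i hi hk
      exact ⟨Or.inl ⟨hnX, Or.inl rfl⟩, fun l hl _ => Or.inl ⟨hnX, Or.inr ⟨hl, him⟩⟩⟩
    rintro h3 ⟨hf, hc⟩
    have e1 : h3.reg 1 = j := (hf.reg 1 (by simp)).trans h1
    have e2 : h3.reg 2 = i := (hf.reg 2 (by simp)).trans h2
    refine HRun.seq (storeP_run R hi hj e1 e2) ?_
    rintro h4 ⟨hsr, ht⟩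
    rw [hf.tab] at ht
    have hall := hinv.all.set hi hj hnF hs hc
    rw [← ht] at hall
    have hag := agree_set (I := I) (T := h.tab) hj hnF (h3.rreg 2) (h3.reg 6) (h3.reg 7) (h3.reg 5)
    rw [← ht] at hag
    have k1 : h4.reg 1 = j := by rw [hsr.reg, e1]
    have k2 : h4.reg 2 = i := by rw [hsr.reg, e2]
    have kV : h4.V (i * I.N + j) = h4.rreg 2 := by
      rw [hsr.rreg, ← HStore.tab_V, ht]; simp [Tab.set]
    have hcode := code_lt hi hj
    obtain ⟨⟨x, b1, b2, b3⟩, b4, b5, b6⟩ := hinv.best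
    have r8 : h4.reg 8 = h.reg 8 := by rw [hsr.reg]; exact hf.reg 8 (by simp)
    have rr3 : h4.rreg 3 = h.rreg 3 := by rw [hsr.rreg]; exact hf.rreg 3 (by simp)
    -- Both outcomes of the comparison change only the record of the best state and the counter; the
    -- rest of the invariant is shared.
    have base : ∀ h5 : HStore, Fr [8, 2] [3] h4 h5 →
        I.BestUpTo h5.tab (FinUp I X j (i + 1)) (i + 1) j (h5.rreg 3) (h5.reg 8) →
        PairInv I X j h0 (i + 1) h5 := by
      intro h5 hf5 hb
      refine ⟨?_, ?_, ?_, ?_, ?_, ?_, ?_, ?_, hb⟩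
      · rw [hf5.reg 0 (by simp), hsr.reg, hf.reg 0 (by simp), hinv.r0]
      · rw [hf5.reg 1 (by simp), k1]
      · rw [hf5.reg 9 (by simp), hsr.reg, hf.reg 9 (by simp), hinv.r9]
      · rw [hf5.rreg 0 (by simp), hsr.rreg, hf.rreg 0 (by simp), hinv.rr0]
      · rw [hf5.arr, hsr.arr0, hf.arr, hinv.arr0]
      · rw [hf5.arr, hsr.arr1, hf.arr, hinv.arr1]
      · rw [hf5.tab]; exact hall
      · rw [hf5.tab]; exact hinv.agree.trans hag fun _ _ h => Or.inl h
    refine HRun.of_wp R ?_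
    simp only [updP, HP.wp, HB.ok, HB.den, HR.ok, HR.den, HN.ok, HN.den]
    refine ⟨⟨trivial, trivial⟩, fun hlt => ⟨trivial, ⟨trivial, trivial, ?_, ?_⟩, ?_, ?_⟩,
      fun hlt => ⟨k2, ?_⟩⟩
    · simpa [k2] using hi
    · simpa [k1] using hj
    · simpa using k2
    · refine base _ ((((Fr.refl h4).srr (by simp) _).sr (by simp) _).sr (by simp) _) ?_
      rw [rr3] at hlt
      refine ⟨⟨i, hi, (hs i j).2 (Or.inr ⟨rfl, rfl⟩), by simp [k1, k2]⟩, by simp [k1, k2, kV],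
        by simpa using b5.trans hlt, ?_⟩
      intro y hy hyi M hM
      by_cases hyi' : y = i
      · subst hyi'
        simpa [hsr.rreg] using hc.1 M hM
      · have := b6 y hy (by omega) M hM
        simpa using this.trans hlt.le
    · refine base _ ((Fr.refl h4).sr (by simp) _) ?_
      refine ⟨⟨x, b1, (hs x j).2 (Or.inl b2), by simpa [r8] using b3⟩, ?_, by simpa [rr3] using b5,
        ?_⟩
      · have := (hag x b1 j hj b2).2.2.2
        rw [HStore.tab_V, HStore.tab_V] at this
        simp [rr3, r8]
        rw [b3, this, b4, b3]; rfl
      · intro y hy hyi M hM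
        by_cases hyi' : y = i
        · subst hyi'
          have := hc.1 M hM
          rw [hsr.rreg] at hlt
          simpa [hsr.rreg] using this.trans (not_lt.1 hlt)
        · have := b6 y hy (by omega) M hM
          simpa [rr3] using this

def pairsP : HP := .ite (.lt (.reg 1) .mm) .skip (forUp 2 .mm pairBody)

def pairsT (I : Layered) (j : ℕ) : ℕ :=
  (HB.lt (.reg 1) .mm).c.cost + 1 + (1 + if j < I.m then 0 else 6 + I.k * (pairT I.k + 8))

lemma pairsP_run (R : I.Room nA W S) {h0 h : HStore} {X : Finset ℕ} {j : ℕ} (hjX : j ∈ X)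
    (hj : j < I.N) (hmin : ∀ x < I.N, I.key x < I.key j → x ∉ X)
    (hinv : PairInv I X j h0 I.m h) :
    HRun I nA W S pairsP h (pairsT I j) fun h' => PairInv I X j h0 I.N h' := by
  refine HRun.ite R (by simp) ?_ ?_
  · intro hd
    have hjm : j < I.m := by simpa [hinv.r1] using hd
    refine (HRun.of_wp (p := .skip) (Q := fun h' => h' = h) R rfl).mono
      (by simp only [HP.cst]; omega) ?_
    rintro _ rfl
    -- A single edge as last item has only its base state, so nothing remains to be computed.
    have hiff : ∀ i' < I.N, ∀ j' < I.N, FinUp I X j I.m i' j' ↔ FinUp I X j I.N i' j' := by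
      intro i' _ j' _
      unfold FinUp
      by_cases h2 : Final I X i' j' <;> simp only [h2, true_or, false_or]; omega
    refine ⟨hinv.r0, hinv.r1, hinv.r9, hinv.rr0, hinv.arr0, hinv.arr1, hinv.all.congr hiff,
      hinv.agree, ?_⟩
    obtain ⟨⟨x, b1, b2, b3⟩, b4, b5, b6⟩ := hinv.best
    refine ⟨⟨x, b1, (hiff x b1 j hj).1 b2, b3⟩, b4, b5, ?_⟩
    intro y hy _ M hM
    have hyj : y = j := by
      rcases hM with ⟨h, -⟩ | ⟨-, h, -⟩
      · exact h
      · omega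
    exact b6 y hy (Or.inl hyj) M hM
  · intro hd
    have hjm : ¬ j < I.m := by simpa [hinv.r1] using hd
    refine (HRun.forM R (Iv := fun n h' => PairInv I X j h0 n h') (T := pairT I.k) ?_ ?_).mono
      (by rw [if_neg hjm]; omega) fun _ => id
    · exact ⟨hinv.r0, hinv.r1, hinv.r9, hinv.rr0, hinv.arr0, hinv.arr1, hinv.all, hinv.agree,
        hinv.best⟩
    · intro i h' him hi hr hinv'
      exact pairBody_run R hjX hj (not_lt.1 hjm) hi him hmin hinv' hr

/-- Records the best state of the item, closes the item, and updates the overall optimum. Register 9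
receives the code plus one, since link `0` is the end of a list. -/
def endP : HP :=
  .seq (.setArr 1 (.reg 1) (.reg 8)) (.seq (.setArr 0 (.reg 1) (.lit 1))
    (.seq (.ite (.rlt (.reg 0) (.reg 3)) (.seq (.setRReg 0 (.reg 3)) (.setReg 9 (.succ (.reg 8)))) .skip)
      (.setReg 0 (.succ (.reg 0)))))

/-- One round of the main loop. -/
def bodyP : HP := .seq selP (.seq leftP (.seq baseP (.seq pairsP endP)))

/-- The invariant of the main loop, the items in `X` being open. -/
structure MainInv (I : Layered) (X : Finset ℕ) (h : HStore) : Prop where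
  sub : X ⊆ Finset.range I.N
  cnt : h.reg 0 + X.card = I.N
  opened : ∀ i < I.N, h.arr 0 i = 0 ↔ i ∈ X
  all : I.AllOK h.tab (Final I X)
  best : ∀ j < I.N, j ∉ X → I.BestOK h.tab (h.arr 1) (Final I X) j
  pos : 0 ≤ h.rreg 0
  ub : ∀ i < I.N, ∀ j < I.N, j ∉ X → ∀ M, I.Sem i j M → I.wt M ≤ h.rreg 0
  ex : ∃ M, I.Valid M ∧ I.wt M = h.rreg 0 ∧ I.Tr h.tab (Final I X) (h.reg 9) M

lemma endP_run (R : I.Room nA W S) {h0 h : HStore} {X : Finset ℕ} {j : ℕ} (hjX : j ∈ X)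
    (hm : MainInv I X h0) (hinv : PairInv I X j h0 I.N h) :
    HRun I nA W S endP h endP.cst fun h' => MainInv I (X.erase j) h' := by
  have hN := I.N_le_sq
  have hj : j < I.N := Finset.mem_range.1 (hm.sub hjX)
  have h1 := hinv.r1
  obtain ⟨⟨x, b1, b2, b3⟩, b4, b5, b6⟩ := hinv.best
  have hcode : h.reg 8 < I.N * I.N := b3 ▸ code_lt b1 hj
  have hcard : (X.erase j).card + 1 = X.card := Finset.card_erase_add_one hjX
  have hcnt := hm.cnt
  have hr0 := hinv.r0
  have hiff : ∀ i' < I.N, ∀ j' < I.N, FinUp I X j I.N i' j' ↔ Final I (X.erase j) i' j' := by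
    intro i' hi' j' _
    unfold FinUp Final
    rw [Finset.mem_erase]
    by_cases hjj : j' = j
    · subst hjj; simp [hjX]; omega
    · simp [hjj]
  have hsub : ∀ i' j', Final I X i' j' → Final I (X.erase j) i' j' := fun i' j' h =>
    ⟨fun h' => h.1 (Finset.mem_of_mem_erase h'), h.2⟩
  have hall := hinv.all.congr hiff
  have fin : ∀ h' : HStore, h'.arr 0 = Function.update (h.arr 0) j 1 →
      h'.arr 1 = Function.update (h.arr 1) j (h.reg 8) → h'.tab = h.tab →
      h'.reg 0 = h.reg 0 + 1 → h.rreg 0 ≤ h'.rreg 0 → h.rreg 3 ≤ h'.rreg 0 →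
      (∃ M, I.Valid M ∧ I.wt M = h'.rreg 0 ∧ I.Tr h.tab (Final I (X.erase j)) (h'.reg 9) M) →
      MainInv I (X.erase j) h' := by
    intro h' a0 a1 at' r0 q0 q3 hex
    rw [hinv.rr0] at q0
    have hV : ∀ y, h'.tab.V y = h.V y := fun y => by rw [at', HStore.tab_V]
    refine ⟨(Finset.erase_subset _ _).trans hm.sub, by omega, ?_, by rw [at']; exact hall, ?_,
      hm.pos.trans q0, ?_, by rwa [at']⟩
    · intro i hi
      rw [a0, hinv.arr0, Function.update_apply, Finset.mem_erase]
      split_ifs with hij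
      · simp [hij]
      · simp [hij, hm.opened i hi]
    · intro y hy hyX
      by_cases hyj : y = j
      · subst hyj
        have e : h'.arr 1 y = x * I.N + y := by rw [a1]; simp [b3]
        refine ⟨x, b1, (hiff x b1 y hj).1 b2, e, ?_, ?_⟩
        · rw [e, hV, ← b3, ← HStore.tab_V, ← b4]; exact b5
        · intro i' hi' M hM
          rw [e, hV, ← b3, ← HStore.tab_V, ← b4]
          exact b6 i' hi' (Or.inr hi') M hM
      · have hyX' : y ∉ X := fun h => hyX (Finset.mem_erase.2 ⟨hyj, h⟩)
        obtain ⟨i, c1, c2, c3, c4, c5⟩ := hm.best y hy hyX'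
        have e : h'.arr 1 y = h0.arr 1 y := by rw [a1, hinv.arr1, Function.update_of_ne hyj]
        have eV : h'.tab.V (h'.arr 1 y) = h0.tab.V (h0.arr 1 y) := by
          -- The cells of items closed earlier have not changed during this round.
          rw [at', e, c3]; exact (hinv.agree i c1 y hy c2).2.2.2
        exact ⟨i, c1, hsub _ _ c2, e.trans c3, eV ▸ c4, fun i' hi' M hM => eV ▸ c5 i' hi' M hM⟩
    · intro i hi y hy hyX M hM
      by_cases hyj : y = j
      · subst hyj; exact (b6 i hi (Or.inr hi) M hM).trans q3
      · exact (hm.ub i hi y hy (fun h => hyX (Finset.mem_erase.2 ⟨hyj, h⟩)) M hM).trans q0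
  refine HRun.of_wp R ?_
  simp only [endP, HP.wp, HB.ok, HB.den, HR.ok, HR.den, HN.ok, HN.den, HStore.sa_reg, HStore.sa_rreg]
  refine ⟨by omega, trivial, by omega, trivial, by omega, trivial, by omega, by omega,
    ⟨trivial, trivial⟩, fun hlt => ⟨trivial, ⟨trivial, ?_⟩, ?_⟩, fun hlt => ⟨?_, ?_⟩⟩
  · simpa using hcode
  · refine ⟨⟨trivial, ?_⟩, fin _ ?_ ?_ ?_ ?_ ?_ ?_ ?_⟩
    · simp only [HStore.sr_reg, HStore.srr_reg, HStore.sa_reg, show (0 : ℕ) ≠ 9 by decide, if_false]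
      omega
    · simp [h1]
    · simp [h1]
    · simp [HStore.tab]
    · simp
    · simpa using hlt.le
    · simp
    · obtain ⟨M, d1, d2, d3⟩ := (hinv.all x b1 j hj b2).2.1.resolve_left (by
        rw [← b3, ← b4]; exact b5.ne')
      refine ⟨M, d1.valid.1, ?_, ?_⟩
      · simp [d2, ← b3, b4]
      · rw [← b3] at d3
        have : I.Tr h.tab (Final I (X.erase j)) (h.reg 8 + 1) M := by
          clear fin d1 d2
          generalize h.reg 8 + 1 = p at d3
          induction d3 with
          | nil => exact .nil
          | cons hi hj hf _ hd ih => exact .cons hi hj ((hiff _ hi _ hj).1 hf) ih hd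
        simpa using this
  · exact ⟨trivial, by omega⟩
  · refine fin _ ?_ ?_ ?_ ?_ ?_ ?_ ?_
    · simp [h1]
    · simp [h1]
    · simp [HStore.tab]
    · simp
    · simp
    · simpa using hlt
    · obtain ⟨M, d1, d2, d3⟩ := hm.ex
      exact ⟨M, d1, by simp [d2, hinv.rr0], by simpa [hinv.r9] using hinv.agree.tr hsub d3⟩

def selT (n : ℕ) : ℕ := (HP.setReg 4 .top).cst + (6 + n * (selBody.cst + 8))

def leftT (n : ℕ) : ℕ :=
  ((HP.setRReg 1 .zero).seq (.setReg 5 (.lit 0))).cst + (6 + n * (leftBody.cst + 8))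

/-- The time to process item `j`. -/
def cost (I : Layered) (j : ℕ) : ℕ :=
  selT I.N + (leftT I.N + (baseRegP.cst + storeP.cst + (pairsT I j + endP.cst)))

/-- The time bound depends on the item selected, so it is stated with the postcondition; summing it
over all items later charges the pair loop to pair items only. -/
lemma bodyP_run (R : I.Room nA W S) {h : HStore} {X : Finset ℕ} (hm : MainInv I X h)
    (hX : X.Nonempty) :
    HRunQ I nA W S bodyP h fun t h' => ∃ j ∈ X, t ≤ cost I j ∧ MainInv I (X.erase j) h' := by
  refine HRunQ.seq (selP_run R hm.sub hX hm.opened) ?_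
  rintro h1 ⟨hf, hjX, hmin⟩
  have hj : h1.reg 1 < I.N := Finset.mem_range.1 (hm.sub hjX)
  generalize hj1 : h1.reg 1 = j at hjX hmin hj
  have hmin' : ∀ x < I.N, I.key x < I.key j → x ∉ X := fun x _ hk hx => by
    have := hmin x hx; omega
  have key : HRun I nA W S (.seq leftP (.seq baseP (.seq pairsP endP))) h1
      (leftT I.N + (baseRegP.cst + storeP.cst + (pairsT I j + endP.cst)))
      (MainInv I (X.erase j)) := by
    refine HRun.seq (leftP_run (F := Final I X) R hj hj1 (by rw [hf.tab]; exact hm.all) ?_) ?_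
    · intro i hi hk
      rw [hf.tab, hf.arr]
      exact hm.best i hi (hmin' i hi hk)
    rintro h2 ⟨hf2, hG⟩
    rw [hf.tab] at hG
    refine HRun.seq (baseP_run R hjX hj
      ((hf.mono (by simp) (by simp)).trans (hf2.mono (by simp) (by simp)))
      ((hf2.reg 1 (by simp)).trans hj1) hm.all hG) ?_
    intro h3 hinv
    refine HRun.seq (pairsP_run R hjX hj hmin' hinv) ?_
    intro h4 hinv4
    exact endP_run R hjX hm hinv4
  intro s hs
  obtain ⟨t, s', h', e, hs', ht, hq⟩ := key s hs
  refine ⟨t, s', h', e, hs', fun t' ht' => ⟨j, hjX, ?_, hq⟩⟩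
  unfold cost selT
  omega

def initP : HP := .seq (.setReg 0 (.lit 0)) (.seq (.setRReg 0 .zero) (.setReg 9 (.lit 0)))

def mainLoop : HP := .loop (.lt (.reg 0) .nn) bodyP

/-- The dynamic program. -/
def mainP : HP := .seq initP mainLoop

lemma mainP_run (R : I.Room nA W S) {h : HStore} (h0 : ∀ i < I.N, h.arr 0 i = 0) :
    HRun I nA W S mainP h (initP.cst + ((HB.lt (.reg 0) .nn).c.cost + 1 +
      ∑ j ∈ Finset.range I.N, (cost I j + ((HB.lt (.reg 0) .nn).c.cost + 1))))
      (MainInv I ∅) := by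
  refine HRun.seq (HRun.of_wp (Q := fun h' => h' = ((h.sr 0 0).srr 0 0).sr 9 0) R ?_) ?_
  · simp [initP]
  rintro _ rfl
  refine HRun.todo R (Iv := MainInv I) (cost := cost I) ?_ (fun X h hm hX => bodyP_run R hm hX)
    (Finset.range I.N) _ ?_
  · intro X h hm
    refine ⟨⟨trivial, trivial⟩, ?_⟩
    have := hm.cnt
    simp only [HB.den, HN.den]
    rw [← Finset.card_pos]
    omega
  -- Initially all items are open, so the table claims are vacuous, and the empty matching attains
  -- the optimum `0`.
  · refine ⟨subset_rfl, by simp, ?_, ?_, ?_, by simp, ?_, ∅, valid_empty, by simp [wt], ?_⟩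
    · intro i hi; simp [h0 i hi, hi]
    · intro i _ j hj hf; exact (hf.1 (Finset.mem_range.2 hj)).elim
    · intro j hj hf; exact (hf (Finset.mem_range.2 hj)).elim
    · intro i _ j hj hf; exact (hf (Finset.mem_range.2 hj)).elim
    · simpa using Tr.nil

lemma MainInv.max {h : HStore} (hm : MainInv I ∅ h) :
    ∃ M, I.Valid M ∧ (∀ M', I.Valid M' → I.wt M' ≤ I.wt M) ∧
      I.Tr h.tab (Final I ∅) (h.reg 9) M := by
  obtain ⟨M, h1, h2, h3⟩ := hm.ex
  refine ⟨M, h1, fun M' hM' => ?_, h3⟩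
  rw [h2]
  by_cases hne : M'.Nonempty
  · obtain ⟨i, hi, j, hj, hs⟩ := exists_sem hM' hne
    exact hm.ub i hi j hj (by simp) M' hs
  · rw [Finset.not_nonempty_iff_eq_empty.1 hne]; simpa [wt] using hm.pos

end

end CPE

/-! ### Reading the input and writing the output -/

namespace CPE

open Layered RAM

section

variable {I : Layered} {nA W S : ℕ}

/-- Edges take the first `2 * m` cells and pairs follow, so the data of pair item `n` start at cell
`2 * n`. The pair is oriented by its upper endpoints before being stored and marked in the matrix.
-/
def fillBody : Prog :=
  .seq (.ite (.lt (.reg 6) (.reg 2))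
      (.seq (.setReg 7 (.reg 6)) (.setReg 8 (.reg 6)))
      (.seq (.seq (.setReg 7 (.load (.mul (.lit 2) (.reg 6))))
          (.setReg 8 (.load (.add (.mul (.lit 2) (.reg 6)) (.lit 1)))))
        (.seq (.ite (.lt (.load (.mul (.lit 2) (.reg 7))) (.load (.mul (.lit 2) (.reg 8)))) .skip
            (.seq (.setReg 9 (.reg 7)) (.seq (.setReg 7 (.reg 8)) (.setReg 8 (.reg 9)))))
          (.setMem (adr 2 (.add (.mul (.reg 7) (.reg 4)) (.reg 8))) (.lit 1)))))
    (.seq (.seq (.setMem (adr 0 (.reg 6)) (.reg 7)) (.setMem (adr 1 (.reg 6)) (.reg 8)))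
      (.setReg 6 (.add (.reg 6) (.lit 1))))

def setupInit : Prog :=
  .seq (.setReg 4 (.add (.reg 2) (.reg 3)))
    (.seq (.setReg 5 (.add (.mul (.lit 2) (.reg 2)) (.mul (.lit 2) (.reg 3))))
      (.setReg 6 (.lit 0)))

/-- Set up the tables of items. -/
def setupP : Prog := .seq setupInit (.loop (.lt (.reg 6) (.reg 4)) fillBody)

/-- The input memories `mem0`, `rmem0` present the instance `I`. -/
structure Input (I : Layered) (mem0 : ℕ → ℕ) (rmem0 : ℕ → ℝ) : Prop where
  a : ∀ e < I.m, mem0 (2 * e) = I.a e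
  b : ∀ e < I.m, mem0 (2 * e + 1) = I.b e
  w : ∀ e < I.m, rmem0 e = I.w e
  pair : ∀ i, I.m ≤ i → i < I.N → mem0 (2 * i) < I.m ∧ mem0 (2 * i + 1) < I.m ∧
    ((I.a (mem0 (2 * i)) < I.a (mem0 (2 * i + 1)) → I.U i = mem0 (2 * i) ∧
      I.D i = mem0 (2 * i + 1)) ∧
    (¬ I.a (mem0 (2 * i)) < I.a (mem0 (2 * i + 1)) → I.U i = mem0 (2 * i + 1) ∧
      I.D i = mem0 (2 * i)))
  high : ∀ x, I.base ≤ x → mem0 x = 0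

/-- The registers of constants and the input part of the memory are intact. -/
structure Intact (I : Layered) (nA : ℕ) (mem0 : ℕ → ℕ) (rmem0 : ℕ → ℝ) (s : Store) : Prop where
  r0 : s.reg 0 = nA
  r2 : s.reg 2 = I.m
  r4 : s.reg 4 = I.N
  r5 : s.reg 5 = I.base
  low : ∀ x < I.base, s.mem x = mem0 x
  real : s.rmem = rmem0

/-- The tables of the first `n` items, and of the adjacency given by the first `n'` items. -/
structure Filled (I : Layered) (n n' : ℕ) (s : Store) : Prop where
  U : ∀ i < n, s.mem (I.base + (8 * i + 0)) = I.U i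
  D : ∀ i < n, s.mem (I.base + (8 * i + 1)) = I.D i
  adj : ∀ u < I.m, ∀ v < I.m, s.mem (I.base + (8 * (u * I.N + v) + 2)) = 1 ↔
    ∃ i, I.m ≤ i ∧ i < n' ∧ I.U i = u ∧ I.D i = v
  opened : ∀ i < I.N, s.mem (I.base + (8 * i + 3)) = 0

lemma Intact.setReg {mem0 : ℕ → ℕ} {rmem0 : ℕ → ℝ} {s : Store} (h : Intact I nA mem0 rmem0 s)
    {r : ℕ} (hr : 6 ≤ r) (v : ℕ) :
    Intact I nA mem0 rmem0 { s with reg := Function.update s.reg r v } := by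
  obtain ⟨h0, h2, h4, h5, hl, hre⟩ := h
  exact ⟨by simpa [Function.update_of_ne (show 0 ≠ r by omega)] using h0,
    by simpa [Function.update_of_ne (show 2 ≠ r by omega)] using h2,
    by simpa [Function.update_of_ne (show 4 ≠ r by omega)] using h4,
    by simpa [Function.update_of_ne (show 5 ≠ r by omega)] using h5, hl, hre⟩

lemma Intact.setMem {mem0 : ℕ → ℕ} {rmem0 : ℕ → ℝ} {s : Store} (h : Intact I nA mem0 rmem0 s)
    (x v : ℕ) : Intact I nA mem0 rmem0
      { s with mem := Function.update s.mem (I.base + x) v } := by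
  obtain ⟨h0, h2, h4, h5, hl, hre⟩ := h
  refine ⟨h0, h2, h4, h5, fun y hy => ?_, hre⟩
  dsimp only
  rw [Function.update_of_ne (by omega)]
  exact hl y hy

lemma Filled.setReg {n n' : ℕ} {s : Store} (h : Filled I n n' s) (r v : ℕ) :
    Filled I n n' { s with reg := Function.update s.reg r v } := ⟨h.U, h.D, h.adj, h.opened⟩

/-- A time bound for a program without loops. -/
def pcst : Prog → ℕ
  | .skip => 1
  | .setReg _ e => e.cost + 1
  | .setMem a e => a.cost + e.cost + 1
  | .setRReg _ x => x.cost + 1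
  | .setRMem a x => a.cost + x.cost + 1
  | .seq p q => pcst p + pcst q
  | .ite b p q => b.cost + 1 + (pcst p + pcst q)
  | .loop _ _ => 0

/-- `p` runs without a fault from `s`, within its time bound, and `Q` holds of the final store. -/
def Runs (W S : ℕ) (p : Prog) (s : Store) (Q : Store → Prop) : Prop :=
  ∃ t s', Exec W S p s t s' ∧ t ≤ pcst p ∧ Q s'

lemma Runs.seq {p q : Prog} {s : Store} {Q' Q : Store → Prop} (hp : Runs W S p s Q')
    (hq : ∀ s', Q' s' → Runs W S q s' Q) : Runs W S (.seq p q) s Q := by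
  obtain ⟨t, s', e, ht, hQ⟩ := hp
  obtain ⟨t', s'', e', ht', hQ'⟩ := hq s' hQ
  exact ⟨_, _, .seq e e', by simp only [pcst]; omega, hQ'⟩

lemma Runs.setReg {s : Store} {r : ℕ} {e : NExp} {v : ℕ} {Q : Store → Prop}
    (he : e.eval W S s = some v) (hQ : Q { s with reg := Function.update s.reg r v }) :
    Runs W S (.setReg r e) s Q := ⟨_, _, .setReg he, le_rfl, hQ⟩

lemma Runs.setMem {s : Store} {a e : NExp} {i v : ℕ} {Q : Store → Prop}
    (ha : a.eval W S s = some i) (hi : i < S) (he : e.eval W S s = some v)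
    (hQ : Q { s with mem := Function.update s.mem i v }) :
    Runs W S (.setMem a e) s Q := ⟨_, _, .setMem ha hi he, le_rfl, hQ⟩

lemma Runs.skip {s : Store} {Q : Store → Prop} (hQ : Q s) : Runs W S .skip s Q :=
  ⟨_, _, .skip s, le_rfl, hQ⟩

lemma Runs.ite_lt {s : Store} {a b : NExp} {u v : ℕ} {p q : Prog} {Q : Store → Prop}
    (ha : a.eval W S s = some u) (hb : b.eval W S s = some v)
    (hp : u < v → Runs W S p s Q) (hq : ¬ u < v → Runs W S q s Q) :
    Runs W S (.ite (.lt a b) p q) s Q := by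
  by_cases h : u < v
  · obtain ⟨t, s', e, ht, hQ⟩ := hp h
    exact ⟨_, _, .iteTrue (by simp [BExp.eval, ha, hb, h]) e, by simp only [pcst]; omega, hQ⟩
  · obtain ⟨t, s', e, ht, hQ⟩ := hq h
    exact ⟨_, _, .iteFalse (by simp [BExp.eval, ha, hb, not_lt.1 h]) e,
      by simp only [pcst]; omega, hQ⟩

lemma Runs.ite_eq {s : Store} {a b : NExp} {u v : ℕ} {p q : Prog} {Q : Store → Prop}
    (ha : a.eval W S s = some u) (hb : b.eval W S s = some v)
    (hp : u = v → Runs W S p s Q) (hq : u ≠ v → Runs W S q s Q) :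
    Runs W S (.ite (.eq a b) p q) s Q := by
  by_cases h : u = v
  · obtain ⟨t, s', e, ht, hQ⟩ := hp h
    exact ⟨_, _, .iteTrue (by simp [BExp.eval, ha, hb, h]) e, by simp only [pcst]; omega, hQ⟩
  · obtain ⟨t, s', e, ht, hQ⟩ := hq h
    exact ⟨_, _, .iteFalse (by simp [BExp.eval, ha, hb, h]) e, by simp only [pcst]; omega, hQ⟩

variable {mem0 : ℕ → ℕ} {rmem0 : ℕ → ℝ}

lemma even_load (R : I.Room nA W S) {s : Store} {e : NExp} {v : ℕ}
    (he : e.eval W S s = some v) (hv : v < I.N) :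
    (NExp.load (.mul (.lit 2) e)).eval W S s = some (s.mem (2 * v)) := by
  have := R.word; have := R.space; have : I.base = 2 * I.m + 2 * I.k := rfl
  have : I.N = I.m + I.k := rfl
  simp only [NExp.eval, he, fit, Option.bind_some]
  rw [if_pos (by omega), Option.bind_some, if_pos (by omega), Option.bind_some, if_pos (by omega)]

lemma odd_load (R : I.Room nA W S) {s : Store} {e : NExp} {v : ℕ}
    (he : e.eval W S s = some v) (hv : v < I.N) :
    (NExp.load (.add (.mul (.lit 2) e) (.lit 1))).eval W S s = some (s.mem (2 * v + 1)) := by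
  have := R.word; have := R.space; have : I.base = 2 * I.m + 2 * I.k := rfl
  have : I.N = I.m + I.k := rfl
  simp only [NExp.eval, he, fit, Option.bind_some]
  rw [if_pos (by omega), Option.bind_some, if_pos (by omega), Option.bind_some,
    if_pos (by omega), Option.bind_some, if_pos (by omega), Option.bind_some, if_pos (by omega)]

lemma fillBody_run (R : I.Room nA W S) (hin : Input I mem0 rmem0) {n : ℕ} (hn : n < I.N)
    {s : Store} (h6 : s.reg 6 = n) (hs : Intact I nA mem0 rmem0 s) (hf : Filled I n n s) :
    Runs W S fillBody s fun s' => s'.reg 6 = n + 1 ∧ Intact I nA mem0 rmem0 s' ∧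
      Filled I (n + 1) (n + 1) s' := by
  have hW := R.word
  have hS := R.space
  have hN := I.N_le_sq
  have hb : I.base = 2 * I.m + 2 * I.k := rfl
  have hNm : I.N = I.m + I.k := rfl
  -- Between the two halves the matrix already includes item `n` but the tables of ends do not,
  -- hence the two counters of `Filled`.
  refine Runs.seq (Q' := fun s' => s'.reg 6 = n ∧ s'.reg 7 = I.U n ∧ s'.reg 8 = I.D n ∧
    Intact I nA mem0 rmem0 s' ∧ Filled I n (n + 1) s') ?_ ?_
  · refine Runs.ite_lt (u := n) (v := I.m) (by rw [← h6]; rfl) (by rw [← hs.r2]; rfl) ?_ ?_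
    · intro hlt
      obtain ⟨e1, e2⟩ := I.single n hlt
      refine Runs.seq (Q' := fun s' => s' = { s with reg := Function.update s.reg 7 n })
        (Runs.setReg (by rw [← h6]; rfl) rfl) ?_
      rintro _ rfl
      refine Runs.setReg (v := n) (by simp [NExp.eval, h6]) ?_
      refine ⟨by simp [h6], by simp [e1], by simp [e2],
        (hs.setReg (by omega) _).setReg (by omega) _, ?_⟩
      refine ⟨hf.U, hf.D, fun u hu v hv => (hf.adj u hu v hv).trans ?_, hf.opened⟩
      constructor
      · rintro ⟨i, h1, h2, -⟩; omega
      · rintro ⟨i, h1, h2, -⟩; omega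
    · intro hge
      obtain ⟨p1, p2, p3, p4⟩ := hin.pair n (not_lt.1 hge) hn
      have l1 : s.mem (2 * n) = mem0 (2 * n) := hs.low _ (by omega)
      have l2 : s.mem (2 * n + 1) = mem0 (2 * n + 1) := hs.low _ (by omega)
      generalize hx : mem0 (2 * n) = x at *
      generalize hy : mem0 (2 * n + 1) = y at *
      refine Runs.seq (Q' := fun s' => s'.reg 6 = n ∧ s'.reg 7 = x ∧ s'.reg 8 = y ∧
        Intact I nA mem0 rmem0 s' ∧ Filled I n n s') ?_ ?_
      · refine Runs.seq (Q' := fun s' => s' = { s with reg := Function.update s.reg 7 x })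
          (Runs.setReg ?_ rfl) ?_
        · rw [← l1]; exact even_load R (by rw [← h6]; rfl) hn
        rintro _ rfl
        refine Runs.setReg (v := y) ?_ ?_
        · rw [← l2]; exact odd_load R (s := { s with reg := Function.update s.reg 7 x })
            (by simp [NExp.eval, h6]) hn
        · exact ⟨by simp [h6], by simp, by simp, (hs.setReg (by omega) _).setReg (by omega) _,
            (hf.setReg _ _).setReg _ _⟩
      rintro s1 ⟨k6, k7, k8, hs1, hf1⟩
      refine Runs.seq (Q' := fun s' => s'.reg 6 = n ∧ s'.reg 7 = I.U n ∧ s'.reg 8 = I.D n ∧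
        Intact I nA mem0 rmem0 s' ∧ Filled I n n s') ?_ ?_
      · refine Runs.ite_lt (even_load R (v := x) (by rw [← k7]; rfl) (by omega))
          (even_load R (v := y) (by rw [← k8]; rfl) (by omega)) ?_ ?_
        all_goals rw [hs1.low _ (by omega), hs1.low _ (by omega), hin.a x p1, hin.a y p2]
        · intro hlt
          obtain ⟨q1, q2⟩ := p3 hlt
          exact Runs.skip ⟨k6, k7.trans q1.symm, k8.trans q2.symm, hs1, hf1⟩
        · intro hge'
          obtain ⟨q1, q2⟩ := p4 hge'
          refine Runs.seq (Q' := fun s' => s' = { s1 with reg := Function.update s1.reg 9 x })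
            (Runs.setReg (by rw [← k7]; rfl) rfl) ?_
          rintro _ rfl
          refine Runs.seq (Runs.setReg (v := y) (by simp [NExp.eval, k8])
            (Eq.refl (Store.mk _ _ _ _))) ?_
          rintro _ rfl
          refine Runs.setReg (v := x) (by simp [NExp.eval]) ?_
          exact ⟨by simp [k6], by simp [q1], by simp [q2],
            ((hs1.setReg (by omega) _).setReg (by omega) _).setReg (by omega) _,
            ((hf1.setReg _ _).setReg _ _).setReg _ _⟩
      rintro s2 ⟨k6, k7, k8, hs2, hf2⟩
      have hU := U_lt hn
      have hD := D_lt hn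
      have hc := code_lt (N := I.N) (i := I.U n) (j := I.D n) (by omega) (by omega)
      refine Runs.setMem (v := 1)
        (adr_eval R hs2.r5 (v := I.U n * I.N + I.D n) ?_ hc (by omega)) (by omega) ?_ ?_
      · simp only [NExp.eval, k7, k8, hs2.r4, Option.bind_some, fit]
        rw [if_pos (by omega), Option.bind_some, if_pos (by omega)]
      · simp only [NExp.eval, fit]; rw [if_pos (by omega)]
      · refine ⟨k6, k7, k8, hs2.setMem _ _, ?_, ?_, ?_, ?_⟩
        · intro i hi; dsimp only; rw [Function.update_of_ne (by omega)]; exact hf2.U i hi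
        · intro i hi; dsimp only; rw [Function.update_of_ne (by omega)]; exact hf2.D i hi
        · intro u hu v hv
          dsimp only
          by_cases huv : u = I.U n ∧ v = I.D n
          · obtain ⟨rfl, rfl⟩ := huv
            simp only [Function.update_self, true_iff]
            exact ⟨n, not_lt.1 hge, by omega, rfl, rfl⟩
          · rw [Function.update_of_ne, hf2.adj u hu v hv]
            · constructor
              · rintro ⟨i, h1, h2, h3⟩; exact ⟨i, h1, by omega, h3⟩
              · rintro ⟨i, h1, h2, h3, h4⟩
                by_cases hin' : i = n
                · subst hin'; exact (huv ⟨h3.symm, h4.symm⟩).elim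
                · exact ⟨i, h1, by omega, h3, h4⟩
            · intro h
              exact huv (code_inj (N := I.N) (by omega) (by omega) (by omega))
        · intro i hi; dsimp only; rw [Function.update_of_ne (by omega)]; exact hf2.opened i hi
  rintro s1 ⟨k6, k7, k8, hs1, hf1⟩
  refine Runs.seq (Q' := fun s' => s'.reg 6 = n ∧ Intact I nA mem0 rmem0 s' ∧
    Filled I (n + 1) (n + 1) s') ?_ ?_
  · refine Runs.seq (Runs.setMem (v := I.U n)
      (adr_eval R hs1.r5 (v := n) (by rw [← k6]; rfl) (by omega) (by omega)) (by omega)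
      (by rw [← k7]; rfl) (Eq.refl (Store.mk _ _ _ _))) ?_
    rintro _ rfl
    refine Runs.setMem (v := I.D n)
      (adr_eval R (by exact hs1.r5) (v := n) (by rw [← k6]; rfl) (by omega) (by omega)) (by omega)
      (by rw [← k8]; rfl) ?_
    refine ⟨k6, (hs1.setMem _ _).setMem _ _, ?_, ?_, ?_, ?_⟩
    · intro i hi
      dsimp only
      rw [Function.update_of_ne (by omega)]
      by_cases hin' : i = n
      · subst hin'; simp
      · rw [Function.update_of_ne (by omega)]; exact hf1.U i (by omega)
    · intro i hi
      dsimp only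
      by_cases hin' : i = n
      · subst hin'; simp
      · rw [Function.update_of_ne (by omega), Function.update_of_ne (by omega)]
        exact hf1.D i (by omega)
    · intro u hu v hv
      dsimp only
      rw [Function.update_of_ne (by omega), Function.update_of_ne (by omega)]
      exact hf1.adj u hu v hv
    · intro i hi
      dsimp only
      rw [Function.update_of_ne (by omega), Function.update_of_ne (by omega)]
      exact hf1.opened i hi
  rintro s2 ⟨k6, hs2, hf2⟩
  refine Runs.setReg (v := n + 1) ?_ ⟨by simp, hs2.setReg (by omega) _, hf2.setReg _ _⟩
  simp only [NExp.eval, k6, fit]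
  rw [if_pos (by omega), Option.bind_some, Option.bind_some, if_pos (by omega)]

lemma setupLoop_run (R : I.Room nA W S) (hin : Input I mem0 rmem0) (d : ℕ) :
    ∀ n, n + d = I.N → ∀ s : Store, s.reg 6 = n → Intact I nA mem0 rmem0 s → Filled I n n s →
      ∃ t s', Exec W S (.loop (.lt (.reg 6) (.reg 4)) fillBody) s t s' ∧
        t ≤ 4 + d * (pcst fillBody + 4) ∧ Intact I nA mem0 rmem0 s' ∧ Filled I I.N I.N s' := by
  induction d with
  | zero =>
    intro n hn s h6 hs hf
    have : n = I.N := hn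
    subst this
    refine ⟨_, s, .loopFalse ?_, by simp [BExp.cost, NExp.cost], hs, hf⟩
    simp [BExp.eval, NExp.eval, h6, hs.r4]
  | succ d ih =>
    intro n hn s h6 hs hf
    obtain ⟨t, s', e, ht, k6, hs', hf'⟩ := fillBody_run R hin (n := n) (by omega) h6 hs hf
    obtain ⟨t', s'', e', ht', q⟩ := ih (n + 1) (by omega) s' k6 hs' hf'
    refine ⟨_, s'', .loopTrue ?_ e e', ?_, q⟩
    · have : n < I.N := by omega
      simp [BExp.eval, NExp.eval, h6, hs.r4, this]
    · have : (d + 1) * (pcst fillBody + 4) = d * (pcst fillBody + 4) + (pcst fillBody + 4) :=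
        Nat.succ_mul _ _
      simp only [BExp.cost, NExp.cost]
      omega

lemma setupP_run (R : I.Room nA W S) (hin : Input I mem0 rmem0) {s : Store}
    (h0 : s.reg 0 = nA) (h2 : s.reg 2 = I.m) (h3 : s.reg 3 = I.k) (hm : s.mem = mem0)
    (hr : s.rmem = rmem0) :
    ∃ t s' h, Exec W S setupP s t s' ∧ t ≤ pcst setupInit + (4 + I.N * (pcst fillBody + 4)) ∧
      Sim I nA s' h ∧ ∀ i < I.N, h.arr 0 i = 0 := by
  have hW := R.word
  have hN := I.N_le_sq
  have hb : I.base = 2 * I.m + 2 * I.k := rfl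
  have hNm : I.N = I.m + I.k := rfl
  have hinit : Runs W S setupInit s fun s' => s'.reg 6 = 0 ∧ Intact I nA mem0 rmem0 s' ∧
      Filled I 0 0 s' := by
    refine Runs.seq (Runs.setReg (v := I.N) ?_ (Eq.refl (Store.mk _ _ _ _))) ?_
    · simp only [NExp.eval, h2, h3, fit, Option.bind_some]; rw [if_pos (by omega), hNm]
    rintro _ rfl
    refine Runs.seq (Runs.setReg (v := I.base) ?_ (Eq.refl (Store.mk _ _ _ _))) ?_
    · have e2 : Function.update s.reg 4 I.N 2 = I.m := by simp [h2]
      have e3 : Function.update s.reg 4 I.N 3 = I.k := by simp [h3]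
      simp only [NExp.eval, e2, e3, fit]
      rw [if_pos (by omega), Option.bind_some, Option.bind_some, if_pos (by omega),
        Option.bind_some, Option.bind_some, Option.bind_some, if_pos (by omega), Option.bind_some,
        if_pos (by omega), hb]
    rintro _ rfl
    refine Runs.setReg (v := 0) ?_ ⟨by simp, ⟨by simp [h0], by simp [h2], by simp, by simp,
      fun x _ => by simp [hm], hr⟩, by simp, by simp, ?_, ?_⟩
    · simp only [NExp.eval, fit]; rw [if_pos (by omega)]
    · intro u _ v _
      dsimp only
      -- Memory above the input is zero at the start: the matrix is empty and every item is open.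
      rw [hm, hin.high _ (by omega)]
      simp
    · intro i _
      dsimp only
      rw [hm, hin.high _ (by omega)]
  obtain ⟨t, s1, e1, ht1, k6, hs1, hf1⟩ := hinit
  obtain ⟨t', s2, e2, ht2, hs2, hf2⟩ := setupLoop_run R hin I.N 0 (by omega) s1 k6 hs1 hf1
  -- The structured store is read off the machine store, so its registers and tables agree by
  -- definition.
  refine ⟨_, s2, ⟨fun r => s2.reg (r + 6), fun c i => s2.mem (I.base + (8 * i + (c + 3))), s2.rreg,
    fun i => s2.rmem (I.m + i)⟩, .seq e1 e2, by omega, ?_, fun i hi => hf2.opened i hi⟩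
  refine ⟨hs2.r0, hs2.r2, hs2.r4, hs2.r5, fun _ => rfl, ?_, ?_, hf2.U, hf2.D, ?_,
    fun _ _ _ _ => rfl, fun _ => rfl, ?_, fun _ _ => rfl⟩
  · intro e he; rw [hs2.low _ (by omega), hin.a e he]
  · intro e he; rw [hs2.low _ (by omega), hin.b e he]
  · intro u hu v hv; exact hf2.adj u hu v hv
  · intro e he; rw [hs2.real, hin.w e he]

/-- Register 15 is the structured register 9, the current link; register 0 is both the number of
edges written and the next output address. Equal entries in columns 5 and 6 mean a single new edge,
written once. -/
def outBody : Prog :=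
  .seq (.setReg 15 (.sub (.reg 15) (.lit 1)))
    (.seq (.seq (.setMem (.reg 0) (.load (adr 5 (.reg 15)))) (.setReg 0 (.add (.reg 0) (.lit 1))))
      (.seq (.ite (.eq (.load (adr 5 (.reg 15))) (.load (adr 6 (.reg 15)))) .skip
          (.seq (.setMem (.reg 0) (.load (adr 6 (.reg 15)))) (.setReg 0 (.add (.reg 0) (.lit 1)))))
        (.setReg 15 (.load (adr 7 (.reg 15))))))

def outLoop : Prog := .loop (.lt (.lit 0) (.reg 15)) outBody

/-- Write the edges found by following the links from the best state. -/
def outP : Prog := .seq (.setReg 0 (.lit 0)) outLoop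

/-- The store contains the tables `T`. -/
structure HasTab (I : Layered) (T : Tab) (s : Store) : Prop where
  r5 : s.reg 5 = I.base
  e1 : ∀ x < I.N * I.N, s.mem (I.base + (8 * x + 5)) = T.e1 x
  e2 : ∀ x < I.N * I.N, s.mem (I.base + (8 * x + 6)) = T.e2 x
  nx : ∀ x < I.N * I.N, s.mem (I.base + (8 * x + 7)) = T.nx x

lemma HasTab.setReg {T : Tab} {s : Store} (h : HasTab I T s) {r : ℕ} (hr : r ≠ 5) (v : ℕ) :
    HasTab I T { s with reg := Function.update s.reg r v } :=
  ⟨by simpa [Function.update_of_ne hr.symm] using h.r5, h.e1, h.e2, h.nx⟩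

lemma HasTab.setMem {T : Tab} {s : Store} (h : HasTab I T s) {x : ℕ} (hx : x < I.base) (v : ℕ) :
    HasTab I T { s with mem := Function.update s.mem x v } := by
  refine ⟨h.r5, ?_, ?_, ?_⟩ <;> intro y hy <;> dsimp only <;>
    rw [Function.update_of_ne (by omega)]
  · exact h.e1 y hy
  · exact h.e2 y hy
  · exact h.nx y hy

/-- The store `s'` results from `s` by appending `l` to the output. -/
structure Appended (I : Layered) (T : Tab) (s : Store) (c : ℕ) (l : List ℕ) (s' : Store) :
    Prop where
  tab : HasTab I T s'
  r0 : s'.reg 0 = c + l.length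
  out : ∀ (j : ℕ) (hj : j < l.length), s'.mem (c + j) = l[j]
  low : ∀ x < c, s'.mem x = s.mem x

lemma emit_run (R : I.Room nA W S) {T : Tab} {s : Store} (hs : HasTab I T s) {c : ℕ}
    (h0 : s.reg 0 = c) (hc : c < I.base) {e : NExp} {v : ℕ} (he : e.eval W S s = some v) :
    Runs W S (.seq (.setMem (.reg 0) e) (.setReg 0 (.add (.reg 0) (.lit 1)))) s fun s' =>
      Appended I T s c [v] s' ∧ s'.reg 15 = s.reg 15 := by
  have hW := R.word
  have hS := R.space
  refine Runs.seq (Runs.setMem (i := c) (by rw [← h0]; rfl) (by omega) he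
    (Eq.refl (Store.mk _ _ _ _))) ?_
  rintro _ rfl
  refine Runs.setReg (v := c + 1) ?_ ⟨⟨(hs.setMem hc v).setReg (by omega) _, by simp, ?_, ?_⟩,
    by simp⟩
  · simp only [NExp.eval, h0, fit]
    rw [if_pos (by omega), Option.bind_some, Option.bind_some, if_pos (by omega)]
  · intro j hj
    have : j = 0 := by simpa using hj
    subst this
    simp
  · intro x hx
    dsimp only
    rw [Function.update_of_ne (by omega)]

lemma Appended.trans {T : Tab} {s s' s'' : Store} {c : ℕ} {l l' : List ℕ}
    (h : Appended I T s c l s') (h' : Appended I T s' (c + l.length) l' s'') :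
    Appended I T s c (l ++ l') s'' := by
  refine ⟨h'.tab, by rw [h'.r0, List.length_append, add_assoc], ?_, ?_⟩
  · intro j hj
    by_cases hjl : j < l.length
    · rw [h'.low _ (by omega), h.out j hjl, List.getElem_append_left]
    · have := h'.out (j - l.length) (by rw [List.length_append] at hj; omega)
      rw [show c + l.length + (j - l.length) = c + j by omega] at this
      rw [this, List.getElem_append_right (by omega)]
  · intro x hx
    rw [h'.low x (by omega), h.low x hx]

lemma outBody_run (R : I.Room nA W S) {T : Tab} {s : Store} (hs : HasTab I T s) {c x : ℕ}
    (h0 : s.reg 0 = c) (hx : x < I.N * I.N) (h15 : s.reg 15 = x + 1)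
    (hc : c + ({T.e1 x, T.e2 x} : Finset ℕ).card ≤ I.base) :
    Runs W S outBody s fun s' => s'.reg 15 = T.nx x ∧
      ∃ l : List ℕ, l.Nodup ∧ l.toFinset = {T.e1 x, T.e2 x} ∧ Appended I T s c l s' := by
  have hW := R.word
  have hS := R.space
  refine Runs.seq (Runs.setReg (v := x) ?_ (Eq.refl (Store.mk _ _ _ _))) ?_
  · simp only [NExp.eval, h15, fit]
    rw [if_pos (by omega), Option.bind_some, Option.bind_some, if_pos (by omega),
      Nat.add_sub_cancel]
  rintro s1 hs1
  have t1 : HasTab I T s1 := hs1 ▸ hs.setReg (by omega) _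
  have k15 : s1.reg 15 = x := by rw [← hs1]; simp
  have k0 : s1.reg 0 = c := by rw [← hs1]; simp [h0]
  have km : s1.mem = s.mem := by rw [← hs1]
  have ev : ∀ s' : Store, HasTab I T s' → s'.reg 15 = x →
      (NExp.load (adr 5 (.reg 15))).eval W S s' = some (T.e1 x) ∧
      (NExp.load (adr 6 (.reg 15))).eval W S s' = some (T.e2 x) ∧
      (NExp.load (adr 7 (.reg 15))).eval W S s' = some (T.nx x) := by
    intro s' ht hk
    have e : (NExp.reg 15).eval W S s' = some x := by rw [← hk]; rfl
    refine ⟨?_, ?_, ?_⟩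
    · rw [adr_load R ht.r5 e hx (by omega), ht.e1 x hx]
    · rw [adr_load R ht.r5 e hx (by omega), ht.e2 x hx]
    · rw [adr_load R ht.r5 e hx (by omega), ht.nx x hx]
  have hcard : 1 ≤ ({T.e1 x, T.e2 x} : Finset ℕ).card :=
    Finset.card_pos.2 ⟨_, Finset.mem_insert_self _ _⟩
  refine Runs.seq (emit_run R t1 k0 (by omega) (ev s1 t1 k15).1) ?_
  rintro s2 ⟨a2, e15⟩
  rw [k15] at e15
  have a2' : Appended I T s c [T.e1 x] s2 := ⟨a2.tab, a2.r0, a2.out, fun y hy => by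
    rw [a2.low y hy, km]⟩
  refine Runs.seq (Q' := fun s' => s'.reg 15 = x ∧
    ∃ l : List ℕ, l.Nodup ∧ l.toFinset = {T.e1 x, T.e2 x} ∧ Appended I T s c l s') ?_ ?_
  · refine Runs.ite_eq (ev s2 a2.tab e15).1 (ev s2 a2.tab e15).2.1 ?_ ?_
    · intro he
      exact Runs.skip ⟨e15, [T.e1 x], by simp, by simp [← he], a2'⟩
    · intro he
      rw [Finset.card_pair he] at hc
      obtain ⟨t, s3, ex, ht, a3, f15⟩ := emit_run R (c := c + 1) a2.tab a2.r0 (by omega)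
        (ev s2 a2.tab e15).2.1
      exact ⟨t, s3, ex, ht, f15.trans e15, [T.e1 x] ++ [T.e2 x], by simp [he], by simp,
        a2'.trans a3⟩
  rintro s3 ⟨e15, l, l1, l2, a3⟩
  refine Runs.setReg (v := T.nx x) (ev s3 a3.tab e15).2.2 ⟨by simp, l, l1, l2, ?_⟩
  exact ⟨a3.tab.setReg (by omega) _, by simpa using a3.r0, a3.out, a3.low⟩

/-- The output overwrites only the input area below `base`, so the links remain readable. Every
round writes at least one new edge, so the number of rounds is at most the size of the matching. -/
lemma outLoop_run (R : I.Room nA W S) {T : Tab} {F : ℕ → ℕ → Prop} {p : ℕ} {M : Finset ℕ}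
    (h : I.Tr T F p M) : ∀ (s : Store) (c : ℕ), HasTab I T s → s.reg 0 = c → s.reg 15 = p →
      c + M.card ≤ I.base → ∃ t s', Exec W S outLoop s t s' ∧
        t ≤ 4 + M.card * (pcst outBody + 4) ∧
        ∃ l : List ℕ, l.Nodup ∧ l.toFinset = M ∧ Appended I T s c l s' := by
  have hW := R.word
  induction h with
  | nil =>
    intro s c hs h0 h15 _
    refine ⟨_, s, .loopFalse ?_, by simp [BExp.cost, NExp.cost], [], by simp, by simp, hs,
      by simpa using h0, by simp, fun _ _ => rfl⟩
    simp only [BExp.eval, NExp.eval, fit, h15]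
    rw [if_pos (by omega)]; rfl
  | @cons i j M hi hj hF ht hd ih =>
    intro s c hs h0 h15 hc
    have hx := code_lt hi hj
    generalize i * I.N + j = x at *
    rw [Finset.card_union_of_disjoint hd] at hc ⊢
    obtain ⟨t, s1, e1, ht1, k15, l, l1, l2, a1⟩ := outBody_run R hs h0 hx h15 (by omega)
    have hl : l.length = ({T.e1 x, T.e2 x} : Finset ℕ).card := by
      rw [← l2, List.toFinset_card_of_nodup l1]
    obtain ⟨t', s2, e2, ht2, l', l1', l2', a2⟩ := ih s1 (c + l.length) a1.tab a1.r0 k15 (by omega)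
    refine ⟨_, s2, .loopTrue ?_ e1 e2, ?_, l ++ l', ?_, ?_, a1.trans a2⟩
    · simp only [BExp.eval, NExp.eval, fit, h15]
      rw [if_pos (by omega)]; simp
    · have hcard : 1 ≤ ({T.e1 x, T.e2 x} : Finset ℕ).card :=
        Finset.card_pos.2 ⟨_, Finset.mem_insert_self _ _⟩
      have := Nat.mul_le_mul_right (pcst outBody + 4) hcard
      rw [Nat.add_mul]
      simp only [BExp.cost, NExp.cost]
      omega
    · rw [List.nodup_append']
      refine ⟨l1, l1', ?_⟩
      rw [List.disjoint_toFinset_iff_disjoint.symm, l2, l2']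
      exact hd
    · rw [List.toFinset_append, l2, l2']

/-- The program. -/
def wholeP : Prog := .seq setupP (.seq mainP.c outP)

def wholeT (I : Layered) : ℕ :=
  pcst setupInit + (4 + I.N * (pcst fillBody + 4)) +
    ((initP.cst + ((HB.lt (.reg 0) .nn).c.cost + 1 +
      ∑ j ∈ Finset.range I.N, (cost I j + ((HB.lt (.reg 0) .nn).c.cost + 1)))) +
    (2 + (4 + I.m * (pcst outBody + 4))))

theorem wholeP_run (R : I.Room nA W S) (hin : Input I mem0 rmem0) {s : Store}
    (h0 : s.reg 0 = nA) (h2 : s.reg 2 = I.m) (h3 : s.reg 3 = I.k) (hm : s.mem = mem0)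
    (hr : s.rmem = rmem0) :
    ∃ t s', ∃ l : List ℕ, Exec W S wholeP s t s' ∧ t ≤ wholeT I ∧ l.Nodup ∧ I.Valid l.toFinset ∧
      (∀ M', I.Valid M' → I.wt M' ≤ I.wt l.toFinset) ∧ s'.reg 0 = l.length ∧
      ∀ (j : ℕ) (hj : j < l.length), s'.mem j = l[j] := by
  have hW := R.word
  obtain ⟨t1, s1, h1, e1, ht1, hsim, hz⟩ := setupP_run R hin h0 h2 h3 hm hr
  obtain ⟨t2, s2, h2, e2, hsim2, ht2, hmain⟩ := mainP_run R hz s1 hsim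
  obtain ⟨M, hv, hmax, htr⟩ := hmain.max
  have htab : HasTab I h2.tab s2 := ⟨hsim2.r5, fun x hx => hsim2.arr 2 (by omega) x hx,
    fun x hx => hsim2.arr 3 (by omega) x hx, fun x hx => hsim2.arr 4 (by omega) x hx⟩
  -- At most `m` output cells are needed, and the input area has at least `2 * m`.
  have hcard : M.card ≤ I.m := by
    have : M ⊆ Finset.range I.m := fun e he => Finset.mem_range.2 (hv.lt_m e he)
    simpa using Finset.card_le_card this
  have h15 : s2.reg 15 = h2.reg 9 := hsim2.reg 9
  have hb : I.base = 2 * I.m + 2 * I.k := rfl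
  obtain ⟨t3, s3, e3, ht3, l, l1, l2, ap⟩ := outLoop_run R htr
    { s2 with reg := Function.update s2.reg 0 0 } 0 (htab.setReg (by omega) _) (by simp)
    (by simpa using h15) (by omega)
  refine ⟨_, s3, l, .seq e1 (.seq e2 (.seq (.setReg (v := 0) ?_) e3)), ?_, l1, l2 ▸ hv, l2 ▸ hmax, ?_,
    ?_⟩
  · simp only [NExp.eval, fit]; rw [if_pos (by omega)]
  · have := Nat.mul_le_mul_right (pcst outBody + 4) hcard
    unfold wholeT
    simp only [NExp.cost]
    omega
  · simpa using ap.r0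
  · intro j hj; simpa using ap.out j hj

end

end CPE

/-! ### Presentations -/

namespace CPE

open Layered RAM

lemma flat_even {α : Type*} (f g : α → ℕ) (r : List ℕ) : ∀ (l : List α) (i : ℕ) (hi : i < l.length),
    ((l.flatMap fun e => [f e, g e]) ++ r).getD (2 * i) 0 = f l[i] := by
  intro l
  induction l with
  | nil => intro i hi; simp at hi
  | cons x l ih =>
    intro i hi
    cases i with
    | zero => simp
    | succ i =>
      have := ih i (by simpa using hi)
      simpa [Nat.mul_succ] using this

lemma flat_odd {α : Type*} (f g : α → ℕ) (r : List ℕ) : ∀ (l : List α) (i : ℕ) (hi : i < l.length),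
    ((l.flatMap fun e => [f e, g e]) ++ r).getD (2 * i + 1) 0 = g l[i] := by
  intro l
  induction l with
  | nil => intro i hi; simp at hi
  | cons x l ih =>
    intro i hi
    cases i with
    | zero => simp
    | succ i =>
      have := ih i (by simpa using hi)
      simpa [Nat.mul_succ, Nat.add_right_comm] using this

lemma flat_length {α : Type*} (f g : α → ℕ) (l : List α) :
    (l.flatMap fun e => [f e, g e]).length = 2 * l.length := by
  induction l with
  | nil => rfl
  | cons x l ih => simp [ih, Nat.mul_succ]

lemma crosses_comm {nA nB : ℕ} {e f : Edge nA nB} : Crosses e f ↔ Crosses f e := by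
  unfold Crosses; tauto

namespace Presentation

variable {P : Problem} (L : Presentation P)

lemma m_eq : P.m = L.edges.length := by
  rw [Problem.m, ← L.edges_eq, List.toFinset_card_of_nodup L.edges_nodup]

lemma k_eq : P.k = L.pairs.length := by
  rw [Problem.k, ← L.pairs_eq, List.toFinset_card_of_nodup L.pairs_nodup, List.length_map]

/-- The endpoint of edge number `e` on the upper layer. -/
def posA (e : ℕ) : ℕ := if h : e < L.edges.length then (L.edges[e].1 : ℕ) else 0

def posB (e : ℕ) : ℕ := if h : e < L.edges.length then (L.edges[e].2 : ℕ) else 0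

noncomputable def wgt (e : ℕ) : ℝ := if h : e < L.edges.length then P.w L.edges[e] else 0

def fstE (p : ℕ) : ℕ := if h : p < L.pairs.length then (L.pairs[p].1 : ℕ) else 0

def sndE (p : ℕ) : ℕ := if h : p < L.pairs.length then (L.pairs[p].2 : ℕ) else 0

/-- Pairs are listed in either order; comparing upper endpoints decides which edge is `U`. -/
def upE (p : ℕ) : ℕ := if L.posA (L.fstE p) < L.posA (L.sndE p) then L.fstE p else L.sndE p

def downE (p : ℕ) : ℕ := if L.posA (L.fstE p) < L.posA (L.sndE p) then L.sndE p else L.fstE p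

lemma posA_fin (x : Fin L.edges.length) : L.posA x = (L.edges.get x).1 := by
  simp [posA]

lemma posB_fin (x : Fin L.edges.length) : L.posB x = (L.edges.get x).2 := by
  simp [posB]

lemma crosses_iff (x y : Fin L.edges.length) : Crosses (L.edges.get x) (L.edges.get y) ↔
    (L.posA x < L.posA y ∧ L.posB y < L.posB x) ∨ (L.posA y < L.posA x ∧ L.posB x < L.posB y) := by
  simp only [posA_fin, posB_fin, Crosses, Fin.lt_def]

lemma mem_X_crosses {x y : Fin L.edges.length} (h : s(L.edges.get x, L.edges.get y) ∈ P.X) :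
    Crosses (L.edges.get x) (L.edges.get y) := by
  obtain ⟨e, -, f, -, hc, he⟩ := P.X_subset h
  rcases Sym2.eq_iff.1 he with ⟨h1, h2⟩ | ⟨h1, h2⟩
  · rw [h1, h2]; exact hc
  · rw [h1, h2]; exact crosses_comm.1 hc

lemma pair_mem {p : ℕ} (hp : p < L.pairs.length) :
    s(L.edges.get L.pairs[p].1, L.edges.get L.pairs[p].2) ∈ P.X := by
  rw [← L.pairs_eq, List.mem_toFinset, List.mem_map]
  exact ⟨_, List.getElem_mem hp, rfl⟩

/-- The instance with numbered edges. -/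
noncomputable def layered : Layered where
  m := L.edges.length
  k := L.pairs.length
  a := L.posA
  b := L.posB
  w := L.wgt
  U i := if i < L.edges.length then i else L.upE (i - L.edges.length)
  D i := if i < L.edges.length then i else L.downE (i - L.edges.length)
  single i hi := by simp [hi]
  pair i h1 h2 := by
    have hp : i - L.edges.length < L.pairs.length := by omega
    generalize i - L.edges.length = p at hp
    have hc := (L.crosses_iff _ _).1 (L.mem_X_crosses (L.pair_mem hp))
    simp only [not_lt.2 h1, if_false]
    unfold upE downE fstE sndE
    simp only [hp, dite_true]
    split_ifs with h
    · exact ⟨L.pairs[p].1.2, L.pairs[p].2.2, h, by omega⟩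
    · exact ⟨L.pairs[p].2.2, L.pairs[p].1.2, by omega, by omega⟩
  w_pos e he := by
    simp only [wgt, he, dite_true]
    refine P.w_pos _ ?_
    rw [← L.edges_eq, List.mem_toFinset]
    exact List.getElem_mem he

lemma input_ok : Input L.layered L.input.mem L.input.rmem where
  a e he := by
    have he' : e < L.edges.length := he
    refine (flat_even _ _ _ L.edges e he').trans ?_
    simp [layered, posA, he']
  b e he := by
    have he' : e < L.edges.length := he
    refine (flat_odd _ _ _ L.edges e he').trans ?_
    simp [layered, posB, he']
  w e he := by
    have he' : e < L.edges.length := he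
    simp [input, layered, wgt, he']
  pair i h1 h2 := by
    have h1' : L.edges.length ≤ i := h1
    have h2' : i < L.edges.length + L.pairs.length := h2
    have hp : i - L.edges.length < L.pairs.length := by omega
    have e1 : L.input.mem (2 * i) = L.fstE (i - L.edges.length) := by
      have := flat_even (fun p : Fin L.edges.length × Fin L.edges.length => (p.1 : ℕ))
        (fun p => (p.2 : ℕ)) [] L.pairs _ hp
      rw [List.append_nil] at this
      simp only [input, fstE, hp, dite_true]
      rw [← this, List.getD_append_right _ _ _ _ (by rw [flat_length]; omega), flat_length]
      congr 1; omega
    have e2 : L.input.mem (2 * i + 1) = L.sndE (i - L.edges.length) := by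
      have := flat_odd (fun p : Fin L.edges.length × Fin L.edges.length => (p.1 : ℕ))
        (fun p => (p.2 : ℕ)) [] L.pairs _ hp
      rw [List.append_nil] at this
      simp only [input, sndE, hp, dite_true]
      rw [← this, List.getD_append_right _ _ _ _ (by rw [flat_length]; omega), flat_length]
      congr 1; omega
    rw [e1, e2]
    refine ⟨?_, ?_, fun h => ?_, fun h => ?_⟩
    · simp only [fstE, hp, dite_true]; exact Fin.is_lt _
    · simp only [sndE, hp, dite_true]; exact Fin.is_lt _
    · have h' : L.posA (L.fstE (i - L.edges.length)) < L.posA (L.sndE (i - L.edges.length)) := h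
      simp [layered, not_lt.2 h1', upE, downE, h']
    · have h' : ¬ L.posA (L.fstE (i - L.edges.length)) < L.posA (L.sndE (i - L.edges.length)) := h
      simp [layered, not_lt.2 h1', upE, downE, h']
  high x hx := by
    have hx' : 2 * L.edges.length + 2 * L.pairs.length ≤ x := hx
    refine List.getD_eq_default _ _ ?_
    rw [List.length_append, flat_length, flat_length]
    exact hx'

/-- The list gives an unordered pair in one of its two orders; orientation by upper endpoints
removes the ambiguity, and distinctness of listed edges recovers their positions. -/
lemma adj_iff (x y : Fin L.edges.length) : L.layered.Adj x y ↔
    L.posA x < L.posA y ∧ s(L.edges.get x, L.edges.get y) ∈ P.X := by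
  constructor
  · rintro ⟨i, h1, h2, h3, h4⟩
    have h1' : L.edges.length ≤ i := h1
    have h2' : i < L.edges.length + L.pairs.length := h2
    have hp : i - L.edges.length < L.pairs.length := by omega
    have hlt := (L.layered.pair i h1 h2).2.2.1
    rw [h3, h4] at hlt
    refine ⟨hlt, ?_⟩
    have hm := L.pair_mem hp
    simp only [layered, not_lt.2 h1', if_false, upE, downE, fstE, sndE, hp, dite_true] at h3 h4
    split_ifs at h3 h4
    · rwa [Fin.ext h3, Fin.ext h4] at hm
    · rwa [Fin.ext h3, Fin.ext h4, Sym2.eq_swap] at hm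
  · rintro ⟨hlt, hX⟩
    rw [← L.pairs_eq, List.mem_toFinset, List.mem_map] at hX
    obtain ⟨q, hq, he⟩ := hX
    obtain ⟨p, hp, rfl⟩ := List.mem_iff_getElem.1 hq
    have hinj := L.edges_nodup.injective_get
    refine ⟨L.edges.length + p, Nat.le_add_right _ _, Nat.add_lt_add_left hp _, ?_⟩
    simp only [layered, Nat.not_lt.2 (Nat.le_add_right _ _), if_false, Nat.add_sub_cancel_left, upE,
      downE, fstE, sndE, hp, dite_true]
    rcases Sym2.eq_iff.1 he with ⟨e1, e2⟩ | ⟨e1, e2⟩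
    · rw [hinj e1, hinj e2, if_pos hlt, if_pos hlt]; exact ⟨rfl, rfl⟩
    · rw [hinj e1, hinj e2, if_neg (by omega), if_neg (by omega)]; exact ⟨rfl, rfl⟩

/-! ### Translating between sets of edges and sets of numbers -/

lemma cr_iff (x y : Fin L.edges.length) :
    L.layered.Cr x y ↔ Crosses (L.edges.get x) (L.edges.get y) := (L.crosses_iff x y).symm

/-- The edges with numbers in `M`. -/
def decode (M : Finset ℕ) : Finset (Edge P.nA P.nB) :=
  (Finset.univ.filter fun x : Fin L.edges.length => (x : ℕ) ∈ M).image L.edges.get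

/-- The numbers of the edges in `M`. -/
def encode (M : Finset (Edge P.nA P.nB)) : Finset ℕ :=
  (Finset.univ.filter fun x : Fin L.edges.length => L.edges.get x ∈ M).image Fin.val

lemma mem_decode {M : Finset ℕ} {e : Edge P.nA P.nB} :
    e ∈ L.decode M ↔ ∃ x : Fin L.edges.length, (x : ℕ) ∈ M ∧ L.edges.get x = e := by
  simp [decode]

lemma get_mem_E (x : Fin L.edges.length) : L.edges.get x ∈ P.E := by
  rw [← L.edges_eq, List.mem_toFinset]; exact List.get_mem _ _

lemma decode_cpe {M : Finset ℕ} (h : L.layered.Valid M) : P.IsCPEMatching 2 (L.decode M) := by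
  have hne : ∀ x y : Fin L.edges.length, L.edges.get x ≠ L.edges.get y → (x : ℕ) ≠ y :=
    fun x y h h' => h (by rw [Fin.ext h'])
  have hcr : ∀ x y : Fin L.edges.length, Crosses (L.edges.get x) (L.edges.get y) → (x : ℕ) ≠ y := by
    intro x y hc h'
    rw [Fin.ext h'] at hc
    rcases hc with ⟨h, -⟩ | ⟨h, -⟩ <;> exact lt_irrefl _ h
  refine ⟨⟨?_, ?_⟩, ?_, ?_⟩
  · intro e he
    obtain ⟨x, -, rfl⟩ := L.mem_decode.1 he
    exact L.get_mem_E x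
  · intro e he f hf hef
    obtain ⟨x, hx, rfl⟩ := L.mem_decode.1 he
    obtain ⟨y, hy, rfl⟩ := L.mem_decode.1 hf
    have hab : L.posA x ≠ L.posA y ∧ L.posB x ≠ L.posB y := by
      rcases h.rel _ hx _ hy (hne x y hef) with h | h | h | h
      · exact ⟨h.1.ne, h.2.ne⟩
      · exact ⟨h.1.ne', h.2.ne'⟩
      · exact ⟨h.lt.2.2.1.ne, h.lt.2.2.2.ne'⟩
      · exact ⟨h.lt.2.2.1.ne', h.lt.2.2.2.ne⟩
    simp only [posA_fin, posB_fin] at hab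
    exact ⟨fun h => hab.1 (by rw [h]), fun h => hab.2 (by rw [h])⟩
  · rintro p ⟨e, he, f, hf, hc, rfl⟩
    obtain ⟨x, hx, rfl⟩ := L.mem_decode.1 he
    obtain ⟨y, hy, rfl⟩ := L.mem_decode.1 hf
    have hc' := (L.cr_iff x y).2 hc
    rcases h.rel _ hx _ hy (hcr x y hc) with h | h | h | h
    · exact (not_cr_of_lt h hc').elim
    · exact (not_cr_of_lt' h hc').elim
    · exact ((L.adj_iff x y).1 h).2
    · rw [Sym2.eq_swap]; exact ((L.adj_iff y x).1 h).2
  · intro e he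
    obtain ⟨x, hx, rfl⟩ := L.mem_decode.1 he
    by_contra! hcard
    obtain ⟨f1, f2, f3, m1, m2, m3, n12, n13, n23⟩ := Finset.two_lt_card_iff.1 hcard
    simp only [Finset.mem_filter, L.mem_decode] at m1 m2 m3
    obtain ⟨⟨y1, hy1, rfl⟩, c1⟩ := m1
    obtain ⟨⟨y2, hy2, rfl⟩, c2⟩ := m2
    obtain ⟨⟨y3, hy3, rfl⟩, c3⟩ := m3
    exact h.deg _ hx _ hy1 _ hy2 _ hy3 (hne _ _ n12) (hne _ _ n13) (hne _ _ n23)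
      ((L.cr_iff _ _).2 c1) ((L.cr_iff _ _).2 c2) ((L.cr_iff _ _).2 c3)

lemma mem_encode {M : Finset (Edge P.nA P.nB)} {e : ℕ} :
    e ∈ L.encode M ↔ ∃ x : Fin L.edges.length, L.edges.get x ∈ M ∧ (x : ℕ) = e := by
  simp [encode]

lemma encode_valid {M : Finset (Edge P.nA P.nB)} (h : P.IsCPEMatching 2 M) :
    L.layered.Valid (L.encode M) := by
  obtain ⟨⟨-, hm⟩, hX, hd⟩ := h
  have hinj := L.edges_nodup.injective_get
  refine ⟨?_, ?_, ?_⟩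
  · intro e he
    obtain ⟨x, -, rfl⟩ := L.mem_encode.1 he
    exact x.2
  · intro e he f hf hef
    obtain ⟨x, hx, rfl⟩ := L.mem_encode.1 he
    obtain ⟨y, hy, rfl⟩ := L.mem_encode.1 hf
    have hne : L.edges.get x ≠ L.edges.get y := fun h => hef (by rw [hinj h])
    obtain ⟨n1, n2⟩ := hm _ hx _ hy hne
    have hA : L.posA x ≠ L.posA y := by
      rw [posA_fin, posA_fin]; exact fun h => n1 (Fin.ext h)
    have hB : L.posB x ≠ L.posB y := by
      rw [posB_fin, posB_fin]; exact fun h => n2 (Fin.ext h)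
    by_cases hc : Crosses (L.edges.get x) (L.edges.get y)
    · have hXm : s(L.edges.get x, L.edges.get y) ∈ P.X := hX ⟨_, hx, _, hy, hc, rfl⟩
      rcases lt_or_gt_of_ne hA with h | h
      · exact Or.inr (Or.inr (Or.inl ((L.adj_iff x y).2 ⟨h, hXm⟩)))
      · rw [Sym2.eq_swap] at hXm
        exact Or.inr (Or.inr (Or.inr ((L.adj_iff y x).2 ⟨h, hXm⟩)))
    · rw [crosses_iff] at hc
      -- With distinct endpoints on both layers, two edges that do not cross are comparable.
      simp only [Layered.Lt, show L.layered.a = L.posA from rfl, show L.layered.b = L.posB from rfl]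
      omega
  · intro e he f1 h1 f2 h2 f3 h3 n12 n13 n23 c1 c2 c3
    obtain ⟨x, hx, rfl⟩ := L.mem_encode.1 he
    obtain ⟨y1, hy1, rfl⟩ := L.mem_encode.1 h1
    obtain ⟨y2, hy2, rfl⟩ := L.mem_encode.1 h2
    obtain ⟨y3, hy3, rfl⟩ := L.mem_encode.1 h3
    refine absurd (hd _ hx) (not_le.2 (Finset.two_lt_card_iff.2 ⟨_, _, _, ?_, ?_, ?_,
      fun h => n12 (congrArg Fin.val (hinj h)), fun h => n13 (congrArg Fin.val (hinj h)),
      fun h => n23 (congrArg Fin.val (hinj h))⟩))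
    · exact Finset.mem_filter.2 ⟨hy1, (L.cr_iff _ _).1 c1⟩
    · exact Finset.mem_filter.2 ⟨hy2, (L.cr_iff _ _).1 c2⟩
    · exact Finset.mem_filter.2 ⟨hy3, (L.cr_iff _ _).1 c3⟩

lemma wgt_fin (x : Fin L.edges.length) : L.wgt x = P.w (L.edges.get x) := by
  simp [wgt]

lemma weight_decode {M : Finset ℕ} (h : ∀ e ∈ M, e < L.edges.length) :
    P.weight (L.decode M) = L.layered.wt M := by
  have hinj := L.edges_nodup.injective_get
  rw [Problem.weight, decode, Finset.sum_image fun x _ y _ h => hinj h]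
  refine Finset.sum_bij (fun x _ => (x : ℕ)) ?_ ?_ ?_ ?_
  · intro x hx; simpa using hx
  · intro x _ y _ h; exact Fin.ext h
  · intro e he; exact ⟨⟨e, h e he⟩, by simpa using he, rfl⟩
  · intro x _; exact (L.wgt_fin x).symm

lemma weight_encode {M : Finset (Edge P.nA P.nB)} (h : M ⊆ P.E) :
    L.layered.wt (L.encode M) = P.weight M := by
  have hinj := L.edges_nodup.injective_get
  rw [Layered.wt, encode, Finset.sum_image fun x _ y _ h => Fin.ext h]
  refine Finset.sum_bij (fun x _ => L.edges.get x) ?_ ?_ ?_ ?_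
  · intro x hx; simpa using hx
  · intro x _ y _ h; exact hinj h
  · intro e he
    have := h he
    rw [← L.edges_eq, List.mem_toFinset] at this
    obtain ⟨x, rfl⟩ := List.mem_iff_get.1 this
    exact ⟨x, by simpa using he, rfl⟩
  · intro x _; exact L.wgt_fin x

lemma decode_max {M : Finset ℕ} (h : L.layered.Valid M)
    (hmax : ∀ M', L.layered.Valid M' → L.layered.wt M' ≤ L.layered.wt M) :
    P.IsMaxCPEMatching 2 (L.decode M) := by
  refine ⟨L.decode_cpe h, fun M' hM' => ?_⟩
  rw [L.weight_decode h.lt_m, ← L.weight_encode hM'.1.1]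
  exact hmax _ (L.encode_valid hM')

lemma reports {s : Store} {l : List ℕ} (hl : l.Nodup) (hm : ∀ e ∈ l, e < L.edges.length)
    (h0 : s.reg 0 = l.length) (hmem : ∀ (j : ℕ) (hj : j < l.length), s.mem j = l[j]) :
    L.Reports s (L.decode l.toFinset) := by
  refine ⟨l.pmap Fin.mk hm, hl.pmap fun a _ b _ h => Fin.mk.inj h, ?_, by simpa using h0, ?_⟩
  · ext e
    rw [List.mem_toFinset, List.mem_map, mem_decode]
    simp only [List.mem_pmap, List.mem_toFinset]
    constructor
    · rintro ⟨x, ⟨y, hy, rfl⟩, rfl⟩; exact ⟨_, hy, rfl⟩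
    · rintro ⟨x, hx, rfl⟩; exact ⟨x, ⟨x, hx, rfl⟩, rfl⟩
  · intro j hj
    simpa using hmem j (by simpa using hj)

/-- Since `2 * m * k ≤ m ^ 2 + k ^ 2`, the tables of size `8 * (m + k) ^ 2` need no mixed term; 66
also covers the additive 64. -/
lemma room {C : ℕ} (hC : 66 ≤ C) : L.layered.Room P.nA ((P.n + P.m + P.k + 2) ^ C)
    (C * (P.k ^ 2 + P.k * P.n + P.m ^ 2 + 1)) := by
  have hm := L.m_eq
  have hk := L.k_eq
  have hM : L.layered.m = P.m := hm.symm
  have hK : L.layered.k = P.k := hk.symm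
  -- The summand 2 makes the base at least 2, so eight extra powers absorb the constant 256.
  have hpow : 256 * (P.n + P.m + P.k + 2) ^ 2 ≤ (P.n + P.m + P.k + 2) ^ C := by
    calc 256 * (P.n + P.m + P.k + 2) ^ 2 = 2 ^ 8 * (P.n + P.m + P.k + 2) ^ 2 := by norm_num
      _ ≤ (P.n + P.m + P.k + 2) ^ 8 * (P.n + P.m + P.k + 2) ^ 2 := by gcongr; omega
      _ = (P.n + P.m + P.k + 2) ^ 10 := by ring
      _ ≤ _ := Nat.pow_le_pow_right (by omega) (by omega)
  have hnA : P.nA ≤ P.n := Nat.le_add_right _ _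
  refine ⟨?_, ?_, ?_, ?_⟩
  · intro e he
    have he' : e < L.edges.length := he
    simp [layered, posA, he']
  · nlinarith [Nat.zero_le (P.n + P.m + P.k)]
  · simp only [Layered.base, Layered.N, hM, hK]
    refine le_trans ?_ hpow
    nlinarith [Nat.zero_le (P.n * P.m), Nat.zero_le (P.n * P.k), Nat.zero_le (P.m * P.k),
      Nat.zero_le (P.n * P.n), Nat.zero_le (P.m * P.m), Nat.zero_le (P.k * P.k)]
  · simp only [Layered.base, Layered.N, hM, hK]
    calc 2 * P.m + 2 * P.k + 8 * ((P.m + P.k) * (P.m + P.k)) + 64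
        ≤ 66 * (P.k ^ 2 + P.k * P.n + P.m ^ 2 + 1) := by
          have h1 : P.m ≤ P.m ^ 2 := Nat.le_self_pow (by norm_num) _
          have h2 : P.k ≤ P.k ^ 2 := Nat.le_self_pow (by norm_num) _
          have h3 : 2 * (P.m * P.k) ≤ P.m ^ 2 + P.k ^ 2 := by
            have := two_mul_le_add_sq P.m P.k; nlinarith
          nlinarith [Nat.zero_le (P.k * P.n)]
      _ ≤ _ := Nat.mul_le_mul_right _ hC

end Presentation

/-! ### Running time -/

section Time

lemma candT_le : ∃ A, ∀ k, candT k ≤ A * (k + 1) := by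
  refine ⟨candT 0 + (pathBody .U .D).cst + 8 + (pathBody .D .U).cst + 8, fun k => ?_⟩
  have : candT k = candT 0 + k * ((pathBody .U .D).cst + 8 + (pathBody .D .U).cst + 8) := by
    unfold candT candB pathT; ring
  rw [this]
  nlinarith [Nat.zero_le (k * candT 0), Nat.zero_le k]

/-- Only the `k` pair items pay for the loop over predecessors; this keeps the cubic term at `k ^ 3`
instead of `(m + k) ^ 3`. -/
lemma sum_ite (m k c d : ℕ) :
    ∑ j ∈ Finset.range (m + k), (c + if j < m then 0 else d) = (m + k) * c + k * d := by
  rw [Finset.sum_add_distrib, Finset.sum_const, Finset.card_range, smul_eq_mul,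
    Finset.sum_range_add, Finset.sum_eq_zero fun j hj => if_pos (Finset.mem_range.1 hj), zero_add]
  simp

lemma poly_le (c1 c2 c3 c4 c5 c6 : ℕ) {A k m q : ℕ} (hq : q ≤ A * (k + 1)) :
    c1 + (m + k) * c2 + m * c3 + ((m + k) * (c5 + (m + k) * c4) + k * (6 + k * (q + c6))) ≤
      (c1 + 2 * c2 + c3 + 2 * c5 + 4 * c4 + 6 + 2 * A + c6) * (k ^ 3 + m ^ 2 + 1) := by
  have m1 : m ≤ m ^ 2 := Nat.le_self_pow (by norm_num) _
  have k1 : k ≤ k ^ 3 := Nat.le_self_pow (by norm_num) _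
  have k2 : k ^ 2 ≤ k ^ 3 := by
    rcases Nat.eq_zero_or_pos k with rfl | hk
    · simp
    · exact Nat.pow_le_pow_right hk (by norm_num)
  obtain ⟨Z, hZ⟩ : ∃ Z, Z = k ^ 3 + m ^ 2 + 1 := ⟨_, rfl⟩
  rw [← hZ]
  have z1 : m + k ≤ 2 * Z := by omega
  have z2 : (m + k) * (m + k) ≤ 4 * Z := by
    have h1 := two_mul_le_add_sq m k
    have h2 : (m + k) * (m + k) = m ^ 2 + 2 * m * k + k ^ 2 := by ring
    omega
  have z3 : k * (k * q) ≤ 2 * A * Z := by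
    calc k * (k * q) ≤ k * (k * (A * (k + 1))) := by gcongr
      _ = A * (k ^ 3 + k ^ 2) := by ring
      _ ≤ A * (2 * Z) := Nat.mul_le_mul_left _ (by omega)
      _ = 2 * A * Z := by ring
  have z4 : k * k ≤ Z := by rw [← sq]; omega
  have z0 : 1 ≤ Z := by omega
  have z5 : m ≤ Z := by omega
  have z6 : k ≤ Z := by omega
  calc c1 + (m + k) * c2 + m * c3 + ((m + k) * (c5 + (m + k) * c4) + k * (6 + k * (q + c6)))
      = c1 * 1 + c2 * (m + k) + c3 * m + c5 * (m + k) + c4 * ((m + k) * (m + k)) + 6 * k +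
        k * (k * q) + c6 * (k * k) := by ring
    _ ≤ c1 * Z + c2 * (2 * Z) + c3 * Z + c5 * (2 * Z) + c4 * (4 * Z) + 6 * Z + 2 * A * Z +
        c6 * Z := by gcongr
    _ = _ := by ring

/-- The running time of the program. -/
lemma wholeT_le : ∃ C, ∀ I : Layered, wholeT I ≤ C * (I.k ^ 3 + I.m ^ 2 + 1) := by
  -- The program constants are hidden behind existentials so that `ring` treats them as atoms.
  obtain ⟨A, hA⟩ := candT_le
  obtain ⟨c1, h1⟩ : ∃ c, c = pcst setupInit + 4 + initP.cst + ((HB.lt (.reg 0) .nn).c.cost + 1) + 6 :=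
    ⟨_, rfl⟩
  obtain ⟨c2, h2⟩ : ∃ c, c = pcst fillBody + 4 := ⟨_, rfl⟩
  obtain ⟨c3, h3⟩ : ∃ c, c = pcst outBody + 4 := ⟨_, rfl⟩
  obtain ⟨c4, h4⟩ : ∃ c, c = selBody.cst + 8 + (leftBody.cst + 8) := ⟨_, rfl⟩
  obtain ⟨c5, h5⟩ : ∃ c, c = (HP.setReg 4 .top).cst + 6 +
    (((HP.setRReg 1 .zero).seq (.setReg 5 (.lit 0))).cst + 6) + (baseRegP.cst + storeP.cst) +
      ((HB.lt (.reg 1) .mm).c.cost + 1 + 1) + endP.cst + ((HB.lt (.reg 0) .nn).c.cost + 1) :=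
    ⟨_, rfl⟩
  obtain ⟨c6, h6⟩ : ∃ c, c = (HB.eq (.reg 2) (.reg 1)).c.cost + 1 + (storeP.cst + updP.cst) + 1 + 8 :=
    ⟨_, rfl⟩
  have key : ∀ I : Layered, wholeT I = c1 + I.N * c2 + I.m * c3 + (I.N * (c5 + I.N * c4) +
      I.k * (6 + I.k * (candT I.k + c6))) := by
    intro I
    have hj : ∀ j, cost I j + ((HB.lt (.reg 0) .nn).c.cost + 1) = (c5 + I.N * c4) +
        if j < I.m then 0 else 6 + I.k * (candT I.k + c6) := by
      intro j
      rw [h4, h5, h6]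
      unfold cost selT leftT pairsT pairT
      split_ifs <;> ring
    have hs : ∑ j ∈ Finset.range I.N, (cost I j + ((HB.lt (.reg 0) .nn).c.cost + 1)) =
        I.N * (c5 + I.N * c4) + I.k * (6 + I.k * (candT I.k + c6)) := by
      rw [Finset.sum_congr rfl fun j _ => hj j]
      exact sum_ite _ _ _ _
    unfold wholeT
    rw [hs, h1, h2, h3]
    ring
  refine ⟨c1 + 2 * c2 + c3 + 2 * c5 + 4 * c4 + 6 + 2 * A + c6, fun I => ?_⟩
  rw [key]
  exact poly_le _ _ _ _ _ _ (hA I.k)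

end Time

end CPE

theorem mainTheorem3 :
    ∃ (P : RAM.Prog) (C : ℕ), ∀ (I : CPE.Problem) (L : CPE.Presentation I),
      ∃ (t : ℕ) (s : RAM.Store) (M : Finset (CPE.Edge I.nA I.nB)),
        RAM.Exec ((I.n + I.m + I.k + 2) ^ C) (C * (I.k ^ 2 + I.k * I.n + I.m ^ 2 + 1))
          P L.input t s ∧
        (t : ℝ) ≤ C * ((I.k : ℝ) ^ 3 + (I.k : ℝ) ^ 2 * I.n + I.m * (I.m + Real.log I.n) + 1) ∧
        L.Reports s M ∧ I.IsMaxCPEMatching 2 M := by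
  obtain ⟨C, hC⟩ := CPE.wholeT_le
  -- `C` serves the time bound and 66 the word and space bounds.
  refine ⟨CPE.wholeP, C + 66, fun I L => ?_⟩
  obtain ⟨t, s, l, he, ht, hl, hv, hmax, h0, hm⟩ := CPE.wholeP_run
    (L.room (C := C + 66) (by omega)) L.input_ok (s := L.input) rfl
    (L.m_eq.trans rfl) (L.k_eq.trans rfl) rfl rfl
  refine ⟨t, s, L.decode l.toFinset, he, ?_,
    L.reports hl (fun e he => hv.lt_m e (List.mem_toFinset.2 he)) h0 hm, L.decode_max hv hmax⟩
  have ht' := ht.trans (hC _)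
  rw [show L.layered.m = I.m from L.m_eq.symm, show L.layered.k = I.k from L.k_eq.symm] at ht'
  -- The terms `k ^ 2 * n` and `m * log n` are pure slack and only have to be nonnegative; for `n =
  -- 0` the logarithm is `0`.
  have hlog : 0 ≤ Real.log I.n := Real.log_natCast_nonneg _
  have h1 : (0 : ℝ) ≤ (I.k : ℝ) ^ 2 * I.n := by positivity
  have h2 : (0 : ℝ) ≤ I.m * Real.log I.n := by positivity
  have h3 : (0 : ℝ) ≤ (I.k : ℝ) ^ 3 + (I.m : ℝ) ^ 2 + 1 := by positivity
  calc (t : ℝ) ≤ C * ((I.k : ℝ) ^ 3 + (I.m : ℝ) ^ 2 + 1) := by exact_mod_cast ht'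
    _ ≤ ((C + 66 : ℕ) : ℝ) * ((I.k : ℝ) ^ 3 + (I.m : ℝ) ^ 2 + 1) := by
        gcongr; omega
    _ ≤ _ := by
        refine mul_le_mul_of_nonneg_left ?_ (by positivity)
        rw [mul_add, ← sq]
        linarith
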